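/- Let $N\ge 3$, $0<\gamma<\frac{(N-2)^2}{4}$ and $2^\star=\frac{2N}{N-2}$. Let $H^1(\mathbb R^N)$ be the closure of $C_c^\infty(\mathbb R^N)$ with respect to the norm $\|\nabla u\|_{L^2}$ (a space of functions in $L^{2^\star}(\mathbb R^N)$ with weak gradient in $L^2$), and for $u\in H^1(\mathbb R^N)$ put $$\|u\|_\gamma^2=\int_{\mathbb R^N}\Big(|\nabla u|^2-\frac{\gamma}{|x|^2}u^2\Big)\,dx .$$ Let $S_\gamma$ be the optimal (largest) constant such that $S_\gamma\|u\|_{L^{2^\star}}^2\le\|u\|_\gamma^2$ for all $u\in H^1(\mathbb R^N)$. Let $$U_\gamma(x)=C_{\gamma,N}\Big(|x|^{\frac{2\beta_+}{N-2}}+|x|^{\frac{2\beta_-}{N-2}}\Big)^{-\frac{N-2}{2}},\qquad \beta_\pm=\frac{N-2}{2}\pm\sqrt{\frac{(N-2)^2}{4}-\gamma},$$ where $C_{\gamma,N}>0$ is chosen so that $\|U_\gamma\|_{L^{2^\star}}=1$, let $U_\gamma[\lambda](x)=\lambda^{\frac{N-2}{2}}U_\gamma(\lambda x)$ for $\lambda>0$,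 and let $\mathcal M=\{c\,U_\gamma[\lambda]:c\in\mathbb R,\ \lambda>0\}$ and $$\operatorname{dist}(u,\mathcal M)^2=\inf_{c\in\mathbb R,\ \lambda>0}\|u-c\,U_\gamma[\lambda]\|_\gamma^2 .$$ Define the best radial Bianchi--Egnell constant $$C_{\mathrm{BE}}^{\mathrm{rad}}(\gamma)=\inf\left\{\frac{\|u\|_\gamma^2-S_\gamma\|u\|_{L^{2^\star}}^2}{\operatorname{dist}(u,\mathcal M)^2}\;:\;u\in H^1(\mathbb R^N)\text{ radial},\ u\notin\mathcal M\right\}.$$ Then $C_{\mathrm{BE}}^{\mathrm{rad}}(\gamma)$ is a well-defined real number (the infimum of a nonempty set of reals that is bounded below), and $$C_{\mathrm{BE}}^{\mathrm{rad}}(\gamma)<2-2^{\frac{2}{2^\star}} .$$ -/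

import Mathlib

open MeasureTheory Filter Topology
open scoped ContDiff ENNReal

noncomputable section

namespace HardySobolev

/-- `ℝ^N` with its Euclidean norm and Lebesgue measure. -/
abbrev Space (N : ℕ) : Type := EuclideanSpace ℝ (Fin N)

/-- The critical Sobolev exponent `2^⋆ = 2N/(N-2)`. -/
def critExp (N : ℕ) : ℝ := 2 * (N : ℝ) / ((N : ℝ) - 2)

/-- `∇u = G` in the completion of `C_c^∞(ℝ^N)` under the norm `‖∇φ‖_{L²}`: there are test functions
`φ n` with `∇φ n → G` in `L²` and `φ n → u` in `L^{2^⋆}`. By the Sobolev inequality, convergence in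
the norm `‖∇φ‖_{L²}` forces convergence in `L^{2^⋆}`, so that the completion is this space of
functions. -/
def HasH1Gradient (N : ℕ) (u : Space N → ℝ) (G : Space N → Space N) : Prop :=
  MemLp u (ENNReal.ofReal (critExp N)) volume ∧ MemLp G 2 volume ∧
    ∃ φ : ℕ → Space N → ℝ,
      (∀ n, ContDiff ℝ ∞ (φ n) ∧ HasCompactSupport (φ n)) ∧
      Tendsto (fun n => eLpNorm (φ n - u) (ENNReal.ofReal (critExp N)) volume) atTop (𝓝 0) ∧
      Tendsto (fun n => eLpNorm (gradient (φ n) - G) 2 volume) atTop (𝓝 0)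

/-- `u ∈ H¹(ℝ^N)`, the closure of `C_c^∞(ℝ^N)` with respect to the norm `‖∇u‖_{L²}`. -/
def MemH1 (N : ℕ) (u : Space N → ℝ) : Prop := ∃ G, HasH1Gradient N u G

open Classical in
/-- The (weak) gradient of `u ∈ H¹(ℝ^N)`, unique up to null sets by `HasH1Gradient.ae_unique`;
it is `0` by convention if `u ∉ H¹(ℝ^N)`. -/
def grad (N : ℕ) (u : Space N → ℝ) : Space N → Space N :=
  if h : MemH1 N u then h.choose else 0

theorem MemH1.hasH1Gradient_grad {N : ℕ} {u : Space N → ℝ} (h : MemH1 N u) :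
    HasH1Gradient N u (grad N u) := by
  rw [grad, dif_pos h]
  exact h.choose_spec

theorem one_le_critExp {N : ℕ} (hN : 3 ≤ N) : 1 ≤ critExp N := by
  have h : (3 : ℝ) ≤ N := by exact_mod_cast hN
  rw [critExp, le_div_iff₀ (by linarith)]
  linarith

theorem tendsto_integral_mul_zero {N : ℕ} {p q : ℝ≥0∞} [hpq : ENNReal.HolderConjugate p q]
    {f : ℕ → Space N → ℝ} {g : Space N → ℝ} (hf : ∀ n, AEStronglyMeasurable (f n) volume)
    (hg : MemLp g q volume) (h0 : Tendsto (fun n => eLpNorm (f n) p volume) atTop (𝓝 0)) :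
    Tendsto (fun n => ∫ x, f n x * g x) atTop (𝓝 0) := by
  have key : Tendsto (fun n => eLpNorm (f n) p volume * eLpNorm g q volume) atTop (𝓝 0) := by
    have := ENNReal.Tendsto.mul_const (b := eLpNorm g q volume) h0 (Or.inr hg.2.ne)
    simpa using this
  rw [tendsto_zero_iff_enorm_tendsto_zero]
  refine tendsto_of_tendsto_of_tendsto_of_le_of_le tendsto_const_nhds key (fun _ => zero_le) ?_
  intro n
  have h1 : ‖∫ x, f n x * g x‖ₑ ≤ eLpNorm (f n • g) 1 volume := by
    rw [eLpNorm_one_eq_lintegral_enorm]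
    exact enorm_integral_le_lintegral_enorm _
  exact h1.trans (eLpNorm_smul_le_mul_eLpNorm hg.1 (hf n))

/-- The gradient of an element of `H¹(ℝ^N)` is well defined up to null sets. -/
theorem HasH1Gradient.ae_unique {N : ℕ} (hN : 3 ≤ N) {u : Space N → ℝ}
    {G H : Space N → Space N} (hG : HasH1Gradient N u G) (hH : HasH1Gradient N u H) :
    G =ᵐ[volume] H := by
  obtain ⟨hu, hG2, φ, hφ, hφu, hφG⟩ := hG
  obtain ⟨-, hH2, ψ, hψ, hψu, hψH⟩ := hH
  set p : ℝ≥0∞ := ENNReal.ofReal (critExp N) with hp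
  have hp1 : 1 ≤ p := by
    rw [hp, ← ENNReal.ofReal_one]; exact ENNReal.ofReal_le_ofReal (one_le_critExp hN)
  -- the difference of the two approximating sequences
  set v : ℕ → Space N → ℝ := fun n => φ n - ψ n with hv
  have hvs : ∀ n, ContDiff ℝ ∞ (v n) := fun n => (hφ n).1.sub (hψ n).1
  have hvc : ∀ n, HasCompactSupport (v n) := fun n => (hφ n).2.sub (hψ n).2
  have hd : ∀ {f : Space N → ℝ}, ContDiff ℝ ∞ f → Differentiable ℝ f :=
    fun hf => hf.differentiable (by simp)
  have hgv : ∀ n, gradient (v n) = gradient (φ n) - gradient (ψ n) := by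
    intro n; funext x
    simp only [gradient, hv, Pi.sub_apply]
    rw [fderiv_sub (hd (hφ n).1 x) (hd (hψ n).1 x), map_sub]
  have hgm : ∀ {f : Space N → ℝ}, ContDiff ℝ ∞ f → AEStronglyMeasurable (gradient f) volume := by
    intro f hf
    have : Continuous (gradient f) :=
      (InnerProductSpace.toDual ℝ (Space N)).symm.continuous.comp (hf.continuous_fderiv (by simp))
    exact this.aestronglyMeasurable
  have hv0 : Tendsto (fun n => eLpNorm (v n) p volume) atTop (𝓝 0) := by
    have hs := hφu.add hψu
    rw [add_zero] at hs
    refine tendsto_of_tendsto_of_tendsto_of_le_of_le tendsto_const_nhds hs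
      (fun _ => zero_le) (fun n => ?_)
    have : v n = (φ n - u) - (ψ n - u) := by simp [hv]
    rw [this]
    exact eLpNorm_sub_le ((hφ n).1.continuous.aestronglyMeasurable.sub hu.1)
      ((hψ n).1.continuous.aestronglyMeasurable.sub hu.1) hp1
  have hK0 : Tendsto (fun n => eLpNorm (gradient (v n) - (G - H)) 2 volume) atTop (𝓝 0) := by
    have hs := hφG.add hψH
    rw [add_zero] at hs
    refine tendsto_of_tendsto_of_tendsto_of_le_of_le tendsto_const_nhds hs
      (fun _ => zero_le) (fun n => ?_)
    have : gradient (v n) - (G - H) = (gradient (φ n) - G) - (gradient (ψ n) - H) := by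
      rw [hgv]; abel
    rw [this]
    exact eLpNorm_sub_le ((hgm (hφ n).1).sub hG2.1) ((hgm (hψ n).1).sub hH2.1) (by norm_num)
  have hK2 : MemLp (G - H) 2 volume := hG2.sub hH2
  have hKloc : LocallyIntegrable (G - H) volume := hK2.locallyIntegrable (by norm_num)
  have hzero : ∀ᵐ x, (G - H) x = 0 := by
    refine ae_eq_zero_of_integral_contDiff_smul_eq_zero hKloc (fun η hη hηc => ?_)
    refine ext_inner_left ℝ (fun e => ?_)
    have hηi : Integrable (fun x => η x • (G - H) x) volume :=
      hKloc.integrable_smul_left_of_hasCompactSupport hη.continuous hηc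
    rw [inner_zero_right, ← integral_inner hηi]
    have hη2 : MemLp η 2 volume := hη.continuous.memLp_of_hasCompactSupport hηc
    have hη' : Continuous (fun x => fderiv ℝ η x e) :=
      (hη.continuous_fderiv (by simp)).clm_apply continuous_const
    have hηc' : HasCompactSupport (fun x => fderiv ℝ η x e) := hηc.fderiv_apply (𝕜 := ℝ) e
    -- first limit
    have l1 : Tendsto (fun n => ∫ x, inner ℝ e ((gradient (v n) - (G - H)) x) * η x)
        atTop (𝓝 0) := by
      refine tendsto_integral_mul_zero (p := 2) (q := 2) (fun n => ?_) hη2 ?_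
      · exact ((hgm (hvs n)).sub hK2.1).const_inner
      · have hs : Tendsto (fun n => ENNReal.ofReal ‖e‖ *
            eLpNorm (gradient (v n) - (G - H)) 2 volume) atTop (𝓝 0) := by
          have := ENNReal.Tendsto.const_mul (a := ENNReal.ofReal ‖e‖) hK0
            (Or.inr ENNReal.ofReal_ne_top)
          simpa using this
        refine tendsto_of_tendsto_of_tendsto_of_le_of_le tendsto_const_nhds hs
          (fun _ => zero_le) (fun n => ?_)
        exact eLpNorm_le_mul_eLpNorm_of_ae_le_mul
          (Eventually.of_forall fun x => norm_inner_le_norm _ _) 2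
    -- second limit
    have l2 : Tendsto (fun n => ∫ x, v n x * fderiv ℝ η x e) atTop (𝓝 0) := by
      have : ENNReal.HolderConjugate p p.conjExponent := .conjExponent hp1
      exact tendsto_integral_mul_zero (p := p) (q := p.conjExponent)
        (fun n => (hvs n).continuous.aestronglyMeasurable)
        (hη'.memLp_of_hasCompactSupport hηc') hv0
    have heq : ∀ n, ∫ x, inner ℝ e ((gradient (v n) - (G - H)) x) * η x =
        -(∫ x, v n x * fderiv ℝ η x e) - ∫ x, inner ℝ e (η x • (G - H) x) := by
      intro n
      have hv' : Continuous (fun x => fderiv ℝ (v n) x e) :=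
        ((hvs n).continuous_fderiv (by simp)).clm_apply continuous_const
      have i1 : Integrable (fun x => fderiv ℝ (v n) x e * η x) volume :=
        (hv'.mul hη.continuous).integrable_of_hasCompactSupport hηc.mul_left
      have i2 : Integrable (fun x => v n x * fderiv ℝ η x e) volume :=
        ((hvs n).continuous.mul hη').integrable_of_hasCompactSupport hηc'.mul_left
      have i3 : Integrable (fun x => v n x * η x) volume :=
        ((hvs n).continuous.mul hη.continuous).integrable_of_hasCompactSupport hηc.mul_left
      have ibp := integral_mul_fderiv_eq_neg_fderiv_mul_of_integrable i1 i2 i3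
        (fun x _ => hd (hvs n) x) (fun x _ => hd hη x)
      rw [ibp, neg_neg, ← integral_sub i1 (hηi.const_inner e)]
      refine integral_congr_ae (Eventually.of_forall fun x => ?_)
      have hin : inner ℝ e (gradient (v n) x) = fderiv ℝ (v n) x e := by
        rw [real_inner_comm, gradient, InnerProductSpace.toDual_symm_apply]
      simp only [Pi.sub_apply, inner_sub_right, real_inner_smul_right] at hin ⊢
      rw [hin]; ring
    have l3 := l1.add l2
    simp only [heq, add_zero] at l3
    have l4 : Tendsto (fun _ : ℕ => -∫ x, inner ℝ e (η x • (G - H) x)) atTop (𝓝 0) := by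
      refine l3.congr (fun n => ?_)
      ring
    have := tendsto_nhds_unique l4 tendsto_const_nhds
    linarith
  filter_upwards [hzero] with x hx
  exact sub_eq_zero.mp hx

/-- The quadratic form `‖u‖_γ² = ∫ (|∇u|² - γ |x|^{-2} u²) dx`. -/
def energy (N : ℕ) (γ : ℝ) (u : Space N → ℝ) : ℝ :=
  ∫ x, (‖grad N u x‖ ^ 2 - γ / ‖x‖ ^ 2 * u x ^ 2)

/-- The norm `‖u‖_{L^{2^⋆}}`. -/
def critNorm (N : ℕ) (u : Space N → ℝ) : ℝ :=
  (∫ x, |u x| ^ critExp N) ^ (1 / critExp N)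

/-- The optimal constant `S_γ` in `S ‖u‖²_{L^{2^⋆}} ≤ ∫ (|∇u|² - γ |x|^{-2} u²) dx`, for all
`u ∈ H¹(ℝ^N)`. -/
def bestConst (N : ℕ) (γ : ℝ) : ℝ :=
  sSup {S : ℝ | ∀ u, MemH1 N u → S * critNorm N u ^ 2 ≤ energy N γ u}

/-- `β_+(γ)`. -/
def betaPlus (N : ℕ) (γ : ℝ) : ℝ :=
  ((N : ℝ) - 2) / 2 + Real.sqrt (((N : ℝ) - 2) ^ 2 / 4 - γ)

/-- `β_-(γ)`. -/
def betaMinus (N : ℕ) (γ : ℝ) : ℝ :=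
  ((N : ℝ) - 2) / 2 - Real.sqrt (((N : ℝ) - 2) ^ 2 / 4 - γ)

/-- The bubble before normalization: the power `-(N-2)/2` of the sum of the two powers
`2β_±/(N-2)` of `|x|`. -/
def profile (N : ℕ) (γ : ℝ) (x : Space N) : ℝ :=
  1 / (‖x‖ ^ (2 * betaPlus N γ / ((N : ℝ) - 2)) +
    ‖x‖ ^ (2 * betaMinus N γ / ((N : ℝ) - 2))) ^ (((N : ℝ) - 2) / 2)

/-- The Hardy-Sobolev bubble `U_γ`, normalized in `L^{2^⋆}`. -/
def bubble (N : ℕ) (γ : ℝ) (x : Space N) : ℝ :=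
  1 / critNorm N (profile N γ) * profile N γ x

/-- The dilated bubble `U_γ[l](x) = l^{(N-2)/2} U_γ(l x)`. -/
def dilatedBubble (N : ℕ) (γ l : ℝ) (x : Space N) : ℝ :=
  l ^ (((N : ℝ) - 2) / 2) * bubble N γ (l • x)

/-- `u` belongs (as a class of functions modulo null sets) to
`{c U_γ[l] : c ∈ ℝ, l > 0}`, the set of extremizers together with `0`. -/
def IsExtremizer (N : ℕ) (γ : ℝ) (u : Space N → ℝ) : Prop :=
  ∃ c l : ℝ, 0 < l ∧ u =ᵐ[volume] fun x => c * dilatedBubble N γ l x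

/-- `dist(u, M_HS)² = inf_{c ∈ ℝ, l > 0} ‖u - c U_γ[l]‖_γ²`. -/
def distSq (N : ℕ) (γ : ℝ) (u : Space N → ℝ) : ℝ :=
  ⨅ p : ℝ × Set.Ioi (0 : ℝ),
    energy N γ (fun x => u x - p.1 * dilatedBubble N γ (p.2 : ℝ) x)

/-- The Hardy-Sobolev deficit `δ(u)`. -/
def deficit (N : ℕ) (γ : ℝ) (u : Space N → ℝ) : ℝ :=
  energy N γ u - bestConst N γ * critNorm N u ^ 2

/-- `u` is radial (up to a null set). -/
def IsRadial (N : ℕ) (u : Space N → ℝ) : Prop :=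
  ∃ f : ℝ → ℝ, u =ᵐ[volume] fun x => f ‖x‖

/-- The set of values of the Bianchi-Egnell quotient `δ(u) / dist(u, M_HS)²` over the radial
functions `u ∈ H¹(ℝ^N)` outside the set of extremizers. -/
def radialQuotients (N : ℕ) (γ : ℝ) : Set ℝ :=
  {q : ℝ | ∃ u, MemH1 N u ∧ IsRadial N u ∧ ¬ IsExtremizer N γ u ∧
    q = deficit N γ u / distSq N γ u}

/-- The best radial Bianchi-Egnell constant. -/
def radialBianchiEgnell (N : ℕ) (γ : ℝ) : ℝ := sInf (radialQuotients N γ)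

end HardySobolev

end

open MeasureTheory Filter Topology
open scoped ContDiff ENNReal

noncomputable section

namespace HardySobolev

open Set

/-! Write μ = (N-2)/2, p = 2^⋆ = 2 + 2/μ, r = 2/p, and γ = μ²(1-σ²) with 0 < σ < 1. The Emden–Fowler
substitution u(x) = |x|^{-μ} w(σ log|x|) moves the radial problem to the line. There ‖u‖_γ² is a
constant multiple of ∫(w'² + μ²w²), ‖u‖_p^p is a constant multiple of ∫|w|^p, and the dilated
bubbles become multiples of translates of b(t) = (2 cosh t)^{-μ}, which solves -b'' + μ²b = 4μ(μ+1)
b^{p-1}.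

The competitor w is the sum of two copies of b centred at L and -L, with L large. Let Q be the
energy of b, I(s) the energy pairing of two copies at distance s, and ε = I(2L), which tends to 0.
The energy of w is 2Q + 2ε. Also ∫w^p ≥ 2(∫b^p)(1 + pε/Q) - o(ε), so the normalized term S‖w‖_p² is
at least 2^r Q + 2·2^r ε - o(ε), and the deficit is at most (2 - 2^r)Q - 2(2^r - 1)ε + o(ε). The
squared distance to the single bubbles is 2Q + 2ε - sup_s (I(s-L) + I(s+L))²/Q. The supremum of the
sum is at most Q + ε + O(ε²), so the terms of order ε cancel and the squared distance is at least Q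
- O(ε²). The quotient is therefore strictly below 2 - 2^r. This is `exists_twoBubble`, resting on
`le_integral_twoBubble_rpow` and `exists_interaction_add_le`.

The constant S_γ is optimal among all functions, not only radial ones, so bounding the deficit from
above requires S_γ to be at least the quotient of the bubble: this is the sharp Hardy–Sobolev
inequality. The case γ = 0 is proved by mass transport (`knothe_sobolev_box`, `sobolev_sharp`). The
triangular Knothe map suffices because the argument uses only the diagonal derivatives of the map
and its Monge–Ampère equation. The case γ > 0 follows through the radial substitution x =
|y|^{1/σ-1} y (`hardySobolev_annular`) and density of functions supported in annuli. The same
inequality makes deficits and distances nonnegative, so the quotients are bounded below by 0. -/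

/-! ### Monotone transport on the line -/

/-- The increasing map transporting the (normalized) density `ρ` on `ℝ` to the (normalized) density
`g` on the interval `(-R, R)`. -/
def transport (ρ g : ℝ → ℝ) (R x : ℝ) : ℝ :=
  Function.invFun (fun y => ∫ s in (-R)..y, g s)
    ((∫ s in (-R)..R, g s) * (∫ s in Iic x, ρ s) / ∫ s, ρ s)

theorem strictMono_intervalIntegral {g : ℝ → ℝ} (hg : Continuous g) (hg0 : ∀ x, 0 < g x) (a : ℝ) :
    StrictMono (fun y => ∫ s in a..y, g s) := by
  intro x y hxy
  have h := intervalIntegral.integral_add_adjacent_intervals (hg.intervalIntegrable (μ := volume) a x)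
    (hg.intervalIntegrable x y)
  have h2 : 0 < ∫ s in x..y, g s :=
    intervalIntegral.intervalIntegral_pos_of_pos (hg.intervalIntegrable x y) hg0 hxy
  simp only
  linarith

theorem strictMono_integral_Iic {ρ : ℝ → ℝ} (hρ : Continuous ρ) (hρ0 : ∀ x, 0 < ρ x)
    (hρi : Integrable ρ) : StrictMono (fun x => ∫ s in Iic x, ρ s) := by
  intro x y hxy
  have h := intervalIntegral.integral_Iic_sub_Iic (a := x) (b := y) hρi.integrableOn hρi.integrableOn
  have h2 : 0 < ∫ s in x..y, ρ s :=
    intervalIntegral.intervalIntegral_pos_of_pos (hρ.intervalIntegrable x y) hρ0 hxy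
  simp only
  linarith

theorem integral_Iic_pos {ρ : ℝ → ℝ} (hρ : Continuous ρ) (hρ0 : ∀ x, 0 < ρ x)
    (hρi : Integrable ρ) (x : ℝ) : 0 < ∫ s in Iic x, ρ s := by
  have h := strictMono_integral_Iic hρ hρ0 hρi (show x - 1 < x by linarith)
  have h1 : 0 ≤ ∫ s in Iic (x - 1), ρ s := integral_nonneg fun s => (hρ0 s).le
  exact h1.trans_lt h

theorem integral_Iic_lt {ρ : ℝ → ℝ} (hρ : Continuous ρ) (hρ0 : ∀ x, 0 < ρ x)
    (hρi : Integrable ρ) (x : ℝ) : ∫ s in Iic x, ρ s < ∫ s, ρ s := by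
  have h := strictMono_integral_Iic hρ hρ0 hρi (show x < x + 1 by linarith)
  exact h.trans_le (setIntegral_le_integral hρi (Eventually.of_forall fun s => (hρ0 s).le))

section

variable {ρ g : ℝ → ℝ} {R : ℝ}

theorem exists_intervalIntegral_eq (hg : Continuous g) (hR : 0 < R) {c : ℝ}
    (h0 : 0 < c) (h1 : c < ∫ s in (-R)..R, g s) :
    ∃ y ∈ Ioo (-R) R, ∫ s in (-R)..y, g s = c := by
  have hc : Continuous (fun y => ∫ s in (-R)..y, g s) :=
    intervalIntegral.continuous_primitive (fun a b => hg.intervalIntegrable a b) _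
  have := intermediate_value_Ioo (show -R ≤ R by linarith) hc.continuousOn
  obtain ⟨y, hy, hy'⟩ := this (show c ∈ Ioo _ _ by simpa using ⟨h0, h1⟩)
  exact ⟨y, hy, hy'⟩

theorem transport_level_mem (hρ : Continuous ρ) (hρ0 : ∀ x, 0 < ρ x) (hρi : Integrable ρ)
    (hg : Continuous g) (hg0 : ∀ x, 0 < g x) (hR : 0 < R) (x : ℝ) :
    (∫ s in (-R)..R, g s) * (∫ s in Iic x, ρ s) / (∫ s, ρ s) ∈ Ioo 0 (∫ s in (-R)..R, g s) := by
  have h1 := integral_Iic_pos hρ hρ0 hρi x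
  have h2 := integral_Iic_lt hρ hρ0 hρi x
  have h3 : 0 < ∫ s in (-R)..R, g s :=
    intervalIntegral.intervalIntegral_pos_of_pos (hg.intervalIntegrable _ _) hg0 (by linarith)
  have h4 := h1.trans h2
  constructor
  · positivity
  · rw [div_lt_iff₀ h4]
    exact mul_lt_mul_of_pos_left h2 h3

/-- The level lies strictly between 0 and the total mass of `g`, hence in the range of the
primitive, so `invFun` really inverts there. -/
theorem intervalIntegral_transport (hρ : Continuous ρ) (hρ0 : ∀ x, 0 < ρ x) (hρi : Integrable ρ)
    (hg : Continuous g) (hg0 : ∀ x, 0 < g x) (hR : 0 < R) (x : ℝ) :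
    ∫ s in (-R)..(transport ρ g R x), g s =
      (∫ s in (-R)..R, g s) * (∫ s in Iic x, ρ s) / ∫ s, ρ s := by
  have h := transport_level_mem hρ hρ0 hρi hg hg0 hR x
  obtain ⟨y, -, hy⟩ := exists_intervalIntegral_eq hg hR h.1 h.2
  exact Function.invFun_eq (f := fun y => ∫ s in (-R)..y, g s) ⟨y, hy⟩

/-- Sublevel sets of the map become comparisons of integrals; monotonicity and joint measurability
both reduce to this. -/
theorem transport_lt_iff (hρ : Continuous ρ) (hρ0 : ∀ x, 0 < ρ x) (hρi : Integrable ρ)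
    (hg : Continuous g) (hg0 : ∀ x, 0 < g x) (hR : 0 < R) (x c : ℝ) :
    transport ρ g R x < c ↔
      (∫ s in (-R)..R, g s) * (∫ s in Iic x, ρ s) / (∫ s, ρ s) < ∫ s in (-R)..c, g s := by
  rw [← intervalIntegral_transport hρ hρ0 hρi hg hg0 hR]
  exact (strictMono_intervalIntegral hg hg0 (-R)).lt_iff_lt.symm

theorem transport_mem (hρ : Continuous ρ) (hρ0 : ∀ x, 0 < ρ x) (hρi : Integrable ρ)
    (hg : Continuous g) (hg0 : ∀ x, 0 < g x) (hR : 0 < R) (x : ℝ) :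
    transport ρ g R x ∈ Ioo (-R) R := by
  have h := transport_level_mem hρ hρ0 hρi hg hg0 hR x
  obtain ⟨y, hy, hy'⟩ := exists_intervalIntegral_eq hg hR h.1 h.2
  rw [← intervalIntegral_transport hρ hρ0 hρi hg hg0 hR] at hy'
  rwa [← (strictMono_intervalIntegral hg hg0 (-R)).injective hy']

theorem strictMono_transport (hρ : Continuous ρ) (hρ0 : ∀ x, 0 < ρ x) (hρi : Integrable ρ)
    (hg : Continuous g) (hg0 : ∀ x, 0 < g x) (hR : 0 < R) :
    StrictMono (transport ρ g R) := by
  intro x y hxy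
  rw [transport_lt_iff hρ hρ0 hρi hg hg0 hR, intervalIntegral_transport hρ hρ0 hρi hg hg0 hR]
  have h3 : 0 < ∫ s in (-R)..R, g s :=
    intervalIntegral.intervalIntegral_pos_of_pos (hg.intervalIntegrable _ _) hg0 (by linarith)
  have h4 := (integral_Iic_pos hρ hρ0 hρi x).trans (integral_Iic_lt hρ hρ0 hρi x)
  have h5 := strictMono_integral_Iic hρ hρ0 hρi hxy
  simp only at h5
  gcongr

/-- The distribution function of `ρ` is continuous with limits 0 and the total mass, so it attains
every level in between. -/
theorem range_transport (hρ : Continuous ρ) (hρ0 : ∀ x, 0 < ρ x) (hρi : Integrable ρ)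
    (hg : Continuous g) (hg0 : ∀ x, 0 < g x) (hR : 0 < R) :
    range (transport ρ g R) = Ioo (-R) R := by
  apply Subset.antisymm
  · rintro _ ⟨x, rfl⟩
    exact transport_mem hρ hρ0 hρi hg hg0 hR x
  · intro y hy
    have h3 : 0 < ∫ s in (-R)..R, g s :=
      intervalIntegral.intervalIntegral_pos_of_pos (hg.intervalIntegrable _ _) hg0 (by linarith)
    have h4 := (integral_Iic_pos hρ hρ0 hρi 0).trans (integral_Iic_lt hρ hρ0 hρi 0)
    have hm := strictMono_intervalIntegral hg hg0 (-R)
    have hy1 := hm hy.1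
    have hy2 := hm hy.2
    simp only [intervalIntegral.integral_same] at hy1 hy2
    have hcont : Continuous (fun x => ∫ s in Iic x, ρ s) := by
      have : (fun x => ∫ s in Iic x, ρ s) = fun x => (∫ s in Iic 0, ρ s) + ∫ s in (0:ℝ)..x, ρ s := by
        funext x
        have := intervalIntegral.integral_Iic_sub_Iic (a := 0) (b := x) hρi.integrableOn
          hρi.integrableOn
        linarith
      rw [this]
      exact continuous_const.add
        (intervalIntegral.continuous_primitive (fun a b => hρ.intervalIntegrable a b) _)
    have hbot : Tendsto (fun x => ∫ s in Iic x, ρ s) atBot (𝓝 0) := by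
      have h := (intervalIntegral_tendsto_integral_Iic 0 (f := ρ) (μ := volume) hρi.integrableOn tendsto_id)
      have h2 := (tendsto_const_nhds (x := ∫ s in Iic 0, ρ s)).sub h
      rw [sub_self] at h2
      refine h2.congr fun x => ?_
      have := intervalIntegral.integral_Iic_sub_Iic (a := x) (b := 0) hρi.integrableOn
          hρi.integrableOn
      simp only [id]
      linarith
    have htop : Tendsto (fun x => ∫ s in Iic x, ρ s) atTop (𝓝 (∫ s, ρ s)) := by
      have h := (intervalIntegral_tendsto_integral_Ioi 0 (f := ρ) (μ := volume) hρi.integrableOn tendsto_id)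
      have h2 := (tendsto_const_nhds (x := ∫ s in Iic 0, ρ s)).add h
      have e : (∫ s in Iic 0, ρ s) + ∫ s in Ioi 0, ρ s = ∫ s, ρ s :=
        intervalIntegral.integral_Iic_add_Ioi hρi.integrableOn hρi.integrableOn
      rw [e] at h2
      refine h2.congr fun x => ?_
      have := intervalIntegral.integral_Iic_sub_Iic (a := 0) (b := x) hρi.integrableOn
          hρi.integrableOn
      simp only [id]
      linarith
    set c := (∫ s in (-R)..y, g s) / (∫ s in (-R)..R, g s) * ∫ s, ρ s with hc
    have hc0 : 0 < c := by positivity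
    have hc1 : c < ∫ s, ρ s := by
      have : (∫ s in (-R)..y, g s) / (∫ s in (-R)..R, g s) < 1 := by rwa [div_lt_one h3]
      rw [hc]
      exact mul_lt_of_lt_one_left h4 this
    obtain ⟨x1, hx1⟩ := (hbot.eventually_lt_const hc0).exists
    obtain ⟨x2, hx2⟩ := (htop.eventually_const_lt hc1).exists
    obtain ⟨x, hx⟩ := mem_range_of_exists_le_of_exists_ge hcont ⟨x1, hx1.le⟩ ⟨x2, hx2.le⟩
    refine ⟨x, hm.injective ?_⟩
    show ∫ s in (-R)..(transport ρ g R x), g s = ∫ s in (-R)..y, g s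
    rw [intervalIntegral_transport hρ hρ0 hρi hg hg0 hR, show ∫ s in Iic x, ρ s = c from hx, hc]
    field_simp

/-- The mass identity of `intervalIntegral_transport` is differentiated as a quotient of slopes.
Continuity, needed to compose with the slope of the primitive of `g`, comes from monotonicity
together with the open range. -/
theorem hasDerivAt_transport (hρ : Continuous ρ) (hρ0 : ∀ x, 0 < ρ x) (hρi : Integrable ρ)
    (hg : Continuous g) (hg0 : ∀ x, 0 < g x) (hR : 0 < R) (x : ℝ) :
    HasDerivAt (transport ρ g R) ((∫ s in (-R)..R, g s) * ρ x / (∫ s, ρ s) /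
      g (transport ρ g R x)) x := by
  have hm := strictMono_transport hρ hρ0 hρi hg hg0 hR
  have hcont : ContinuousAt (transport ρ g R) x := by
    refine (hm.strictMonoOn univ).continuousAt_of_image_mem_nhds univ_mem ?_
    rw [image_univ, range_transport hρ hρ0 hρi hg hg0 hR]
    exact isOpen_Ioo.mem_nhds (transport_mem hρ hρ0 hρi hg hg0 hR x)
  have hd1 : HasDerivAt (fun y => ∫ s in (-R)..y, g s) (g (transport ρ g R x)) (transport ρ g R x) :=
    intervalIntegral.integral_hasDerivAt_right (hg.intervalIntegrable _ _)
      hg.stronglyMeasurable.stronglyMeasurableAtFilter hg.continuousAt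
  have hd2 : HasDerivAt (fun x => (∫ s in (-R)..R, g s) * (∫ s in Iic x, ρ s) / ∫ s, ρ s)
      ((∫ s in (-R)..R, g s) * ρ x / ∫ s, ρ s) x := by
    have e : (fun x => ∫ s in Iic x, ρ s) = fun x => (∫ s in Iic 0, ρ s) + ∫ s in (0:ℝ)..x, ρ s := by
        funext x
        have := intervalIntegral.integral_Iic_sub_Iic (a := 0) (b := x) hρi.integrableOn
          hρi.integrableOn
        linarith
    have : HasDerivAt (fun x => ∫ s in Iic x, ρ s) (ρ x) x := by
      rw [e]
      exact (intervalIntegral.integral_hasDerivAt_right (hρ.intervalIntegrable _ _)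
        hρ.stronglyMeasurable.stronglyMeasurableAtFilter hρ.continuousAt).const_add _
    exact (this.const_mul _).div_const _
  have h4 := (integral_Iic_pos hρ hρ0 hρi 0).trans (integral_Iic_lt hρ hρ0 hρi 0)
  have h3 : 0 < ∫ s in (-R)..R, g s :=
      intervalIntegral.intervalIntegral_pos_of_pos (hg.intervalIntegrable _ _) hg0 (by linarith)
  -- differentiate the defining identity through the slope of the inverse
  rw [hasDerivAt_iff_tendsto_slope] at hd1 hd2 ⊢
  have hne : Tendsto (transport ρ g R) (𝓝[≠] x) (𝓝[≠] (transport ρ g R x)) :=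
    tendsto_nhdsWithin_of_tendsto_nhds_of_eventually_within _ (hcont.tendsto.mono_left nhdsWithin_le_nhds)
      (eventually_nhdsWithin_of_forall fun y hy => hm.injective.ne hy)
  have h := hd2.div (hd1.comp hne) (hg0 _).ne'
  refine h.congr' (eventually_nhdsWithin_of_forall fun y hy => ?_)
  have hy1 : transport ρ g R y - transport ρ g R x ≠ 0 := sub_ne_zero.mpr (hm.injective.ne hy)
  have hy2 : y - x ≠ 0 := sub_ne_zero.mpr hy
  have hne2 : (∫ s in Iic y, ρ s) - ∫ s in Iic x, ρ s ≠ 0 :=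
    sub_ne_zero.mpr ((strictMono_integral_Iic hρ hρ0 hρi).injective.ne hy)
  simp only [Pi.div_apply, Function.comp, slope_def_field, intervalIntegral_transport hρ hρ0 hρi hg hg0 hR]
  rw [← sub_div, ← mul_sub]
  field_simp

/-- Injective change of variables with the derivative just computed. Both masses are kept as factors
so that no normalization is needed. -/
theorem lintegral_transport (hρ : Continuous ρ) (hρ0 : ∀ x, 0 < ρ x) (hρi : Integrable ρ)
    (hg : Continuous g) (hg0 : ∀ x, 0 < g x) (hR : 0 < R) (Ψ : ℝ → ℝ≥0∞) :
    ENNReal.ofReal (∫ s in (-R)..R, g s) * ∫⁻ x, ENNReal.ofReal (ρ x) * Ψ (transport ρ g R x) =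
      ENNReal.ofReal (∫ s, ρ s) * ∫⁻ y in Icc (-R) R, ENNReal.ofReal (g y) * Ψ y := by
  have h3 : 0 < ∫ s in (-R)..R, g s :=
      intervalIntegral.intervalIntegral_pos_of_pos (hg.intervalIntegrable _ _) hg0 (by linarith)
  have h4 := (integral_Iic_pos hρ hρ0 hρi 0).trans (integral_Iic_lt hρ hρ0 hρi 0)
  have h := lintegral_image_eq_lintegral_abs_deriv_mul (s := univ) MeasurableSet.univ
    (fun x _ => (hasDerivAt_transport hρ hρ0 hρi hg hg0 hR x).hasDerivWithinAt)
    (strictMono_transport hρ hρ0 hρi hg hg0 hR).injective.injOn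
    (fun y => ENNReal.ofReal (g y) * Ψ y)
  rw [image_univ, range_transport hρ hρ0 hρi hg hg0 hR, Measure.restrict_univ] at h
  rw [← setLIntegral_congr (Ioo_ae_eq_Icc (a := -R) (b := R) (μ := volume)), h]
  rw [← lintegral_const_mul' _ _ ENNReal.ofReal_ne_top, ← lintegral_const_mul' _ _ ENNReal.ofReal_ne_top]
  refine lintegral_congr fun x => ?_
  have hgx := hg0 (transport ρ g R x)
  have hρx := hρ0 x
  rw [← mul_assoc, ← mul_assoc, ← mul_assoc, abs_of_pos (by positivity), ← ENNReal.ofReal_mul h3.le,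
    ← ENNReal.ofReal_mul h4.le, ← ENNReal.ofReal_mul (by positivity)]
  congr 2
  field_simp

end

/-- The monotone transport map depends measurably on parameters. -/
theorem measurable_transport {A : Type*} [MeasurableSpace A] {ρ g : A → ℝ → ℝ} {R : ℝ}
    (hρm : Measurable (Function.uncurry ρ)) (hgm : Measurable (Function.uncurry g))
    (hρ : ∀ a, Continuous (ρ a)) (hρ0 : ∀ a x, 0 < ρ a x)
    (hρi : ∀ a, Integrable (ρ a)) (hg : ∀ a, Continuous (g a)) (hg0 : ∀ a x, 0 < g a x)
    (hR : 0 < R) : Measurable (fun z : A × ℝ => transport (ρ z.1) (g z.1) R z.2) := by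
  have hΓ : ∀ c, Measurable (fun a => ∫ s in (-R)..c, g a s) := by
    intro c
    simp only [intervalIntegral]
    exact ((hgm.stronglyMeasurable.integral_prod_right
      (ν := volume.restrict (Ioc (-R) c))).sub (hgm.stronglyMeasurable.integral_prod_right
      (ν := volume.restrict (Ioc c (-R))))).measurable
  have hT : Measurable (fun a => ∫ s, ρ a s) := hρm.stronglyMeasurable.integral_prod_right.measurable
  have hΦ : Measurable (fun z : A × ℝ => ∫ s in Iic z.2, ρ z.1 s) := by
    have e : (fun z : A × ℝ => ∫ s in Iic z.2, ρ z.1 s) =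
        fun z : A × ℝ => ∫ s, {w : (A × ℝ) × ℝ | w.2 ≤ w.1.2}.indicator
          (fun w => ρ w.1.1 w.2) (z, s) := by
      funext z
      rw [← integral_indicator measurableSet_Iic]
      rfl
    rw [e]
    have hm : Measurable ({w : (A × ℝ) × ℝ | w.2 ≤ w.1.2}.indicator (fun w => ρ w.1.1 w.2)) :=
      (hρm.comp ((measurable_fst.comp measurable_fst).prodMk measurable_snd)).indicator
        (measurableSet_le measurable_snd (measurable_snd.comp measurable_fst))
    exact hm.stronglyMeasurable.integral_prod_right'.measurable
  -- Half-lines suffice; by `transport_lt_iff` their preimages compare integrals that depend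
  -- measurably on the parameters.
  refine measurable_of_Iio fun c => ?_
  have e : (fun z : A × ℝ => transport (ρ z.1) (g z.1) R z.2) ⁻¹' Iio c =
      {z : A × ℝ | (∫ s in (-R)..R, g z.1 s) * (∫ s in Iic z.2, ρ z.1 s) / (∫ s, ρ z.1 s) <
        ∫ s in (-R)..c, g z.1 s} := by
    ext z
    exact transport_lt_iff (hρ _) (hρ0 _) (hρi _) (hg _) (hg0 _) hR _ _
  rw [e]
  exact measurableSet_lt ((((hΓ R).comp measurable_fst).mul hΦ).div (hT.comp measurable_fst))
    ((hΓ c).comp measurable_fst)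

/-! ### The Knothe map -/

theorem continuous_finCons {n : ℕ} :
    Continuous (fun p : ℝ × (Fin n → ℝ) => (Fin.cons p.1 p.2 : Fin (n + 1) → ℝ)) := by
  refine continuous_pi fun i => ?_
  refine Fin.cases ?_ (fun j => ?_) i
  · simpa using continuous_fst
  · simp only [Fin.cons_succ]
    fun_prop

theorem continuous_finTail {n : ℕ} :
    Continuous (fun x : Fin (n + 1) → ℝ => (Fin.tail x : Fin n → ℝ)) :=
  continuous_pi fun i => continuous_apply (Fin.succ i)

theorem measurePreserving_finCons {n : ℕ} (μ : Measure ℝ) [SigmaFinite μ] :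
    MeasurePreserving (fun p : ℝ × (Fin n → ℝ) => (Fin.cons p.1 p.2 : Fin (n + 1) → ℝ))
      (μ.prod (Measure.pi fun _ => μ)) (Measure.pi fun _ => μ) := by
  have h := (measurePreserving_piFinSuccAbove (fun _ : Fin (n + 1) => μ) 0).symm
  convert h using 1
  funext p
  simp [MeasurableEquiv.piFinSuccAbove, Fin.insertNthEquiv]

theorem measurableEmbedding_finCons {n : ℕ} : MeasurableEmbedding
    (fun p : ℝ × (Fin n → ℝ) => (Fin.cons p.1 p.2 : Fin (n + 1) → ℝ)) := by
  have h := (MeasurableEquiv.piFinSuccAbove (fun _ : Fin (n + 1) => ℝ) 0).symm.measurableEmbedding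
  convert h using 1
  funext p
  simp [MeasurableEquiv.piFinSuccAbove, Fin.insertNthEquiv]

theorem lintegral_pi_cons {n : ℕ} (μ : Measure ℝ) [SigmaFinite μ]
    {f : (Fin (n + 1) → ℝ) → ℝ≥0∞} (hf : Measurable f) :
    ∫⁻ x, f x ∂(Measure.pi fun _ => μ) =
      ∫⁻ s, ∫⁻ z, f (Fin.cons s z) ∂(Measure.pi fun _ => μ) ∂μ := by
  rw [← (measurePreserving_finCons μ).lintegral_comp hf,
    lintegral_prod (fun p : ℝ × (Fin n → ℝ) => f (Fin.cons p.1 p.2))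
      (hf.comp continuous_finCons.measurable).aemeasurable]

theorem integrable_comp_cons {n : ℕ} (μ : Measure ℝ) [SigmaFinite μ]
    {f : (Fin (n + 1) → ℝ) → ℝ} (hf : Integrable f (Measure.pi fun _ => μ)) :
    Integrable (fun p : ℝ × (Fin n → ℝ) => f (Fin.cons p.1 p.2))
      (μ.prod (Measure.pi fun _ => μ)) :=
  ((measurePreserving_finCons μ).integrable_comp_emb measurableEmbedding_finCons).mpr hf

theorem integral_pi_cons {n : ℕ} (μ : Measure ℝ) [SigmaFinite μ]
    {f : (Fin (n + 1) → ℝ) → ℝ} (hf : Integrable f (Measure.pi fun _ => μ)) :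
    ∫ x, f x ∂(Measure.pi fun _ => μ) =
      ∫ s, ∫ z, f (Fin.cons s z) ∂(Measure.pi fun _ => μ) ∂μ := by
  rw [← (measurePreserving_finCons μ).integral_comp measurableEmbedding_finCons]
  exact integral_prod _ (integrable_comp_cons μ hf)

/-- Lebesgue measure on the box `[-R, R]^n`. -/
def boxMeasure (n : ℕ) (R : ℝ) : Measure (Fin n → ℝ) :=
  Measure.pi fun _ => volume.restrict (Icc (-R) R)

/-- The product form serves the recursion on coordinates, the restricted form serves compactness
arguments. -/
theorem boxMeasure_eq (n : ℕ) (R : ℝ) :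
    boxMeasure n R = volume.restrict (Icc (fun _ => -R) (fun _ => R)) := by
  rw [boxMeasure, ← pi_univ_Icc, volume_pi, Measure.restrict_pi_pi]

theorem integrable_boxMeasure {n : ℕ} {R : ℝ} {G : (Fin n → ℝ) → ℝ} (hG : Continuous G) :
    Integrable G (boxMeasure n R) := by
  rw [boxMeasure_eq]
  exact hG.continuousOn.integrableOn_compact isCompact_Icc

theorem boxMeasure_ne_zero (n : ℕ) {R : ℝ} (hR : 0 < R) : boxMeasure n R ≠ 0 := by
  intro h
  have h1 : boxMeasure n R univ = 0 := by simp [h]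
  rw [boxMeasure, Measure.pi_univ, Finset.prod_eq_zero_iff] at h1
  obtain ⟨i, -, hi⟩ := h1
  simp at hi
  linarith

theorem integral_boxMeasure_pos {n : ℕ} {R : ℝ} (hR : 0 < R) {G : (Fin n → ℝ) → ℝ}
    (hG : Continuous G) (hG0 : ∀ x, 0 < G x) : 0 < ∫ x, G x ∂(boxMeasure n R) := by
  rw [integral_pos_iff_support_of_nonneg (fun x => (hG0 x).le) (integrable_boxMeasure hG)]
  have : Function.support G = univ := by
    ext x; simp [(hG0 x).ne']
  rw [this, pos_iff_ne_zero, Measure.measure_univ_ne_zero]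
  exact boxMeasure_ne_zero n hR

theorem continuous_boxMarginal {n : ℕ} {R : ℝ} {G : (Fin (n + 1) → ℝ) → ℝ} (hG : Continuous G) :
    Continuous (fun s : ℝ => ∫ z, G (Fin.cons s z) ∂(boxMeasure n R)) := by
  rw [boxMeasure_eq]
  exact continuous_parametric_integral_of_continuous
    (f := fun (s : ℝ) (z : Fin n → ℝ) => G (Fin.cons s z)) (hG.comp continuous_finCons) isCompact_Icc

theorem integral_boxMarginal {n : ℕ} {R : ℝ} (hR : 0 < R) {G : (Fin (n + 1) → ℝ) → ℝ}
    (hG : Continuous G) :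
    ∫ s in (-R)..R, ∫ z, G (Fin.cons s z) ∂(boxMeasure n R) = ∫ x, G x ∂(boxMeasure (n + 1) R) := by
  rw [intervalIntegral.integral_of_le (by linarith), ← integral_Icc_eq_integral_Ioc]
  exact (integral_pi_cons _ (integrable_boxMeasure hG)).symm

/-- Positive continuous functions on `ℝ^n` dominated by `∏ (1 + x_i²)⁻¹`. -/
structure IsDecayingDensity {n : ℕ} (F : (Fin n → ℝ) → ℝ) : Prop where
  continuous : Continuous F
  pos : ∀ x, 0 < F x
  bound : ∃ C, ∀ x, F x ≤ C * ∏ i, (1 + x i ^ 2)⁻¹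

namespace IsDecayingDensity

theorem integrable_prod (n : ℕ) :
    Integrable (fun x : Fin n → ℝ => ∏ i, (1 + x i ^ 2)⁻¹) :=
  Integrable.fintype_prod (f := fun _ s => (1 + s ^ 2)⁻¹) fun _ => integrable_inv_one_add_sq

variable {n : ℕ}

theorem integrable {F : (Fin n → ℝ) → ℝ} (hF : IsDecayingDensity F) : Integrable F := by
  obtain ⟨C, hC⟩ := hF.bound
  refine ((integrable_prod n).const_mul C).mono' hF.continuous.aestronglyMeasurable
    (Eventually.of_forall fun x => ?_)
  rw [Real.norm_of_nonneg (hF.pos x).le]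
  exact hC x

theorem integral_pos {F : (Fin n → ℝ) → ℝ} (hF : IsDecayingDensity F) : 0 < ∫ x, F x := by
  rw [integral_pos_iff_support_of_nonneg (fun x => (hF.pos x).le) hF.integrable]
  have : Function.support F = univ := by
    ext x; simp [(hF.pos x).ne']
  rw [this]
  exact isOpen_univ.measure_pos _ univ_nonempty

variable {F : (Fin (n + 1) → ℝ) → ℝ}

/-- Stability under slicing is the reason for a product bound: fixing the first coordinate only
changes the constant. -/
theorem slice (hF : IsDecayingDensity F) (s : ℝ) :
    IsDecayingDensity (fun z : Fin n → ℝ => F (Fin.cons s z)) where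
  continuous := hF.continuous.comp (continuous_finCons.comp (by fun_prop :
    Continuous fun z : Fin n → ℝ => (s, z)))
  pos _ := hF.pos _
  bound := by
    obtain ⟨C, hC⟩ := hF.bound
    refine ⟨C * (1 + s ^ 2)⁻¹, fun z => (hC _).trans_eq ?_⟩
    rw [Fin.prod_univ_succ]
    simp [mul_assoc]

theorem continuous_marginal (hF : IsDecayingDensity F) :
    Continuous (fun s : ℝ => ∫ z, F (Fin.cons s z)) := by
  obtain ⟨C, hC⟩ := hF.bound
  have hC0 : 0 ≤ C := by
    by_contra h
    have h1 := hC 0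
    have h2 := hF.pos 0
    simp at h1
    linarith
  refine continuous_of_dominated (bound := fun z => C * ∏ i, (1 + z i ^ 2)⁻¹)
    (fun s => (hF.slice s).continuous.aestronglyMeasurable) (fun s => Eventually.of_forall fun z => ?_)
    ((integrable_prod n).const_mul C) (Eventually.of_forall fun z => ?_)
  · rw [Real.norm_of_nonneg (hF.pos _).le]
    refine (hC _).trans ?_
    rw [Fin.prod_univ_succ]
    simp only [Fin.cons_zero, Fin.cons_succ]
    have h0 : 0 ≤ ∏ i, (1 + z i ^ 2)⁻¹ := Finset.prod_nonneg fun i _ => by positivity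
    have h1 : (1 + s ^ 2)⁻¹ ≤ 1 := inv_le_one_of_one_le₀ (by nlinarith [sq_nonneg s])
    gcongr
    exact mul_le_of_le_one_left h0 h1
  · exact hF.continuous.comp (continuous_finCons.comp (by fun_prop :
      Continuous fun s : ℝ => (s, z)))

theorem marginal_pos (hF : IsDecayingDensity F) (s : ℝ) : 0 < ∫ z, F (Fin.cons s z) :=
  (hF.slice s).integral_pos

theorem integrable_marginal (hF : IsDecayingDensity F) :
    Integrable (fun s : ℝ => ∫ z, F (Fin.cons s z)) :=
  (integrable_comp_cons volume hF.integrable).integral_prod_left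

theorem integral_marginal (hF : IsDecayingDensity F) :
    ∫ s, ∫ z, F (Fin.cons s z) = ∫ x, F x :=
  (integral_pi_cons volume hF.integrable).symm

end IsDecayingDensity

/-- The Knothe (triangular) map from the density `F` on `ℝ^n` to the density `G` on `[-R, R]^n`. -/
def knothe (R : ℝ) : (n : ℕ) → ((Fin n → ℝ) → ℝ) → ((Fin n → ℝ) → ℝ) → (Fin n → ℝ) → (Fin n → ℝ)
  | 0, _, _, x => x
  | n + 1, F, G, x =>
    Fin.cons
      (transport (fun s => ∫ z, F (Fin.cons s z)) (fun s => ∫ z, G (Fin.cons s z) ∂(boxMeasure n R))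
        R (x 0))
      (knothe R n (fun z => F (Fin.cons (x 0) z))
        (fun z => G (Fin.cons (transport (fun s => ∫ z, F (Fin.cons s z))
          (fun s => ∫ z, G (Fin.cons s z) ∂(boxMeasure n R)) R (x 0)) z)) (Fin.tail x))

theorem continuous_comp_cons {n : ℕ} {G : (Fin (n + 1) → ℝ) → ℝ} (hG : Continuous G) (s : ℝ) :
    Continuous (fun z : Fin n → ℝ => G (Fin.cons s z)) :=
  hG.comp (continuous_finCons.comp (by fun_prop : Continuous fun z : Fin n → ℝ => (s, z)))

/-- The recursive call acts on slices that depend on the first coordinate, so the induction must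
carry a parameter space, which gains one real variable at each step. -/
theorem measurable_knothe_param {R : ℝ} (hR : 0 < R) : ∀ (n : ℕ) {A : Type} [MeasurableSpace A]
    {F G : A → (Fin n → ℝ) → ℝ} (_ : Measurable (Function.uncurry F))
    (_ : Measurable (Function.uncurry G)) (_ : ∀ a, IsDecayingDensity (F a))
    (_ : ∀ a, Continuous (G a)) (_ : ∀ a x, 0 < G a x),
    Measurable (fun z : A × (Fin n → ℝ) => knothe R n (F z.1) (G z.1) z.2)
  | 0, A, _, F, G, _, _, _, _, _ => measurable_snd
  | n + 1, A, _, F, G, hFm, hGm, hF, hG, hG0 => by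
    have hcons : Measurable (fun q : (A × ℝ) × (Fin n → ℝ) =>
        ((q.1.1, Fin.cons q.1.2 q.2) : A × (Fin (n + 1) → ℝ))) :=
      (measurable_fst.comp measurable_fst).prodMk
        (continuous_finCons.measurable.comp ((measurable_snd.comp measurable_fst).prodMk measurable_snd))
    have hρm : Measurable (Function.uncurry fun (a : A) (s : ℝ) => ∫ z, F a (Fin.cons s z)) :=
      ((hFm.comp hcons).stronglyMeasurable.integral_prod_right' (ν := volume)).measurable
    have hgm : Measurable (Function.uncurry fun (a : A) (s : ℝ) =>
        ∫ z, G a (Fin.cons s z) ∂(boxMeasure n R)) := by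
      have : SFinite (boxMeasure n R) := by unfold boxMeasure; infer_instance
      exact ((hGm.comp hcons).stronglyMeasurable.integral_prod_right' (ν := boxMeasure n R)).measurable
    have ht := measurable_transport (R := R) hρm hgm (fun a => (hF a).continuous_marginal)
      (fun a => (hF a).marginal_pos) (fun a => (hF a).integrable_marginal)
      (fun a => continuous_boxMarginal (hG a))
      (fun a s => integral_boxMeasure_pos hR (continuous_comp_cons (hG a) s) fun _ => hG0 a _) hR
    set t : A × ℝ → ℝ := fun z => transport (fun s => ∫ y, F z.1 (Fin.cons s y))
      (fun s => ∫ y, G z.1 (Fin.cons s y) ∂(boxMeasure n R)) R z.2 with ht_def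
    have hrec := measurable_knothe_param hR n (A := A × ℝ)
      (F := fun q y => F q.1 (Fin.cons q.2 y)) (G := fun q y => G q.1 (Fin.cons (t q) y))
      (hFm.comp hcons)
      (hGm.comp (hcons.comp (((measurable_fst.comp measurable_fst).prodMk
        (ht.comp measurable_fst)).prodMk measurable_snd)))
      (fun q => (hF q.1).slice q.2) (fun q => continuous_comp_cons (hG q.1) _) (fun q y => hG0 q.1 _)
    have hx0 : Measurable (fun z : A × (Fin (n + 1) → ℝ) => (z.1, z.2 0)) :=
      measurable_fst.prodMk ((measurable_pi_apply 0).comp measurable_snd)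
    exact continuous_finCons.measurable.comp ((ht.comp hx0).prodMk
      (hrec.comp (hx0.prodMk (continuous_finTail.measurable.comp measurable_snd))))

theorem measurable_knothe {n : ℕ} {R : ℝ} (hR : 0 < R) {F G : (Fin n → ℝ) → ℝ}
    (hF : IsDecayingDensity F) (hG : Continuous G) (hG0 : ∀ x, 0 < G x) :
    Measurable (knothe R n F G) := by
  have h := measurable_knothe_param hR n (A := Unit) (F := fun _ => F) (G := fun _ => G)
    (hF.continuous.measurable.comp measurable_snd) (hG.measurable.comp measurable_snd)
    (fun _ => hF) (fun _ => hG) (fun _ => hG0)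
  exact h.comp (measurable_const.prodMk measurable_id : Measurable fun x => ((), x))

/-- Push-forward identity with masses as factors. By Fubini and induction, each slice contributes
the marginal of `F` times a normalized slice integral at the transported point, and the
one-dimensional transport handles the remaining variable. -/
theorem lintegral_knothe {R : ℝ} (hR : 0 < R) : ∀ (n : ℕ) {F G : (Fin n → ℝ) → ℝ}
    (_ : IsDecayingDensity F) (_ : Continuous G) (_ : ∀ x, 0 < G x) {Ψ : (Fin n → ℝ) → ℝ≥0∞}
    (_ : Measurable Ψ),
    ENNReal.ofReal (∫ y, G y ∂(boxMeasure n R)) *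
        ∫⁻ x, ENNReal.ofReal (F x) * Ψ (knothe R n F G x) =
      ENNReal.ofReal (∫ x, F x) * ∫⁻ y, ENNReal.ofReal (G y) * Ψ y ∂(boxMeasure n R)
  | 0, F, G, hF, hG, hG0, Ψ, hΨ => by
    simp only [boxMeasure, knothe, volume_pi, Measure.pi_of_empty (α := Fin 0) (x := ![]),
      integral_dirac, lintegral_dirac]
    ring
  | n + 1, F, G, hF, hG, hG0, Ψ, hΨ => by
    set ρ : ℝ → ℝ := fun s => ∫ z, F (Fin.cons s z) with hρ
    set g : ℝ → ℝ := fun s => ∫ z, G (Fin.cons s z) ∂(boxMeasure n R) with hg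
    have hg0 : ∀ s, 0 < g s := fun s =>
      integral_boxMeasure_pos hR (continuous_comp_cons hG s) fun _ => hG0 _
    set K : ℝ → ℝ≥0∞ := fun s => ∫⁻ y, ENNReal.ofReal (G (Fin.cons s y)) * Ψ (Fin.cons s y)
      ∂(boxMeasure n R) with hK
    have h1 : ∀ s, ∫⁻ z, ENNReal.ofReal (F (Fin.cons s z)) *
        Ψ (knothe R (n + 1) F G (Fin.cons s z)) =
        ENNReal.ofReal (ρ s) * (K (transport ρ g R s) / ENNReal.ofReal (g (transport ρ g R s))) := by
      intro s
      have ih := lintegral_knothe hR n (hF.slice s) (continuous_comp_cons hG (transport ρ g R s))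
        (fun _ => hG0 _) (Ψ := fun z => Ψ (Fin.cons (transport ρ g R s) z))
        (hΨ.comp (continuous_finCons.measurable.comp (measurable_const.prodMk measurable_id)))
      have hgt : ENNReal.ofReal (g (transport ρ g R s)) ≠ 0 := by
        simpa using hg0 _
      rw [← mul_div_assoc, ENNReal.eq_div_iff hgt ENNReal.ofReal_ne_top]
      exact ih
    have hm : Measurable (fun x => ENNReal.ofReal (F x) * Ψ (knothe R (n + 1) F G x)) :=
      (ENNReal.measurable_ofReal.comp hF.continuous.measurable).mul
        (hΨ.comp (measurable_knothe hR hF hG hG0))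
    rw [volume_pi, lintegral_pi_cons volume hm]
    simp only [← volume_pi, h1]
    rw [← integral_boxMarginal hR hG, ← hF.integral_marginal,
      lintegral_transport hF.continuous_marginal hF.marginal_pos hF.integrable_marginal
        (continuous_boxMarginal hG) hg0 hR (fun y => K y / ENNReal.ofReal (g y))]
    congr 1
    have hm2 : Measurable (fun x => ENNReal.ofReal (G x) * Ψ x) :=
      (ENNReal.measurable_ofReal.comp hG.measurable).mul hΨ
    conv_rhs => rw [boxMeasure, lintegral_pi_cons _ hm2]
    refine lintegral_congr fun s => ?_
    have hgt : ENNReal.ofReal (g s) ≠ 0 := by simpa using hg0 _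
    exact ENNReal.mul_div_cancel hgt ENNReal.ofReal_ne_top

theorem knothe_mem {R : ℝ} (hR : 0 < R) : ∀ (n : ℕ) {F G : (Fin n → ℝ) → ℝ}
    (_ : IsDecayingDensity F) (_ : Continuous G) (_ : ∀ x, 0 < G x) (x : Fin n → ℝ) (i : Fin n),
    knothe R n F G x i ∈ Ioo (-R) R
  | 0, F, G, hF, hG, hG0, x, i => i.elim0
  | n + 1, F, G, hF, hG, hG0, x, i => by
    refine Fin.cases ?_ (fun j => ?_) i
    · exact transport_mem hF.continuous_marginal hF.marginal_pos hF.integrable_marginal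
        (continuous_boxMarginal hG)
        (fun s => integral_boxMeasure_pos hR (continuous_comp_cons hG s) fun _ => hG0 _) hR _
    · exact knothe_mem hR n (hF.slice (x 0)) (continuous_comp_cons hG _) (fun _ => hG0 _) _ j

theorem knothe_zero_add_single {n : ℕ} {R : ℝ} {F G : (Fin (n + 1) → ℝ) → ℝ} (x : Fin (n + 1) → ℝ)
    (s : ℝ) : knothe R (n + 1) F G (x + s • Pi.single 0 1) 0 =
      transport (fun s => ∫ z, F (Fin.cons s z)) (fun s => ∫ z, G (Fin.cons s z) ∂(boxMeasure n R)) R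
        (x 0 + s) := by
  simp [knothe]

/-- Triangularity: moving a later coordinate changes neither the first component nor the slices, so
the shift passes to the lower-dimensional map. -/
theorem knothe_succ_add_single {n : ℕ} {R : ℝ} {F G : (Fin (n + 1) → ℝ) → ℝ} (x : Fin (n + 1) → ℝ)
    (s : ℝ) (j : Fin n) : knothe R (n + 1) F G (x + s • Pi.single j.succ 1) j.succ =
      knothe R n (fun z => F (Fin.cons (x 0) z))
        (fun z => G (Fin.cons (knothe R (n + 1) F G x 0) z))
        (Fin.tail x + s • Pi.single j 1) j := by
  have h0 : (x + s • Pi.single j.succ 1 : Fin (n + 1) → ℝ) 0 = x 0 := by simp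
  have h1 : Fin.tail (x + s • Pi.single j.succ 1 : Fin (n + 1) → ℝ) =
      Fin.tail x + s • Pi.single j 1 := by
    funext k
    by_cases h : k = j <;> simp [Fin.tail, h]
  simp only [knothe, h0, h1, Fin.cons_succ, Fin.cons_zero]

theorem knothe_le_add_single {R : ℝ} (hR : 0 < R) : ∀ (n : ℕ) {F G : (Fin n → ℝ) → ℝ}
    (_ : IsDecayingDensity F) (_ : Continuous G) (_ : ∀ x, 0 < G x) (x : Fin n → ℝ) (i : Fin n)
    {s : ℝ} (_ : 0 ≤ s), knothe R n F G x i ≤ knothe R n F G (x + s • Pi.single i 1) i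
  | 0, F, G, hF, hG, hG0, x, i, s, hs => i.elim0
  | n + 1, F, G, hF, hG, hG0, x, i, s, hs => by
    refine Fin.cases ?_ (fun j => ?_) i
    · rw [knothe_zero_add_single]
      refine (strictMono_transport hF.continuous_marginal hF.marginal_pos hF.integrable_marginal
        (continuous_boxMarginal hG)
        (fun s => integral_boxMeasure_pos hR (continuous_comp_cons hG s) fun _ => hG0 _)
        hR).monotone (by linarith : x 0 ≤ x 0 + s)
    · rw [knothe_succ_add_single]
      exact knothe_le_add_single hR n (hF.slice (x 0)) (continuous_comp_cons hG _) (fun _ => hG0 _) _ j hs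

/-- The Monge–Ampère equation for a triangular map, whose Jacobian is the product of the diagonal
derivatives `D i`. These telescope: each is a ratio of marginals. Full differentiability of the map
is never needed. -/
theorem exists_hasLineDerivAt_knothe {R : ℝ} (hR : 0 < R) : ∀ (n : ℕ) {F G : (Fin n → ℝ) → ℝ}
    (_ : IsDecayingDensity F) (_ : Continuous G) (_ : ∀ x, 0 < G x) (x : Fin n → ℝ),
    ∃ D : Fin n → ℝ, (∀ i, 0 < D i) ∧
      (∀ i, HasLineDerivAt ℝ (fun y => knothe R n F G y i) (D i) x (Pi.single i 1)) ∧
      F x * ∫ y, G y ∂(boxMeasure n R) = (∏ i, D i) * G (knothe R n F G x) * ∫ y, F y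
  | 0, F, G, hF, hG, hG0, x => by
    refine ⟨fun _ => 1, fun i => i.elim0, fun i => i.elim0, ?_⟩
    have hx : x = ![] := Subsingleton.elim _ _
    subst hx
    simp only [boxMeasure, knothe, volume_pi, Measure.pi_of_empty (α := Fin 0) (x := ![]),
      integral_dirac, Finset.univ_eq_empty, Finset.prod_empty]
    ring
  | n + 1, F, G, hF, hG, hG0, x => by
    set ρ : ℝ → ℝ := fun s => ∫ z, F (Fin.cons s z) with hρ
    set g : ℝ → ℝ := fun s => ∫ z, G (Fin.cons s z) ∂(boxMeasure n R) with hg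
    have hg0 : ∀ s, 0 < g s := fun s =>
      integral_boxMeasure_pos hR (continuous_comp_cons hG s) fun _ => hG0 _
    obtain ⟨D, hD0, hD, hDp⟩ := exists_hasLineDerivAt_knothe hR n (hF.slice (x 0))
      (continuous_comp_cons hG (transport ρ g R (x 0))) (fun _ => hG0 _) (Fin.tail x)
    have hder := hasDerivAt_transport hF.continuous_marginal hF.marginal_pos hF.integrable_marginal
        (continuous_boxMarginal hG) hg0 hR (x 0)
    rw [integral_boxMarginal hR hG, hF.integral_marginal] at hder
    have hI := integral_boxMeasure_pos hR hG hG0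
    have hIF := hF.integral_pos
    have hρ0 := hF.marginal_pos (x 0)
    refine ⟨Fin.cons ((∫ x, G x ∂(boxMeasure (n + 1) R)) * ρ (x 0) / (∫ x, F x) /
        g (transport ρ g R (x 0))) D, fun i => ?_, fun i => ?_, ?_⟩
    rotate_left
    · refine Fin.cases ?_ (fun j => ?_) i
      · rw [Fin.cons_zero]
        unfold HasLineDerivAt
        simp only [knothe_zero_add_single]
        have h := HasDerivAt.comp_const_add (x 0) 0 (by rw [add_zero]; exact hder)
        exact h
      · rw [Fin.cons_succ]
        unfold HasLineDerivAt
        simp only [knothe_succ_add_single]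
        exact hD j
    · rw [Fin.prod_univ_succ]
      simp only [Fin.cons_zero, Fin.cons_succ]
      rw [Fin.cons_self_tail] at hDp
      change F x * g (transport ρ g R (x 0)) =
        (∏ i, D i) * G (knothe R (n + 1) F G x) * ρ (x 0) at hDp
      have hgt := hg0 (transport ρ g R (x 0))
      have hρx : 0 < ρ (x 0) := hρ0
      have e : F x = (∏ i, D i) * G (knothe R (n + 1) F G x) * ρ (x 0) /
          g (transport ρ g R (x 0)) := by
        rw [eq_div_iff hgt.ne']; exact hDp
      rw [e]
      field_simp
    · refine Fin.cases ?_ (fun j => ?_) i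
      · rw [Fin.cons_zero]
        have := hg0 (transport ρ g R (x 0))
        positivity
      · rw [Fin.cons_succ]; exact hD0 j

/-! ### The transport proof of the sharp Sobolev inequality -/

/-- One-sided integration by parts against a bounded function which is monotone and differentiable
in the direction `e`. -/
theorem lintegral_mul_lineDeriv_le {n : ℕ} {e : Fin n → ℝ} {h H h' T D : (Fin n → ℝ) → ℝ} {R : ℝ}
    (hh0 : ∀ x, 0 ≤ h x) (hhi : Integrable h) (hHi : Integrable H)
    (hlip : ∀ x s, 0 ≤ s → s ≤ 1 → |h (x - s • e) - h x| ≤ s * H x)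
    (hh' : ∀ x, HasLineDerivAt ℝ h (h' x) x e)
    (hTm : Measurable T) (hTR : ∀ x, |T x| ≤ R) (hTmono : ∀ x (s : ℝ), 0 ≤ s → T x ≤ T (x + s • e))
    (hTD : ∀ x, HasLineDerivAt ℝ T (D x) x e) :
    0 ≤ -∫ x, h' x * T x ∧
      ∫⁻ x, ENNReal.ofReal (h x * D x) ≤ ENNReal.ofReal (-∫ x, h' x * T x) := by
  -- Step sizes for difference quotients of `T` in the direction `e`.
  set c : ℕ → ℝ := fun k => 1 / ((k : ℝ) + 1) with hc
  have hc0 : ∀ k, 0 < c k := fun k => by positivity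
  have hc1 : ∀ k, c k ≤ 1 := fun k => by
    rw [hc]; simp only; rw [div_le_one (by positivity)]; linarith [(Nat.cast_nonneg k : (0:ℝ) ≤ k)]
  have hclim : Tendsto c atTop (𝓝[≠] 0) :=
    tendsto_nhdsWithin_of_tendsto_nhds_of_eventually_within _ tendsto_one_div_add_atTop_nhds_zero_nat
      (Eventually.of_forall fun k => (hc0 k).ne')
  have hTshift : ∀ k, Measurable (fun x => T (x + c k • e)) := fun k =>
    hTm.comp (measurable_add_const _)
  have hbd : ∀ {g : (Fin n → ℝ) → ℝ} {S : (Fin n → ℝ) → ℝ}, Integrable g → Measurable S →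
      (∀ x, |S x| ≤ R) → Integrable (fun x => g x * S x) := fun hg hS hSR =>
    hg.mul_bdd (c := R) hS.aestronglyMeasurable (Eventually.of_forall fun x => hSR x)
  set q : ℕ → (Fin n → ℝ) → ℝ := fun k x => h x * ((T (x + c k • e) - T x) / c k) with hq
  have hq0 : ∀ k x, 0 ≤ q k x := fun k x =>
    mul_nonneg (hh0 x) (div_nonneg (sub_nonneg.mpr (hTmono x (c k) (hc0 k).le)) (hc0 k).le)
  have hi1 : ∀ k, Integrable (fun x => h x * T (x + c k • e)) := fun k =>
    hbd hhi (hTshift k) fun x => hTR _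
  have hi2 : Integrable (fun x => h x * T x) := hbd hhi hTm hTR
  have hqi : ∀ k, Integrable (q k) := fun k => by
    refine (((hi1 k).sub hi2).div_const (c k)).congr (Eventually.of_forall fun x => ?_)
    simp only [hq, Pi.sub_apply]; ring
  -- Discrete integration by parts: translation invariance moves the difference quotient from `T` to
  -- `h`.
  have hqint : ∀ k, ∫ x, q k x = ∫ x, (h (x - c k • e) - h x) / c k * T x := by
    intro k
    have e1 : ∫ x, q k x = ((∫ x, h x * T (x + c k • e)) - ∫ x, h x * T x) / c k := by
      rw [← integral_sub (hi1 k) hi2, ← integral_div]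
      refine integral_congr_ae (Eventually.of_forall fun x => ?_)
      simp only [hq]; ring
    have e2 : ∫ x, h x * T (x + c k • e) = ∫ x, h (x - c k • e) * T x := by
      rw [← integral_add_right_eq_self (fun x => h (x - c k • e) * T x) (c k • e)]
      simp
    have hi3 : Integrable (fun x => h (x - c k • e) * T x) :=
      hbd (hhi.comp_sub_right (c k • e)) hTm hTR
    rw [e1, e2, ← integral_sub hi3 hi2, ← integral_div]
    refine integral_congr_ae (Eventually.of_forall fun x => ?_)
    simp only; ring
  have hlim : Tendsto (fun k => ∫ x, q k x) atTop (𝓝 (-∫ x, h' x * T x)) := by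
    simp only [hqint]
    rw [← integral_neg]
    refine tendsto_integral_of_dominated_convergence (fun x => H x * R) (fun k => ?_)
      (hHi.mul_const R) (fun k => Eventually.of_forall fun x => ?_) (Eventually.of_forall fun x => ?_)
    · exact ((((hhi.comp_sub_right (c k • e)).sub hhi).div_const _).aestronglyMeasurable).mul
        hTm.aestronglyMeasurable
    · have h1 := hlip x (c k) (hc0 k).le (hc1 k)
      have h2 : |(h (x - c k • e) - h x) / c k| ≤ H x := by
        rw [abs_div, abs_of_pos (hc0 k), div_le_iff₀ (hc0 k)]
        linarith
      rw [Real.norm_eq_abs, abs_mul]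
      exact mul_le_mul h2 (hTR x) (abs_nonneg _) ((abs_nonneg _).trans h2)
    · have h1 := (hasDerivAt_iff_tendsto_slope.mp (hh' x))
      have hneg : Tendsto (fun k => -c k) atTop (𝓝[≠] 0) := by
        refine tendsto_nhdsWithin_of_tendsto_nhds_of_eventually_within _ ?_
          (Eventually.of_forall fun k => neg_ne_zero.mpr (hc0 k).ne')
        have := (tendsto_nhdsWithin_iff.mp hclim).1.neg
        simpa using this
      have h2 := ((h1.comp hneg).neg).mul_const (T x)
      rw [neg_mul] at h2
      refine h2.congr fun k => ?_
      simp only [Function.comp, slope_def_field, zero_smul, add_zero, neg_smul, ← sub_eq_add_neg]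
      rw [sub_zero, div_neg, neg_neg]
  have hnn : 0 ≤ -∫ x, h' x * T x :=
    ge_of_tendsto' hlim fun k => integral_nonneg (hq0 k)
  refine ⟨hnn, ?_⟩
  have hpt : ∀ x, ENNReal.ofReal (h x * D x) = liminf (fun k => ENNReal.ofReal (q k x)) atTop := by
    intro x
    refine (Tendsto.liminf_eq ?_).symm
    refine (ENNReal.continuous_ofReal.tendsto _).comp (Tendsto.const_mul _ ?_)
    have h1 := (hasDerivAt_iff_tendsto_slope.mp (hTD x)).comp hclim
    refine h1.congr fun k => ?_
    simp [slope_def_field]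
  -- The difference quotients of the monotone `T` are nonnegative, so Fatou applies. It gives only
  -- an inequality, in the direction the transport argument needs; a singular part of the derivative
  -- would be discarded here.
  calc ∫⁻ x, ENNReal.ofReal (h x * D x)
      = ∫⁻ x, liminf (fun k => ENNReal.ofReal (q k x)) atTop := lintegral_congr hpt
    _ ≤ liminf (fun k => ∫⁻ x, ENNReal.ofReal (q k x)) atTop := by
        refine lintegral_liminf_le' fun k => ?_
        exact (hqi k).aestronglyMeasurable.aemeasurable.ennreal_ofReal
    _ = ENNReal.ofReal (-∫ x, h' x * T x) := by
        refine Tendsto.liminf_eq ?_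
        have : (fun k => ∫⁻ x, ENNReal.ofReal (q k x)) = fun k => ENNReal.ofReal (∫ x, q k x) := by
          funext k
          rw [ofReal_integral_eq_lintegral_ofReal (hqi k) (Eventually.of_forall (hq0 k))]
        rw [this]
        exact (ENNReal.continuous_ofReal.tendsto _).comp hlim

theorem abs_exp_sub_one_le_mul_exp (u : ℝ) : |Real.exp u - 1| ≤ |u| * Real.exp |u| := by
  have h1 := Real.add_one_le_exp u
  have h2 := Real.add_one_le_exp (-u)
  have h3 : Real.exp u * Real.exp (-u) = 1 := by rw [← Real.exp_add]; simp
  have h4 : Real.exp u ≤ Real.exp |u| := Real.exp_le_exp.mpr (le_abs_self u)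
  have h5 : 1 ≤ Real.exp |u| := Real.one_le_exp (abs_nonneg u)
  rw [abs_le]
  constructor
  · nlinarith [neg_abs_le u, abs_nonneg u, le_abs_self u]
  · have : Real.exp u - 1 ≤ u * Real.exp u := by nlinarith [Real.exp_pos u]
    refine this.trans ?_
    exact mul_le_mul (le_abs_self u) h4 (Real.exp_pos u).le (abs_nonneg u)

/-- A positive function with bounded logarithmic derivative: increments of its powers. -/
theorem abs_rpow_sub_rpow_le {n : ℕ} {e : Fin n → ℝ} {f f' : (Fin n → ℝ) → ℝ} {C k : ℝ} (hk : 0 ≤ k)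
    (hf0 : ∀ x, 0 < f x) (hf' : ∀ x, HasLineDerivAt ℝ f (f' x) x e) (hC : ∀ x, |f' x| ≤ C * f x)
    (x : Fin n → ℝ) {s : ℝ} (hs0 : 0 ≤ s) (hs1 : s ≤ 1) :
    |f (x - s • e) ^ k - f x ^ k| ≤ s * (k * C * Real.exp (k * C) * f x ^ k) := by
  have hC0 : 0 ≤ C := by
    have := (abs_nonneg _).trans (hC 0)
    exact nonneg_of_mul_nonneg_left this (hf0 0)
  have hder : ∀ r : ℝ, HasDerivAt (fun r => Real.log (f (x - r • e)))
      (-f' (x - r • e) / f (x - r • e)) r := by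
    intro r
    have h1 : HasDerivAt (fun u : ℝ => f ((x - r • e) + u • e)) (f' (x - r • e)) 0 := hf' _
    have h2 : HasDerivAt (fun t : ℝ => r - t) (-1) r := by
      simpa using (hasDerivAt_id r).const_sub r
    have h3 : HasDerivAt (fun t : ℝ => f ((x - r • e) + (r - t) • e)) (f' (x - r • e) * -1) r :=
      HasDerivAt.comp (h₂ := fun u : ℝ => f ((x - r • e) + u • e)) r (by simpa using h1) h2
    have h4 : (fun t : ℝ => f ((x - r • e) + (r - t) • e)) = fun t => f (x - t • e) := by
      funext t; congr 1; module
    rw [h4, mul_neg_one] at h3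
    exact h3.log (hf0 _).ne'
  -- The hypothesis says that log f is `C`-Lipschitz along `e`; exponentiating `k` times its
  -- increment gives the claim.
  have hlog : |Real.log (f (x - s • e)) - Real.log (f x)| ≤ C * s := by
    have := (convex_univ (𝕜 := ℝ) (E := ℝ)).norm_image_sub_le_of_norm_hasDerivWithin_le
      (f := fun r => Real.log (f (x - r • e))) (C := C) (x := 0) (y := s)
      (fun r _ => (hder r).hasDerivWithinAt) (fun r _ => by
        rw [Real.norm_eq_abs, abs_div, abs_neg, abs_of_pos (hf0 _), div_le_iff₀ (hf0 _)]
        exact hC _) (mem_univ _) (mem_univ _)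
    simpa [abs_of_nonneg hs0] using this
  set u := k * (Real.log (f (x - s • e)) - Real.log (f x)) with hu
  have hu1 : |u| ≤ k * C * s := by
    rw [hu, abs_mul, abs_of_nonneg hk]
    calc _ ≤ k * (C * s) := by gcongr
      _ = _ := by ring
  have e1 : f (x - s • e) ^ k - f x ^ k = f x ^ k * (Real.exp u - 1) := by
    rw [mul_sub, mul_one, Real.rpow_def_of_pos (hf0 _), Real.rpow_def_of_pos (hf0 x), ← Real.exp_add, hu]
    congr 2
    ring
  rw [e1, abs_mul, abs_of_pos (Real.rpow_pos_of_pos (hf0 x) k)]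
  have hkC : 0 ≤ k * C := mul_nonneg hk hC0
  calc f x ^ k * |Real.exp u - 1| ≤ f x ^ k * (|u| * Real.exp |u|) := by
        gcongr
        · exact (Real.rpow_pos_of_pos (hf0 x) k).le
        · exact abs_exp_sub_one_le_mul_exp u
    _ ≤ f x ^ k * ((k * C * s) * Real.exp (k * C)) := by
        have : |u| ≤ k * C := hu1.trans (mul_le_of_le_one_right hkC hs1)
        have := (Real.rpow_pos_of_pos (hf0 x) k).le
        gcongr
    _ = _ := by ring

theorem measurable_of_hasLineDerivAt {n : ℕ} {e : Fin n → ℝ} {T D : (Fin n → ℝ) → ℝ}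
    (hT : Measurable T) (hTD : ∀ x, HasLineDerivAt ℝ T (D x) x e) : Measurable D := by
  refine measurable_of_tendsto_metrizable
    (f := fun (k : ℕ) x => (T (x + (1 / ((k : ℝ) + 1)) • e) - T x) / (1 / ((k : ℝ) + 1)))
    (fun k => ((hT.comp (measurable_add_const _)).sub hT).div_const _) ?_
  rw [tendsto_pi_nhds]
  intro x
  have hclim : Tendsto (fun k : ℕ => 1 / ((k : ℝ) + 1)) atTop (𝓝[≠] 0) :=
    tendsto_nhdsWithin_of_tendsto_nhds_of_eventually_within _ tendsto_one_div_add_atTop_nhds_zero_nat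
      (Eventually.of_forall fun k => (by positivity : (0 : ℝ) < 1 / ((k : ℝ) + 1)).ne')
  refine ((hasDerivAt_iff_tendsto_slope.mp (hTD x)).comp hclim).congr fun k => ?_
  simp [slope_def_field]

theorem integral_knothe {n : ℕ} {R : ℝ} (hR : 0 < R) {F G : (Fin n → ℝ) → ℝ}
    (hF : IsDecayingDensity F) (hG : Continuous G) (hG0 : ∀ x, 0 < G x) {Ψ : (Fin n → ℝ) → ℝ}
    (hΨ : Continuous Ψ) (hΨ0 : ∀ x, 0 ≤ Ψ x) :
    Integrable (fun x => F x * Ψ (knothe R n F G x)) ∧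
    (∫ y, G y ∂(boxMeasure n R)) * ∫ x, F x * Ψ (knothe R n F G x) =
      (∫ x, F x) * ∫ y, G y * Ψ y ∂(boxMeasure n R) := by
  obtain ⟨C, hC⟩ := (isCompact_Icc (a := fun _ : Fin n => -R) (b := fun _ => R)).bddAbove_image
    hΨ.continuousOn
  have hm := hΨ.measurable.comp (measurable_knothe hR hF hG hG0)
  have hint : Integrable (fun x => F x * Ψ (knothe R n F G x)) := by
    refine hF.integrable.mul_bdd (c := C) hm.aestronglyMeasurable (Eventually.of_forall fun x => ?_)
    rw [Real.norm_of_nonneg (hΨ0 _)]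
    exact hC (mem_image_of_mem _ ⟨fun i => (knothe_mem hR n hF hG hG0 x i).1.le,
      fun i => (knothe_mem hR n hF hG hG0 x i).2.le⟩)
  refine ⟨hint, ?_⟩
  have h := lintegral_knothe hR n hF hG hG0 (ENNReal.measurable_ofReal.comp hΨ.measurable)
  have h1 := integral_boxMeasure_pos hR hG hG0
  have h2 := hF.integral_pos
  simp only [Function.comp, ← ENNReal.ofReal_mul (hF.pos _).le, ← ENNReal.ofReal_mul (hG0 _).le] at h
  rw [← ofReal_integral_eq_lintegral_ofReal hint
      (Eventually.of_forall fun x => mul_nonneg (hF.pos _).le (hΨ0 _)),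
    ← ofReal_integral_eq_lintegral_ofReal
      (integrable_boxMeasure (G := fun y => G y * Ψ y) (hG.mul hΨ))
      (Eventually.of_forall fun x => mul_nonneg (hG0 _).le (hΨ0 _)),
    ← ENNReal.ofReal_mul h1.le, ← ENNReal.ofReal_mul h2.le,
    ENNReal.ofReal_eq_ofReal_iff (mul_nonneg h1.le (integral_nonneg fun x =>
      mul_nonneg (hF.pos _).le (hΨ0 _))) (mul_nonneg h2.le (integral_nonneg fun x =>
      mul_nonneg (hG0 _).le (hΨ0 _)))] at h
  exact h

theorem geom_mean_prod_le {n : ℕ} (hn : 0 < n) {D : Fin n → ℝ} (hD : ∀ i, 0 < D i) :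
    (∏ i, D i) ^ (1 / (n : ℝ)) ≤ 1 / n * ∑ i, D i := by
  have hn' : (n : ℝ) ≠ 0 := by positivity
  have h := Real.geom_mean_le_arith_mean_weighted Finset.univ (fun _ => 1 / (n : ℝ)) D
    (fun _ _ => by positivity) (by simp [hn']) (fun i _ => (hD i).le)
  rwa [Real.finsetProd_rpow _ _ (fun i _ => (hD i).le), ← Finset.mul_sum] at h

/-- The transport proof of Sobolev. The Monge–Ampère equation and the arithmetic-geometric
inequality bound F·G(T)^{-1/n} by a multiple of f^k ΣD_i. Integration moves the derivatives from T
onto f^k, and Cauchy–Schwarz separates the Dirichlet energy of f from the second moment of G.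
Truncating the target to a box keeps T bounded, which justifies the integration by parts. -/
theorem knothe_sobolev_box {n : ℕ} (hn : 3 ≤ n) {p k C R : ℝ} (hp : p = 2 * n / (n - 2))
    (hk : k = 2 * (n - 1) / (n - 2)) (hR : 0 < R)
    {f : (Fin n → ℝ) → ℝ} {d : Fin n → (Fin n → ℝ) → ℝ} (hf0 : ∀ x, 0 < f x) (hfc : Continuous f)
    (hd : ∀ i x, HasLineDerivAt ℝ f (d i x) x (Pi.single i 1)) (hC : ∀ i x, |d i x| ≤ C * f x)
    (hF : IsDecayingDensity (fun x => f x ^ p)) (hh : Integrable (fun x => f x ^ k))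
    (hE : Integrable (fun x => ∑ i, d i x ^ 2))
    {G : (Fin n → ℝ) → ℝ} (hG : Continuous G) (hG0 : ∀ x, 0 < G x) :
    ((∫ x, f x ^ p) / ∫ y, G y ∂(boxMeasure n R)) ^ (1 - 2 / (n : ℝ)) *
        (n * ∫ y, G y ^ (1 - 1 / (n : ℝ)) ∂(boxMeasure n R)) ^ 2 ≤
      k ^ 2 * (∫ x, ∑ i, d i x ^ 2) * ∫ y, G y * ∑ i, y i ^ 2 ∂(boxMeasure n R) := by
  have hn3 : (3 : ℝ) ≤ n := by exact_mod_cast hn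
  have hn0 : (0 : ℝ) < n := by linarith
  have hn2 : (0 : ℝ) < n - 2 := by linarith
  have hk0 : 0 ≤ k := by rw [hk]; exact div_nonneg (by linarith) hn2.le
  -- The first identity says F^{1-1/n} = f^k; the second says f^{k-1} = F^{1/2}, the factor paired
  -- with |T| in Cauchy–Schwarz.
  have hkp : p * (1 - 1 / n) = k := by rw [hp, hk]; field_simp
  have hk1 : k - 1 = p / 2 := by rw [hp, hk]; field_simp; ring
  set F : (Fin n → ℝ) → ℝ := fun x => f x ^ p with hFdef
  set MF := ∫ x, F x with hMF
  set MG := ∫ y, G y ∂(boxMeasure n R) with hMG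
  have hMF0 : 0 < MF := hF.integral_pos
  have hMG0 : 0 < MG := integral_boxMeasure_pos hR hG hG0
  set m := MF / MG with hm
  have hm0 : 0 < m := by positivity
  set T := knothe R n F G with hT
  have hTm : Measurable T := measurable_knothe hR hF hG hG0
  have hTi : ∀ i, Measurable (fun x => T x i) := fun i => (measurable_pi_apply i).comp hTm
  have hTR : ∀ i x, |T x i| ≤ R := fun i x =>
    abs_le.mpr ⟨(knothe_mem hR n hF hG hG0 x i).1.le, (knothe_mem hR n hF hG hG0 x i).2.le⟩
  choose D hD0 hD hDp using exists_hasLineDerivAt_knothe hR n hF hG hG0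
  set h' : Fin n → (Fin n → ℝ) → ℝ := fun i x => k * f x ^ (k - 1) * d i x with hh'
  have hibp := fun i => lintegral_mul_lineDeriv_le (e := Pi.single i 1) (h := fun x => f x ^ k)
    (H := fun x => k * C * Real.exp (k * C) * f x ^ k) (h' := h' i) (T := fun x => T x i)
    (D := fun x => D x i) (R := R) (fun x => (Real.rpow_pos_of_pos (hf0 x) k).le) hh (hh.const_mul _)
    (fun x s hs0 hs1 => abs_rpow_sub_rpow_le hk0 hf0 (hd i) (hC i) x hs0 hs1)
    (fun x => by
      have h1 : HasDerivAt (fun t : ℝ => f (x + t • Pi.single i 1)) (d i x) 0 := hd i x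
      have h2 := h1.rpow_const (p := k) (Or.inl (hf0 _).ne')
      unfold HasLineDerivAt
      have h3 : d i x * k * f (x + (0 : ℝ) • Pi.single i 1) ^ (k - 1) = h' i x := by
        rw [zero_smul, add_zero]; ring
      rw [h3] at h2
      exact h2)
    (hTi i) (hTR i) (fun x s hs => knothe_le_add_single hR n hF hG hG0 x i hs) (fun x => hD x i)
  set b : Fin n → ℝ := fun i => -∫ x, h' i x * T x i with hb
  have hDm : ∀ i, Measurable (fun x => D x i) := fun i =>
    measurable_of_hasLineDerivAt (hTi i) fun x => hD x i
  -- arithmetic-geometric mean inequality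
  have hpt : ∀ x, F x * G (T x) ^ (-(1 / (n : ℝ))) ≤
      m ^ (1 / (n : ℝ)) / n * ∑ i, f x ^ k * D x i := by
    intro x
    have hP : 0 < ∏ i, D x i := Finset.prod_pos fun i _ => hD0 x i
    have hFx : 0 < F x := hF.pos x
    have e1 : G (T x) = F x / ((∏ i, D x i) * m) := by
      have := hDp x
      rw [← hMF, ← hMG] at this
      rw [hm]
      field_simp
      linarith
    have e2 : G (T x) ^ (-(1 / (n : ℝ))) =
        F x ^ (-(1 / (n : ℝ))) * ((∏ i, D x i) ^ (1 / (n : ℝ)) * m ^ (1 / (n : ℝ))) := by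
      rw [e1, Real.div_rpow hFx.le (by positivity), Real.rpow_neg (x := (∏ i, D x i) * m) (by positivity),
        div_inv_eq_mul, Real.mul_rpow hP.le hm0.le]
    have e3 : F x * F x ^ (-(1 / (n : ℝ))) = f x ^ k := by
      nth_rewrite 1 [← Real.rpow_one (F x)]
      rw [← Real.rpow_add hFx, hFdef, ← hkp, ← sub_eq_add_neg]
      exact (Real.rpow_mul (hf0 x).le _ _).symm
    rw [e2, ← mul_assoc, e3, ← Finset.mul_sum]
    have h1 := geom_mean_prod_le (by omega) (hD0 x)
    have h2 : 0 < f x ^ k := Real.rpow_pos_of_pos (hf0 x) k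
    have h3 : 0 < m ^ (1 / (n : ℝ)) := Real.rpow_pos_of_pos hm0 _
    calc f x ^ k * ((∏ i, D x i) ^ (1 / (n : ℝ)) * m ^ (1 / (n : ℝ)))
        ≤ f x ^ k * ((1 / n * ∑ i, D x i) * m ^ (1 / (n : ℝ))) := by gcongr
      _ = _ := by ring
  set A := ∫ y, G y ^ (1 - 1 / (n : ℝ)) ∂(boxMeasure n R) with hA
  have hA0 : 0 ≤ A := integral_nonneg fun y => (Real.rpow_pos_of_pos (hG0 y) _).le
  have hGA : Continuous (fun y => G y ^ (1 - 1 / (n : ℝ))) :=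
    hG.rpow_const fun y => Or.inl (hG0 y).ne'
  -- The push-forward identity is tested with Ψ = G^{-1/n}: its right side is the integral of
  -- G^{1-1/n}, and its left side is controlled by `hpt` and `hibp`.
  have hineq : MF * A ≤ MG * (m ^ (1 / (n : ℝ)) / n * ∑ i, b i) := by
    have h1 := lintegral_knothe hR n hF hG hG0 (Ψ := fun y => ENNReal.ofReal (G y ^ (-(1 / (n : ℝ)))))
      (ENNReal.measurable_ofReal.comp (hG.rpow_const fun y => Or.inl (hG0 y).ne').measurable)
    have h2 : ∫⁻ y, ENNReal.ofReal (G y) * ENNReal.ofReal (G y ^ (-(1 / (n : ℝ)))) ∂(boxMeasure n R) =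
        ENNReal.ofReal A := by
      rw [ofReal_integral_eq_lintegral_ofReal (integrable_boxMeasure hGA)
        (Eventually.of_forall fun y => (Real.rpow_pos_of_pos (hG0 y) _).le)]
      refine lintegral_congr fun y => ?_
      rw [← ENNReal.ofReal_mul (hG0 y).le]
      nth_rewrite 1 [← Real.rpow_one (G y)]
      rw [← Real.rpow_add (hG0 y), ← sub_eq_add_neg]
    have hb0 : ∀ i, 0 ≤ b i := fun i => (hibp i).1
    have hc0 : 0 ≤ m ^ (1 / (n : ℝ)) / n := by positivity
    have h3 : ∫⁻ x, ENNReal.ofReal (F x) * ENNReal.ofReal (G (T x) ^ (-(1 / (n : ℝ)))) ≤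
        ENNReal.ofReal (m ^ (1 / (n : ℝ)) / n * ∑ i, b i) := by
      calc _ ≤ ∫⁻ x, ENNReal.ofReal (m ^ (1 / (n : ℝ)) / n) *
              ∑ i, ENNReal.ofReal (f x ^ k * D x i) := by
            refine lintegral_mono fun x => ?_
            rw [← ENNReal.ofReal_mul (hF.pos x).le, ← ENNReal.ofReal_sum_of_nonneg
              (fun i _ => mul_nonneg (Real.rpow_pos_of_pos (hf0 x) k).le (hD0 x i).le),
              ← ENNReal.ofReal_mul hc0]
            exact ENNReal.ofReal_le_ofReal (hpt x)
        _ = ENNReal.ofReal (m ^ (1 / (n : ℝ)) / n) *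
              ∑ i, ∫⁻ x, ENNReal.ofReal (f x ^ k * D x i) := by
            rw [lintegral_const_mul' _ _ ENNReal.ofReal_ne_top, lintegral_finsetSum]
            intro i _
            exact ENNReal.measurable_ofReal.comp
              ((hfc.rpow_const fun x => Or.inl (hf0 x).ne').measurable.mul (hDm i))
        _ ≤ ENNReal.ofReal (m ^ (1 / (n : ℝ)) / n) * ∑ i, ENNReal.ofReal (b i) := by
            gcongr with i
            exact (hibp i).2
        _ = _ := by
            rw [← ENNReal.ofReal_sum_of_nonneg (fun i _ => hb0 i), ← ENNReal.ofReal_mul hc0]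
    have h4 : ENNReal.ofReal (MF * A) ≤ ENNReal.ofReal (MG * (m ^ (1 / (n : ℝ)) / n * ∑ i, b i)) := by
      rw [ENNReal.ofReal_mul hMF0.le, ENNReal.ofReal_mul hMG0.le, ← h2, ← h1]
      gcongr
    exact (ENNReal.ofReal_le_ofReal_iff
      (mul_nonneg hMG0.le (mul_nonneg hc0 (Finset.sum_nonneg fun i _ => hb0 i)))).mp h4
  -- Cauchy-Schwarz
  set E := ∫ x, ∑ i, d i x ^ 2 with hEdef
  set B := ∫ y, G y * ∑ i, y i ^ 2 ∂(boxMeasure n R) with hBdef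
  have hE0 : 0 ≤ E := integral_nonneg fun x => Finset.sum_nonneg fun i _ => sq_nonneg _
  have hB0 : 0 ≤ B := integral_nonneg fun y =>
    mul_nonneg (hG0 y).le (Finset.sum_nonneg fun i _ => sq_nonneg _)
  obtain ⟨hTint, hTeq⟩ := integral_knothe hR hF hG hG0 (Ψ := fun y => ∑ i, y i ^ 2)
    (by fun_prop) (fun y => Finset.sum_nonneg fun i _ => sq_nonneg _)
  have hTeq' : ∫ x, F x * ∑ i, T x i ^ 2 = m * B := by
    rw [hm, div_mul_eq_mul_div, eq_div_iff hMG0.ne', mul_comm]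
    exact hTeq
  have hdm : ∀ i, Measurable (d i) := fun i => measurable_of_hasLineDerivAt hfc.measurable (hd i)
  have hsum : ∑ i, b i ≤ k * (√E * √(m * B)) := by
    have hi : ∀ i, Integrable (fun x => h' i x * T x i) := by
      intro i
      have h1 : Integrable (h' i) := by
        refine (hh.const_mul (k * C)).mono' ?_ (Eventually.of_forall fun x => ?_)
        · exact (((hfc.rpow_const fun x => Or.inl (hf0 x).ne').measurable.const_mul k).mul
            (hdm i)).aestronglyMeasurable
        · have h2 : 0 < f x ^ (k - 1) := Real.rpow_pos_of_pos (hf0 x) _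
          have h3 : f x ^ k = f x ^ (k - 1) * f x := by
            nth_rewrite 3 [← Real.rpow_one (f x)]
            rw [← Real.rpow_add (hf0 x)]; congr 1; ring
          simp only [hh']
          rw [Real.norm_eq_abs, abs_mul, abs_mul, abs_of_nonneg hk0, abs_of_pos h2, h3]
          calc k * f x ^ (k - 1) * |d i x| ≤ k * f x ^ (k - 1) * (C * f x) := by
                gcongr; exact hC i x
            _ = _ := by ring
      exact h1.mul_bdd (c := R) (hTi i).aestronglyMeasurable (Eventually.of_forall fun x => hTR i x)
    set α : (Fin n → ℝ) → ℝ := fun x => √(∑ i, d i x ^ 2) with hα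
    set β : (Fin n → ℝ) → ℝ := fun x => f x ^ (p / 2) * √(∑ i, T x i ^ 2) with hβ
    have hα2 : ∀ x, α x ^ 2 = ∑ i, d i x ^ 2 := fun x =>
      Real.sq_sqrt (Finset.sum_nonneg fun i _ => sq_nonneg _)
    have hβ2 : ∀ x, β x ^ 2 = F x * ∑ i, T x i ^ 2 := fun x => by
      rw [hβ]; simp only
      rw [mul_pow, Real.sq_sqrt (Finset.sum_nonneg fun i _ => sq_nonneg _), hFdef]
      simp only
      rw [← Real.rpow_natCast, ← Real.rpow_mul (hf0 x).le]
      norm_num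
    have hαL : MemLp α 2 volume := by
      rw [memLp_two_iff_integrable_sq]
      · simpa only [hα2] using hE
      · exact (Finset.measurable_fun_sum _ fun i _ => (hdm i).pow_const 2).sqrt.aestronglyMeasurable
    have hβL : MemLp β 2 volume := by
      rw [memLp_two_iff_integrable_sq]
      · simpa only [hβ2] using hTint
      · exact ((hfc.rpow_const fun x => Or.inl (hf0 x).ne').measurable.mul
          (Finset.measurable_fun_sum _ fun i _ => (hTi i).pow_const 2).sqrt).aestronglyMeasurable
    have hβ0 : ∀ x, 0 ≤ β x := fun x =>
      mul_nonneg (Real.rpow_pos_of_pos (hf0 x) _).le (Real.sqrt_nonneg _)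
    have hcs := integral_mul_le_Lp_mul_Lq_of_nonneg (μ := volume) Real.HolderConjugate.two_two
      (f := α) (g := β) (Eventually.of_forall fun x => Real.sqrt_nonneg _) (Eventually.of_forall hβ0)
      (by simpa using hαL) (by simpa using hβL)
    simp only [Real.rpow_two, hα2, hβ2, ← Real.sqrt_eq_rpow] at hcs
    rw [hTeq'] at hcs
    calc ∑ i, b i = ∫ x, ∑ i, -(h' i x * T x i) := by
          rw [integral_finsetSum _ fun i _ => (hi i).fun_neg]
          simp only [hb, integral_neg]
      _ ≤ ∫ x, k * (α x * β x) := by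
          refine integral_mono (integrable_finsetSum _ fun i _ => (hi i).fun_neg)
            ((hαL.integrable_mul hβL).const_mul k) fun x => ?_
          have h1 := Real.sum_mul_le_sqrt_mul_sqrt Finset.univ (fun i => -d i x) (fun i => T x i)
          simp only [neg_sq] at h1
          have h2 : 0 < f x ^ (p / 2) := Real.rpow_pos_of_pos (hf0 x) _
          have e : ∑ i, -(h' i x * T x i) = k * f x ^ (p / 2) * ∑ i, -d i x * T x i := by
            rw [Finset.mul_sum]
            refine Finset.sum_congr rfl fun i _ => ?_
            simp only [hh', hk1]; ring
          simp only
          rw [e]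
          calc k * f x ^ (p / 2) * ∑ i, -d i x * T x i
              ≤ k * f x ^ (p / 2) * (√(∑ i, d i x ^ 2) * √(∑ i, T x i ^ 2)) := by gcongr
            _ = k * (α x * β x) := by simp only [hα, hβ]; ring
      _ = k * ∫ x, α x * β x := integral_const_mul _ _
      _ ≤ k * (√E * √(m * B)) := by gcongr
  have h1 : n * (m * A) ≤ m ^ (1 / (n : ℝ)) * (k * (√E * √(m * B))) := by
    have h2 : m * A ≤ m ^ (1 / (n : ℝ)) / n * ∑ i, b i := by
      rw [hm, div_mul_eq_mul_div, div_le_iff₀ hMG0, ← hm]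
      linarith
    calc n * (m * A) ≤ n * (m ^ (1 / (n : ℝ)) / n * ∑ i, b i) := by gcongr
      _ = m ^ (1 / (n : ℝ)) * ∑ i, b i := by field_simp
      _ ≤ _ := by gcongr
  have h2 : (n * (m * A)) ^ 2 ≤ (m ^ (1 / (n : ℝ)) * (k * (√E * √(m * B)))) ^ 2 := by
    gcongr
  have e1 : (m ^ (1 / (n : ℝ)) * (k * (√E * √(m * B)))) ^ 2 =
      m ^ (2 / (n : ℝ)) * m * (k ^ 2 * E * B) := by
    rw [mul_pow, mul_pow, mul_pow, Real.sq_sqrt hE0, Real.sq_sqrt (by positivity),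
      ← Real.rpow_natCast (m ^ (1 / (n : ℝ))), ← Real.rpow_mul hm0.le]
    rw [show 1 / (n : ℝ) * ((2 : ℕ) : ℝ) = 2 / n by push_cast; ring]
    ring
  -- Both sides carry the factor m^{2/n}·m, leaving the power 1 - 2/n of the mass ratio.
  have e2 : (n * (m * A)) ^ 2 = m ^ (2 / (n : ℝ)) * m * (m ^ (1 - 2 / (n : ℝ)) * (n * A) ^ 2) := by
    have : m ^ (2 / (n : ℝ)) * m ^ (1 - 2 / (n : ℝ)) = m := by
      rw [← Real.rpow_add hm0]; simp
    calc (n * (m * A)) ^ 2 = m * m * (n * A) ^ 2 := by ring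
      _ = (m ^ (2 / (n : ℝ)) * m ^ (1 - 2 / (n : ℝ))) * m * (n * A) ^ 2 := by rw [this]
      _ = _ := by ring
  rw [e1, e2] at h2
  exact le_of_mul_le_mul_left h2 (by positivity)

theorem tendsto_integral_boxMeasure {n : ℕ} {φ : (Fin n → ℝ) → ℝ} (hφ : Integrable φ) :
    Tendsto (fun k : ℕ => ∫ y, φ y ∂(boxMeasure n ((k : ℝ) + 1))) atTop (𝓝 (∫ y, φ y)) := by
  have hU : ⋃ k : ℕ, Icc (fun _ : Fin n => -((k : ℝ) + 1)) (fun _ => (k : ℝ) + 1) = univ := by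
    refine eq_univ_of_forall fun x => ?_
    obtain ⟨k, hk⟩ := exists_nat_ge (∑ i, |x i|)
    have h : ∀ i, |x i| ≤ (k : ℝ) + 1 := fun i =>
      (Finset.single_le_sum (f := fun i => |x i|) (fun j _ => abs_nonneg _) (Finset.mem_univ i)).trans
        (hk.trans (by linarith))
    exact mem_iUnion.mpr ⟨k, fun i => (abs_le.mp (h i)).1, fun i => (abs_le.mp (h i)).2⟩
  have h := tendsto_setIntegral_of_monotone (μ := volume) (f := φ)
    (s := fun k : ℕ => Icc (fun _ : Fin n => -((k : ℝ) + 1)) (fun _ => (k : ℝ) + 1))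
    (fun _ => measurableSet_Icc) (fun a b hab => Icc_subset_Icc (fun i => by
      have : (a : ℝ) ≤ b := by exact_mod_cast hab
      linarith) (fun i => by
      have : (a : ℝ) ≤ b := by exact_mod_cast hab
      linarith)) (by rw [hU]; exact hφ.integrableOn)
  rw [hU, setIntegral_univ] at h
  simpa only [boxMeasure_eq] using h

/-! ### Euclidean coordinates and the moments of the target density -/

theorem integral_comp_toLp {N : ℕ} (φ : Space N → ℝ) :
    ∫ x : Fin N → ℝ, φ (WithLp.toLp 2 x) = ∫ y, φ y :=
  (PiLp.volume_preserving_toLp (Fin N)).integral_comp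
    (MeasurableEquiv.toLp 2 (Fin N → ℝ)).measurableEmbedding φ

theorem integrable_comp_toLp {N : ℕ} {φ : Space N → ℝ} (hφ : Integrable φ) :
    Integrable (fun x : Fin N → ℝ => φ (WithLp.toLp 2 x)) :=
  ((PiLp.volume_preserving_toLp (Fin N)).integrable_comp_emb
    (MeasurableEquiv.toLp 2 (Fin N → ℝ)).measurableEmbedding).mpr hφ

theorem integrable_one_add_norm_sq_rpow {N : ℕ} {s : ℝ} (hs : (N : ℝ) < 2 * s) :
    Integrable (fun x : Space N => (1 + ‖x‖ ^ 2) ^ (-s)) := by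
  have h := integrable_rpow_neg_one_add_norm_sq (E := Space N) (μ := volume) (r := 2 * s)
    (by simpa using hs)
  simpa [neg_div] using h

/-- The mass of `(1 + |x|²)^{-N}`. -/
def sobolevMass (N : ℕ) : ℝ := ∫ x : Space N, (1 + ‖x‖ ^ 2) ^ (-(N : ℝ))

/-- The second moment of `(1 + |x|²)^{-N}`. -/
def sobolevMoment (N : ℕ) : ℝ := ∫ x : Space N, (1 + ‖x‖ ^ 2) ^ (-(N : ℝ)) * ‖x‖ ^ 2

theorem one_add_norm_sq_rpow_split {N : ℕ} (x : Space N) :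
    (1 + ‖x‖ ^ 2) ^ (-((N : ℝ) - 1)) =
      (1 + ‖x‖ ^ 2) ^ (-(N : ℝ)) + (1 + ‖x‖ ^ 2) ^ (-(N : ℝ)) * ‖x‖ ^ 2 := by
  have h : 0 < 1 + ‖x‖ ^ 2 := by positivity
  rw [show -((N : ℝ) - 1) = -(N : ℝ) + 1 by ring, Real.rpow_add h, Real.rpow_one]
  ring

section

variable {N : ℕ} (hN : 3 ≤ N)
include hN

theorem integrable_sobolevMass :
    Integrable (fun x : Space N => (1 + ‖x‖ ^ 2) ^ (-(N : ℝ))) := by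
  have h : (3 : ℝ) ≤ N := by exact_mod_cast hN
  exact integrable_one_add_norm_sq_rpow (by linarith)

theorem integrable_sobolevMoment :
    Integrable (fun x : Space N => (1 + ‖x‖ ^ 2) ^ (-(N : ℝ)) * ‖x‖ ^ 2) := by
  have h : (3 : ℝ) ≤ N := by exact_mod_cast hN
  have h1 := integrable_one_add_norm_sq_rpow (N := N) (s := (N : ℝ) - 1) (by linarith)
  refine (h1.sub (integrable_sobolevMass hN)).congr (Eventually.of_forall fun x => ?_)
  simp only [Pi.sub_apply, one_add_norm_sq_rpow_split x]
  ring

theorem sobolevMass_pos : 0 < sobolevMass N := by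
  have hpos : ∀ x : Space N, 0 < (1 + ‖x‖ ^ 2) ^ (-(N : ℝ)) := fun x => by positivity
  rw [sobolevMass, integral_pos_iff_support_of_nonneg (fun x => (hpos x).le)
    (integrable_sobolevMass hN)]
  have : Function.support (fun x : Space N => (1 + ‖x‖ ^ 2) ^ (-(N : ℝ))) = univ := by
    ext x; simpa using (hpos x).ne'
  rw [this]
  exact isOpen_univ.measure_pos _ univ_nonempty

theorem nontrivial_space : Nontrivial (Space N) := by
  have : Nonempty (Fin N) := ⟨⟨0, by omega⟩⟩
  infer_instance

/-- Integrate the derivative of r^N (1+r²)^{1-N}, whose boundary values vanish. Since mass plus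
moment is ∫(1+|x|²)^{1-N}, this reads N(M+B) = 2(N-1)B. -/
theorem sobolevMoment_eq : ((N : ℝ) - 2) * sobolevMoment N = N * sobolevMass N := by
  have h3 : (3 : ℝ) ≤ N := by exact_mod_cast hN
  have := nontrivial_space hN
  set φ : ℝ → ℝ := fun r => N * (1 + r ^ 2) ^ (-((N : ℝ) - 1)) -
    2 * ((N : ℝ) - 1) * ((1 + r ^ 2) ^ (-(N : ℝ)) * r ^ 2) with hφ
  have hi1 := integrable_one_add_norm_sq_rpow (N := N) (s := (N : ℝ) - 1) (by linarith)
  have hφi : Integrable (fun x : Space N => φ ‖x‖) :=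
    (hi1.const_mul _).sub ((integrable_sobolevMoment hN).const_mul _)
  have h1 := integral_fun_norm_addHaar (volume : Measure (Space N)) φ
  have h2 := (integrable_fun_norm_addHaar (volume : Measure (Space N)) (f := φ)).mp hφi
  rw [finrank_euclideanSpace_fin] at h1 h2
  have hN1 : ((N - 1 : ℕ) : ℝ) = N - 1 := by rw [Nat.cast_sub (by omega)]; simp
  have h4 : ∫ r in Ioi (0 : ℝ), r ^ (N - 1) • φ r = 0 := by
    have hder : ∀ r ∈ Ioi (0 : ℝ), HasDerivAt (fun r : ℝ => r ^ N * (1 + r ^ 2) ^ (-((N : ℝ) - 1)))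
        (r ^ (N - 1) • φ r) r := by
      intro r hr
      have hr0 : (0 : ℝ) < r := hr
      have hq : 0 < 1 + r ^ 2 := by positivity
      have d1 : HasDerivAt (fun r : ℝ => 1 + r ^ 2) (2 * r) r := by
        simpa using (hasDerivAt_pow 2 r).const_add 1
      have d2 := d1.rpow_const (p := -((N : ℝ) - 1)) (Or.inl hq.ne')
      have d3 := (hasDerivAt_pow N r).mul d2
      refine d3.congr_deriv ?_
      have e1 : r ^ N = r ^ (N - 1) * r := by
        rw [← pow_succ]; congr 1; omega
      have e2 : -((N : ℝ) - 1) - 1 = -N := by ring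
      rw [e2, smul_eq_mul, hφ, e1]
      ring
    have hlim : Tendsto (fun r : ℝ => r ^ N * (1 + r ^ 2) ^ (-((N : ℝ) - 1))) atTop (𝓝 0) := by
      have hl := tendsto_rpow_neg_atTop (y := (N : ℝ) - 2) (by linarith)
      refine squeeze_zero' ?_ ?_ hl
      · filter_upwards [eventually_gt_atTop 0] with r hr
        positivity
      · filter_upwards [eventually_gt_atTop 0] with r hr
        have : (1 + r ^ 2) ^ (-((N : ℝ) - 1)) ≤ (r ^ 2) ^ (-((N : ℝ) - 1)) :=
          Real.rpow_le_rpow_of_nonpos (by positivity) (by linarith) (by linarith)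
        calc r ^ N * (1 + r ^ 2) ^ (-((N : ℝ) - 1)) ≤ r ^ N * (r ^ 2) ^ (-((N : ℝ) - 1)) := by gcongr
          _ = r ^ (-((N : ℝ) - 2)) := by
            rw [← Real.rpow_natCast r N, ← Real.rpow_natCast r 2, ← Real.rpow_mul hr.le,
              ← Real.rpow_add hr]
            congr 1; push_cast; ring
    have := integral_Ioi_of_hasDerivAt_of_tendsto (a := 0) (m := 0)
      (f := fun r : ℝ => r ^ N * (1 + r ^ 2) ^ (-((N : ℝ) - 1))) ?_ hder h2 hlim
    · rw [this]
      have : N ≠ 0 := by omega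
      simp [this]
    · have : Continuous (fun r : ℝ => r ^ N * (1 + r ^ 2) ^ (-((N : ℝ) - 1))) := by
        refine (continuous_pow N).mul ((by fun_prop : Continuous fun r : ℝ => 1 + r ^ 2).rpow_const
          fun r => Or.inl (by positivity))
      exact this.continuousWithinAt
  rw [h4] at h1
  simp only [smul_zero] at h1
  have e : ∫ x : Space N, φ ‖x‖ = N * (sobolevMass N + sobolevMoment N) -
      2 * ((N : ℝ) - 1) * sobolevMoment N := by
    have h5 : sobolevMass N + sobolevMoment N =
        ∫ x : Space N, (1 + ‖x‖ ^ 2) ^ (-((N : ℝ) - 1)) := by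
      rw [sobolevMass, sobolevMoment, ← integral_add (integrable_sobolevMass hN)
        (integrable_sobolevMoment hN)]
      simp only [one_add_norm_sq_rpow_split]
    rw [h5, sobolevMoment, ← integral_const_mul, ← integral_const_mul,
      ← integral_sub (hi1.const_mul _) ((integrable_sobolevMoment hN).const_mul _)]
  rw [e] at h1
  linarith

/-- The sharp Sobolev inequality for positive functions comparable to the bubble from above. -/
theorem sobolev_of_decaying {f : Space N → ℝ} {C : ℝ} (hf0 : ∀ x, 0 < f x) (hf : ContDiff ℝ 1 f)
    (hfC : ∀ x, f x ≤ C * (1 + ‖x‖ ^ 2) ^ (-(((N : ℝ) - 2) / 2)))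
    (hgC : ∀ x, ‖gradient f x‖ ≤ C * f x) (hE : Integrable (fun x => ‖gradient f x‖ ^ 2)) :
    N * ((N : ℝ) - 2) * sobolevMass N ^ (2 / (N : ℝ)) *
      (∫ x, f x ^ critExp N) ^ (1 - 2 / (N : ℝ)) ≤ ∫ x, ‖gradient f x‖ ^ 2 := by
  have h3 : (3 : ℝ) ≤ N := by exact_mod_cast hN
  have hN0 : (0 : ℝ) < N := by linarith
  have hN2 : (0 : ℝ) < N - 2 := by linarith
  have hC0 : 0 ≤ C := by
    have := (norm_nonneg _).trans (hgC 0)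
    exact nonneg_of_mul_nonneg_left this (hf0 0)
  have hfc : Continuous f := hf.continuous
  have hfd : Differentiable ℝ f := hf.differentiable (by simp)
  set p := critExp N with hp
  set k : ℝ := 2 * (N - 1) / (N - 2) with hk
  have hp0 : 0 < p := by rw [hp, critExp]; positivity
  have hk0 : 0 < k := by rw [hk]; exact div_pos (by linarith) hN2
  have hq : ∀ x : Space N, 0 < 1 + ‖x‖ ^ 2 := fun x => by positivity
  have hpow : ∀ s, 0 ≤ s → ∀ x, f x ^ s ≤ C ^ s * (1 + ‖x‖ ^ 2) ^ (-(((N : ℝ) - 2) / 2) * s) := by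
    intro s hs x
    rw [Real.rpow_mul (hq x).le, ← Real.mul_rpow hC0 (Real.rpow_nonneg (hq x).le _)]
    exact Real.rpow_le_rpow (hf0 x).le (hfC x) hs
  have hep : -(((N : ℝ) - 2) / 2) * p = -N := by rw [hp, critExp]; field_simp
  have hek : -(((N : ℝ) - 2) / 2) * k = -((N : ℝ) - 1) := by rw [hk]; field_simp
  have hfp := hpow p hp0.le
  have hfk := hpow k hk0.le
  rw [hep] at hfp
  rw [hek] at hfk
  -- the data on `Fin N → ℝ`
  set f' : (Fin N → ℝ) → ℝ := fun x => f (WithLp.toLp 2 x) with hf'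
  set d : Fin N → (Fin N → ℝ) → ℝ := fun i x => gradient f (WithLp.toLp 2 x) i with hd
  have hcont : Continuous (fun x : Fin N → ℝ => (WithLp.toLp 2 x : Space N)) :=
    PiLp.continuous_toLp 2 _
  have hline : ∀ i x, HasLineDerivAt ℝ f' (d i x) x (Pi.single i 1) := by
    intro i x
    have h1 := (hfd (WithLp.toLp 2 x)).hasFDerivAt.hasLineDerivAt (EuclideanSpace.single i (1 : ℝ))
    have h2 : fderiv ℝ f (WithLp.toLp 2 x) (EuclideanSpace.single i (1 : ℝ)) = d i x := by
      simp only [hd]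
      have : inner ℝ (gradient f (WithLp.toLp 2 x)) (EuclideanSpace.single i (1 : ℝ)) =
          fderiv ℝ f (WithLp.toLp 2 x) (EuclideanSpace.single i (1 : ℝ)) := by
        rw [gradient, InnerProductSpace.toDual_symm_apply]
      rw [← this, EuclideanSpace.inner_single_right]
      simp
    rw [h2] at h1
    unfold HasLineDerivAt at h1 ⊢
    simpa [hf', WithLp.toLp_add, WithLp.toLp_smul, PiLp.toLp_single] using h1
  have hnorm : ∀ x, ∑ i, d i x ^ 2 = ‖gradient f (WithLp.toLp 2 x)‖ ^ 2 := fun x =>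
    (EuclideanSpace.real_norm_sq_eq _).symm
  have hdC : ∀ i x, |d i x| ≤ C * f' x := fun i x =>
    (PiLp.norm_apply_le (gradient f (WithLp.toLp 2 x)) i).trans (hgC _)
  have hsq : ∀ x : Fin N → ℝ, ‖(WithLp.toLp 2 x : Space N)‖ ^ 2 = ∑ i, x i ^ 2 := fun x =>
    EuclideanSpace.real_norm_sq_eq _
  -- Each factor 1 + x_i² is at most 1 + |x|², so the bound (1+|x|²)^{-N} is dominated by the
  -- product required of a decaying density.
  have hFdec : IsDecayingDensity (fun x => f' x ^ p) := by
    refine ⟨(hfc.comp hcont).rpow_const fun x => Or.inl (hf0 _).ne',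
      fun x => Real.rpow_pos_of_pos (hf0 _) _, C ^ p, fun x => (hfp _).trans ?_⟩
    gcongr
    rw [hsq, Real.rpow_neg (by positivity), Finset.prod_inv_distrib, Real.rpow_natCast]
    gcongr
    calc ∏ i, (1 + x i ^ 2) ≤ ∏ _i : Fin N, (1 + ∑ i, x i ^ 2) := by
          refine Finset.prod_le_prod (fun i _ => by positivity) fun i _ => ?_
          have := Finset.single_le_sum (f := fun i => x i ^ 2) (fun j _ => sq_nonneg _)
            (Finset.mem_univ i)
          linarith
      _ = _ := by simp
  have hhint : Integrable (fun x => f' x ^ k) := by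
    have h1 : Integrable (fun x : Space N => f x ^ k) := by
      refine ((integrable_one_add_norm_sq_rpow (N := N) (s := (N : ℝ) - 1)
        (by linarith)).const_mul (C ^ k)).mono'
        (hfc.rpow_const fun x => Or.inl (hf0 x).ne').aestronglyMeasurable
        (Eventually.of_forall fun x => ?_)
      rw [Real.norm_of_nonneg (Real.rpow_pos_of_pos (hf0 x) _).le]
      exact hfk x
    exact integrable_comp_toLp h1
  have hE' : Integrable (fun x => ∑ i, d i x ^ 2) := by
    simp only [hnorm]; exact integrable_comp_toLp hE
  -- The target is the p-th power of the Aubin–Talenti bubble, the expected extremal, so that the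
  -- resulting constant is the sharp one.
  set G : (Fin N → ℝ) → ℝ := fun y => (1 + ∑ i, y i ^ 2) ^ (-(N : ℝ)) with hG
  have hGq : ∀ y : Fin N → ℝ, 0 < 1 + ∑ i, y i ^ 2 := fun y => by positivity
  have hGc : Continuous G :=
    (by fun_prop : Continuous fun y : Fin N → ℝ => 1 + ∑ i, y i ^ 2).rpow_const
      fun y => Or.inl (hGq y).ne'
  have hG0 : ∀ y, 0 < G y := fun y => Real.rpow_pos_of_pos (hGq y) _
  have hbox := fun j : ℕ => knothe_sobolev_box hN (p := p) (k := k) (C := C) (R := (j : ℝ) + 1)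
    (by rw [hp, critExp]) hk (by positivity) (fun x => hf0 (WithLp.toLp 2 x)) (hfc.comp hcont) hline
    hdC hFdec hhint hE' hGc hG0
  -- pass to the limit in the box
  have hGe : ∀ y : Fin N → ℝ, G y = (1 + ‖(WithLp.toLp 2 y : Space N)‖ ^ 2) ^ (-(N : ℝ)) := fun y => by
    rw [hsq]
  have hGA : ∀ y : Fin N → ℝ, G y ^ (1 - 1 / (N : ℝ)) =
      (1 + ‖(WithLp.toLp 2 y : Space N)‖ ^ 2) ^ (-((N : ℝ) - 1)) := fun y => by
    rw [hGe, ← Real.rpow_mul (hq _).le]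
    congr 1; field_simp
  have hMi : Integrable G := by
    simp only [funext hGe]; exact integrable_comp_toLp (integrable_sobolevMass hN)
  have hM : ∫ y, G y = sobolevMass N := by
    simp only [hGe]; exact integral_comp_toLp (fun x : Space N => (1 + ‖x‖ ^ 2) ^ (-(N : ℝ)))
  have hAi : Integrable (fun y => G y ^ (1 - 1 / (N : ℝ))) := by
    simp only [hGA]
    exact integrable_comp_toLp (integrable_one_add_norm_sq_rpow (N := N) (s := (N : ℝ) - 1)
      (by linarith))
  have hA : ∫ y, G y ^ (1 - 1 / (N : ℝ)) = sobolevMass N + sobolevMoment N := by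
    simp only [hGA]
    rw [integral_comp_toLp (fun x : Space N => (1 + ‖x‖ ^ 2) ^ (-((N : ℝ) - 1))), sobolevMass,
      sobolevMoment, ← integral_add (integrable_sobolevMass hN) (integrable_sobolevMoment hN)]
    simp only [one_add_norm_sq_rpow_split]
  have hBe : ∀ y : Fin N → ℝ, G y * ∑ i, y i ^ 2 =
      (1 + ‖(WithLp.toLp 2 y : Space N)‖ ^ 2) ^ (-(N : ℝ)) * ‖(WithLp.toLp 2 y : Space N)‖ ^ 2 :=
    fun y => by rw [hGe, hsq]
  have hBi : Integrable (fun y => G y * ∑ i, y i ^ 2) := by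
    simp only [hBe]; exact integrable_comp_toLp (integrable_sobolevMoment hN)
  have hB : ∫ y, G y * ∑ i, y i ^ 2 = sobolevMoment N := by
    simp only [hBe]
    exact integral_comp_toLp (fun x : Space N => (1 + ‖x‖ ^ 2) ^ (-(N : ℝ)) * ‖x‖ ^ 2)
  have hM0 := sobolevMass_pos hN
  have hlM := tendsto_integral_boxMeasure hMi
  rw [hM] at hlM
  have hlA := tendsto_integral_boxMeasure hAi
  rw [hA] at hlA
  have hlB := tendsto_integral_boxMeasure hBi
  rw [hB] at hlB
  have hMF : ∫ x, f' x ^ p = ∫ x, f x ^ p := integral_comp_toLp (fun x => f x ^ p)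
  have hEE : ∫ x, ∑ i, d i x ^ 2 = ∫ x, ‖gradient f x‖ ^ 2 := by
    simp only [hnorm]; exact integral_comp_toLp (fun x => ‖gradient f x‖ ^ 2)
  have hMF0 : 0 < ∫ x, f x ^ p := by rw [← hMF]; exact hFdec.integral_pos
  have hlim := le_of_tendsto_of_tendsto'
    (((tendsto_const_nhds.div hlM hM0.ne').rpow_const (p := 1 - 2 / (N : ℝ))
      (Or.inl (div_pos hMF0 hM0).ne')).mul ((hlA.const_mul (N : ℝ)).pow 2))
    (hlB.const_mul (k ^ 2 * ∫ x, ‖gradient f x‖ ^ 2)) (fun j => by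
      have := hbox j
      rw [hEE] at this
      simp only [hf'] at this hMF
      rw [hMF] at this
      exact this)
  -- evaluate the constants
  have hmom := sobolevMoment_eq hN
  set M := sobolevMass N
  set B := sobolevMoment N
  set E := ∫ x, ‖gradient f x‖ ^ 2
  set P := ∫ x, f x ^ p
  have hB0 : B = N * M / (N - 2) := by rw [eq_div_iff hN2.ne']; linarith
  have e1 : N * (M + B) = 2 * (N - 1) * (N / (N - 2)) * M := by rw [hB0]; field_simp; ring
  rw [e1, hB0, hk, Real.div_rpow hMF0.le hM0.le] at hlim
  have e2 : M ^ (1 - 2 / (N : ℝ)) = M / M ^ (2 / (N : ℝ)) := by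
    rw [Real.rpow_sub hM0, Real.rpow_one]
  rw [e2] at hlim
  have hMp : 0 < M ^ (2 / (N : ℝ)) := Real.rpow_pos_of_pos hM0 _
  have hN1 : (0 : ℝ) < N - 1 := by linarith
  have e3 : P ^ (1 - 2 / (N : ℝ)) / (M / M ^ (2 / (N : ℝ))) *
      (2 * (N - 1) * (N / (N - 2)) * M) ^ 2 =
      (N * (N - 2) * M ^ (2 / (N : ℝ)) * P ^ (1 - 2 / (N : ℝ))) *
        ((2 * (N - 1) / (N - 2)) ^ 2 * (N * M / (N - 2))) := by
    field_simp
  have e4 : (2 * ((N : ℝ) - 1) / (N - 2)) ^ 2 * E * (N * M / (N - 2)) =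
      E * ((2 * (N - 1) / (N - 2)) ^ 2 * (N * M / (N - 2))) := by ring
  rw [e3, e4] at hlim
  exact le_of_mul_le_mul_right hlim (by positivity)

end

/-! ### From decaying functions to compactly supported functions -/

theorem norm_gradient_eq {N : ℕ} (f : Space N → ℝ) (x : Space N) :
    ‖gradient f x‖ = ‖fderiv ℝ f x‖ := by
  rw [gradient, LinearIsometryEquiv.norm_map]

theorem continuous_gradient {N : ℕ} {f : Space N → ℝ} (hf : ContDiff ℝ 1 f) :
    Continuous (gradient f) :=
  (InnerProductSpace.toDual ℝ (Space N)).symm.continuous.comp (hf.continuous_fderiv (by simp))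

theorem exists_abs_le_mul_of_hasCompactSupport {X : Type*} [TopologicalSpace X] {g b : X → ℝ}
    (hg : Continuous g)
    (hgc : HasCompactSupport g) (hb : Continuous b) (hb0 : ∀ x, 0 < b x) :
    ∃ C, 0 ≤ C ∧ ∀ x, |g x| ≤ C * b x := by
  obtain ⟨C, hC⟩ := (hg.div₀ hb fun x => (hb0 x).ne').bounded_above_of_compact_support
    (hgc.mono fun x hx => by
      simp only [Function.mem_support] at hx ⊢
      exact fun h => hx (by rw [h, zero_div]))
  refine ⟨max C 0, le_max_right _ _, fun x => ?_⟩
  have h := (hC x).trans (le_max_left C 0)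
  rw [Real.norm_eq_abs, abs_div, abs_of_pos (hb0 x), div_le_iff₀ (hb0 x)] at h
  exact h

/-- The unnormalized Aubin–Talenti bubble. -/
def talenti (N : ℕ) (x : Space N) : ℝ := (1 + ‖x‖ ^ 2) ^ (-(((N : ℝ) - 2) / 2))

theorem talenti_pos {N : ℕ} (x : Space N) : 0 < talenti N x := by
  rw [talenti]; positivity

theorem contDiff_talenti (N : ℕ) : ContDiff ℝ ∞ (talenti N) := by
  refine ContDiff.rpow_const_of_ne ?_ fun x => ?_
  · exact contDiff_const.add (contDiff_norm_sq ℝ)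
  · positivity

theorem norm_fderiv_talenti_sq {N : ℕ} (x : Space N) :
    ‖fderiv ℝ (talenti N) x‖ ^ 2 =
      ((N : ℝ) - 2) ^ 2 * ((1 + ‖x‖ ^ 2) ^ (-(N : ℝ)) * ‖x‖ ^ 2) := by
  have hq : 0 < 1 + ‖x‖ ^ 2 := by positivity
  have h1 : HasFDerivAt (fun x : Space N => 1 + ‖x‖ ^ 2) (2 • innerSL ℝ x) x :=
    (hasStrictFDerivAt_norm_sq x).hasFDerivAt.const_add 1
  have h2 := h1.rpow_const (p := -(((N : ℝ) - 2) / 2)) (Or.inl hq.ne')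
  have h3 : fderiv ℝ (talenti N) x = _ := h2.fderiv
  rw [h3, norm_smul, two_smul, ← two_smul ℝ, norm_smul, innerSL_apply_norm, mul_pow, mul_pow,
    Real.norm_eq_abs, sq_abs, mul_pow, ← Real.rpow_natCast (_ ^ (_ : ℝ)), ← Real.rpow_mul hq.le]
  rw [show (-(((N : ℝ) - 2) / 2) - 1) * ((2 : ℕ) : ℝ) = -N by push_cast; ring]
  norm_num
  ring

theorem norm_fderiv_talenti_le {N : ℕ} (hN : 3 ≤ N) (x : Space N) :
    ‖fderiv ℝ (talenti N) x‖ ≤ ((N : ℝ) - 2) * talenti N x := by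
  have h3 : (3 : ℝ) ≤ N := by exact_mod_cast hN
  have hq : 0 < 1 + ‖x‖ ^ 2 := by positivity
  refine le_of_sq_le_sq ?_ (mul_nonneg (by linarith) (talenti_pos x).le)
  rw [norm_fderiv_talenti_sq, mul_pow, talenti, ← Real.rpow_natCast (_ ^ (_ : ℝ)),
    ← Real.rpow_mul hq.le, show -(((N : ℝ) - 2) / 2) * ((2 : ℕ) : ℝ) = -N + 1 + 1 by push_cast; ring,
    Real.rpow_add hq, Real.rpow_add hq, Real.rpow_one]
  have : 0 < (1 + ‖x‖ ^ 2) ^ (-(N : ℝ)) := by positivity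
  rw [mul_assoc]
  gcongr
  nlinarith [sq_nonneg ‖x‖]

/-- The sharp Sobolev inequality for test functions. -/
theorem sobolev_sharp {N : ℕ} (hN : 3 ≤ N) {ψ : Space N → ℝ} (hψ : ContDiff ℝ 1 ψ)
    (hψc : HasCompactSupport ψ) :
    N * ((N : ℝ) - 2) * sobolevMass N ^ (2 / (N : ℝ)) *
      (∫ x, |ψ x| ^ critExp N) ^ (1 - 2 / (N : ℝ)) ≤ ∫ x, ‖gradient ψ x‖ ^ 2 := by
  have h3 : (3 : ℝ) ≤ N := by exact_mod_cast hN
  have hN0 : (0 : ℝ) < N := by linarith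
  have hN2 : (0 : ℝ) < N - 2 := by linarith
  have hb0 := talenti_pos (N := N)
  have hb1 : ContDiff ℝ 1 (talenti N) := (contDiff_talenti N).of_le (by simp)
  have hp0 : 0 ≤ critExp N := by linarith [one_le_critExp hN]
  obtain ⟨C₁, hC₁, hC₁'⟩ := exists_abs_le_mul_of_hasCompactSupport hψ.continuous hψc hb1.continuous hb0
  obtain ⟨C₂, hC₂, hC₂'⟩ := exists_abs_le_mul_of_hasCompactSupport
    (g := fun x => ‖fderiv ℝ ψ x‖) (hψ.continuous_fderiv (by simp)).norm
    ((hψc.fderiv (𝕜 := ℝ)).norm) hb1.continuous hb0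
  have hgψ : Integrable (fun x => ‖gradient ψ x‖ ^ 2) := by
    refine ((continuous_gradient hψ).norm.pow 2).integrable_of_hasCompactSupport ?_
    refine (hψc.fderiv (𝕜 := ℝ)).mono fun x hx => ?_
    rw [Function.mem_support] at hx ⊢
    intro h
    refine hx ?_
    rw [Pi.pow_apply, norm_gradient_eq, h]
    simp
  have hgb : Integrable (fun x => ‖gradient (talenti N) x‖ ^ 2) := by
    simp only [norm_gradient_eq, norm_fderiv_talenti_sq]
    exact (integrable_sobolevMoment hN).const_mul _
  set S := N * ((N : ℝ) - 2) * sobolevMass N ^ (2 / (N : ℝ)) with hS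
  have hS0 : 0 ≤ S := by have := sobolevMass_pos hN; positivity
  -- `sobolev_of_decaying` is applied to f = √(ψ² + ε²U²), with U = `talenti N`. It is positive,
  -- comparable to U, and has bounded logarithmic gradient, while its energy exceeds that of ψ by at
  -- most ε² times the energy of U.
  have hmain : ∀ ε : ℝ, 0 < ε → S * (∫ x, |ψ x| ^ critExp N) ^ (1 - 2 / (N : ℝ)) ≤
      (∫ x, ‖gradient ψ x‖ ^ 2) + ε ^ 2 * ∫ x, ‖gradient (talenti N) x‖ ^ 2 := by
    intro ε hε
    set u : Space N → ℝ := fun x => ψ x ^ 2 + ε ^ 2 * talenti N x ^ 2 with hu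
    have hu0 : ∀ x, 0 < u x := fun x => by have := hb0 x; positivity
    set f : Space N → ℝ := fun x => √(u x) with hf
    have hf0 : ∀ x, 0 < f x := fun x => Real.sqrt_pos.mpr (hu0 x)
    have hf2 : ∀ x, f x ^ 2 = u x := fun x => Real.sq_sqrt (hu0 x).le
    have hu1 : ContDiff ℝ 1 u := (hψ.pow 2).add (contDiff_const.mul (hb1.pow 2))
    have hf1 : ContDiff ℝ 1 f := hu1.sqrt fun x => (hu0 x).ne'
    have hψf : ∀ x, |ψ x| ≤ f x := fun x => by
      refine Real.abs_le_sqrt ?_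
      have := hb0 x
      simp only [hu]
      have : 0 ≤ ε ^ 2 * talenti N x ^ 2 := by positivity
      linarith
    have hbf : ∀ x, ε * talenti N x ≤ f x := fun x => by
      refine Real.le_sqrt_of_sq_le ?_
      simp only [hu]
      rw [mul_pow]
      linarith [sq_nonneg (ψ x)]
    have hfd : ∀ x, f x • fderiv ℝ f x =
        ψ x • fderiv ℝ ψ x + (ε * talenti N x) • (ε • fderiv ℝ (talenti N) x) := by
      intro x
      have d1 := ((hψ.differentiable (by simp)) x).hasFDerivAt.pow 2
      have d2 := (((hb1.differentiable (by simp)) x).hasFDerivAt.pow 2).const_mul (ε ^ 2)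
      have d3 : HasFDerivAt f _ x := (d1.add d2).sqrt (hu0 x).ne'
      rw [d3.fderiv]
      change f x • ((1 / (2 * f x)) • _) = _
      rw [smul_smul, show f x * (1 / (2 * f x)) = 1 / 2 by have := (hf0 x).ne'; field_simp]
      ext v
      simp
      ring
    -- Cauchy–Schwarz in f∇f = ψ∇ψ + (εU)(ε∇U), followed by division by f².
    have hgf : ∀ x, ‖gradient f x‖ ^ 2 ≤ ‖gradient ψ x‖ ^ 2 + ε ^ 2 * ‖gradient (talenti N) x‖ ^ 2 := by
      intro x
      simp only [norm_gradient_eq]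
      have h1 : ‖f x • fderiv ℝ f x‖ ≤
          |ψ x| * ‖fderiv ℝ ψ x‖ + (ε * talenti N x) * (ε * ‖fderiv ℝ (talenti N) x‖) := by
        rw [hfd]
        refine (norm_add_le _ _).trans_eq ?_
        rw [norm_smul, norm_smul, norm_smul, Real.norm_eq_abs, Real.norm_of_nonneg hε.le,
          Real.norm_of_nonneg (mul_pos hε (hb0 x)).le]
      rw [norm_smul, Real.norm_of_nonneg (hf0 x).le] at h1
      have h2 : (f x * ‖fderiv ℝ f x‖) ^ 2 ≤
          (|ψ x| * ‖fderiv ℝ ψ x‖ + (ε * talenti N x) * (ε * ‖fderiv ℝ (talenti N) x‖)) ^ 2 :=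
        pow_le_pow_left₀ (mul_nonneg (hf0 x).le (norm_nonneg _)) h1 2
      have h4 : (|ψ x| * ‖fderiv ℝ ψ x‖ + (ε * talenti N x) * (ε * ‖fderiv ℝ (talenti N) x‖)) ^ 2 ≤
          u x * (‖fderiv ℝ ψ x‖ ^ 2 + ε ^ 2 * ‖fderiv ℝ (talenti N) x‖ ^ 2) := by
        simp only [hu]
        rw [← sq_abs (ψ x)]
        nlinarith [sq_nonneg (|ψ x| * (ε * ‖fderiv ℝ (talenti N) x‖) -
          (ε * talenti N x) * ‖fderiv ℝ ψ x‖)]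
      rw [mul_pow, hf2] at h2
      exact le_of_mul_le_mul_left (h2.trans h4) (hu0 x)
    have hgi : Integrable (fun x => ‖gradient ψ x‖ ^ 2 + ε ^ 2 * ‖gradient (talenti N) x‖ ^ 2) :=
      hgψ.add (hgb.const_mul _)
    have hfi : Integrable (fun x => ‖gradient f x‖ ^ 2) := by
      refine hgi.mono' ((continuous_gradient hf1).norm.pow 2).aestronglyMeasurable
        (Eventually.of_forall fun x => ?_)
      rw [Real.norm_of_nonneg (sq_nonneg _)]
      exact hgf x
    -- The first entry bounds f by |ψ| + εU. The second bounds |∇ψ| + ε|∇U|, using εU ≤ f.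
    set C := max (C₁ + ε) (C₂ / ε + ((N : ℝ) - 2)) with hC
    have hfC : ∀ x, f x ≤ C * talenti N x := by
      intro x
      have h1 : f x ≤ |ψ x| + ε * talenti N x := by
        rw [hf]
        refine Real.sqrt_le_iff.mpr ⟨by have := hb0 x; positivity, ?_⟩
        simp only [hu]
        have : 0 ≤ 2 * |ψ x| * (ε * talenti N x) := by have := hb0 x; positivity
        nlinarith [sq_abs (ψ x)]
      calc f x ≤ C₁ * talenti N x + ε * talenti N x := h1.trans (by linarith [hC₁' x])
        _ = (C₁ + ε) * talenti N x := by ring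
        _ ≤ C * talenti N x := mul_le_mul_of_nonneg_right (le_max_left _ _) (hb0 x).le
    have hgC : ∀ x, ‖gradient f x‖ ≤ C * f x := by
      intro x
      have h1 : ‖gradient f x‖ ≤ ‖gradient ψ x‖ + ε * ‖gradient (talenti N) x‖ := by
        refine le_of_sq_le_sq ((hgf x).trans ?_) (by positivity)
        have : 0 ≤ 2 * ‖gradient ψ x‖ * (ε * ‖gradient (talenti N) x‖) := by positivity
        nlinarith
      have h2 : ‖gradient ψ x‖ ≤ C₂ / ε * f x := by
        rw [norm_gradient_eq]
        have := hC₂' x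
        rw [abs_of_nonneg (norm_nonneg _)] at this
        calc _ ≤ C₂ * talenti N x := this
          _ = C₂ / ε * (ε * talenti N x) := by field_simp
          _ ≤ _ := by gcongr; exact hbf x
      have h4 : ε * ‖gradient (talenti N) x‖ ≤ ((N : ℝ) - 2) * f x := by
        rw [norm_gradient_eq]
        calc _ ≤ ε * (((N : ℝ) - 2) * talenti N x) := by gcongr; exact norm_fderiv_talenti_le hN x
          _ = ((N : ℝ) - 2) * (ε * talenti N x) := by ring
          _ ≤ _ := by gcongr; exact hbf x
      calc _ ≤ (C₂ / ε + ((N : ℝ) - 2)) * f x := by linarith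
        _ ≤ C * f x := mul_le_mul_of_nonneg_right (le_max_right _ _) (hf0 x).le
    have hsob := sobolev_of_decaying hN hf0 hf1 hfC hgC hfi
    have hψi : Integrable (fun x => |ψ x| ^ critExp N) := by
      refine (hψ.continuous.abs.rpow_const fun x => Or.inr hp0).integrable_of_hasCompactSupport ?_
      refine hψc.mono fun x hx => ?_
      rw [Function.mem_support] at hx ⊢
      intro h
      refine hx ?_
      rw [h, abs_zero, Real.zero_rpow (by linarith [one_le_critExp hN])]
    have hle : ∫ x, |ψ x| ^ critExp N ≤ ∫ x, f x ^ critExp N := by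
      refine integral_mono_of_nonneg (Eventually.of_forall fun x => by positivity) ?_
        (Eventually.of_forall fun x => Real.rpow_le_rpow (abs_nonneg _) (hψf x) hp0)
      refine Integrable.mono' (g := fun x => C ^ critExp N * (1 + ‖x‖ ^ 2) ^ (-(N : ℝ)))
        ((integrable_sobolevMass hN).const_mul _)
        (hf1.continuous.rpow_const fun x => Or.inl (hf0 x).ne').aestronglyMeasurable
        (Eventually.of_forall fun x => ?_)
      have hC0 : 0 ≤ C := le_max_of_le_left (by positivity)
      have hq : 0 < 1 + ‖x‖ ^ 2 := by positivity
      rw [Real.norm_of_nonneg (Real.rpow_nonneg (hf0 x).le _)]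
      refine (Real.rpow_le_rpow (hf0 x).le (hfC x) hp0).trans_eq ?_
      rw [Real.mul_rpow hC0 (hb0 x).le, talenti, ← Real.rpow_mul hq.le]
      congr 2
      rw [critExp]; field_simp
    have he : 0 ≤ 1 - 2 / (N : ℝ) := by
      rw [sub_nonneg, div_le_one hN0]; linarith
    calc S * (∫ x, |ψ x| ^ critExp N) ^ (1 - 2 / (N : ℝ))
        ≤ S * (∫ x, f x ^ critExp N) ^ (1 - 2 / (N : ℝ)) := by
          gcongr
      _ ≤ ∫ x, ‖gradient f x‖ ^ 2 := hsob
      _ ≤ ∫ x, ‖gradient ψ x‖ ^ 2 + ε ^ 2 * ‖gradient (talenti N) x‖ ^ 2 :=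
          integral_mono hfi hgi hgf
      _ = _ := by rw [integral_add hgψ (hgb.const_mul _), integral_const_mul]
  have hlim : Tendsto (fun ε : ℝ => (∫ x, ‖gradient ψ x‖ ^ 2) +
      ε ^ 2 * ∫ x, ‖gradient (talenti N) x‖ ^ 2) (𝓝[>] 0) (𝓝 (∫ x, ‖gradient ψ x‖ ^ 2)) := by
    have : Continuous (fun ε : ℝ => (∫ x, ‖gradient ψ x‖ ^ 2) +
      ε ^ 2 * ∫ x, ‖gradient (talenti N) x‖ ^ 2) := by fun_prop
    have h := this.tendsto 0
    simp only [ne_eq, OfNat.ofNat_ne_zero, not_false_eq_true, zero_pow, zero_mul, add_zero] at h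
    exact h.mono_left nhdsWithin_le_nhds
  exact ge_of_tendsto hlim (eventually_nhdsWithin_of_forall fun ε hε => hmain ε hε)

/-! ### Polar coordinates and functions supported in annuli -/

theorem volumeIoiPow_integral (n : ℕ) (g : ℝ → ℝ) :
    ∫ r : Ioi (0 : ℝ), g r ∂(Measure.volumeIoiPow n) = ∫ r in Ioi (0 : ℝ), r ^ n * g r := by
  rw [Measure.volumeIoiPow, integral_withDensity_eq_integral_toReal_smul
    ((measurable_subtype_coe.pow_const n).ennreal_ofReal)
    (Eventually.of_forall fun _ => ENNReal.ofReal_lt_top)]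
  rw [← integral_subtype_comap measurableSet_Ioi fun r : ℝ => r ^ n * g r]
  refine integral_congr_ae (Eventually.of_forall fun r => ?_)
  have hr : (0 : ℝ) < r := r.2
  simp only [smul_eq_mul]
  rw [ENNReal.toReal_ofReal (by positivity)]

/-- The angular variable is retained: the Hardy–Sobolev inequality must hold for nonradial
functions, and each ray is then treated separately. -/
theorem integral_polar {N : ℕ} (hN : 3 ≤ N) {g : Space N → ℝ} (hg : Integrable g) :
    ∫ x, g x = ∫ θ : Metric.sphere (0 : Space N) 1,
      (∫ r in Ioi (0 : ℝ), r ^ (N - 1) * g (r • (θ : Space N))) ∂(volume : Measure (Space N)).toSphere := by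
  have := nontrivial_space hN
  have hmp := (volume : Measure (Space N)).measurePreserving_homeomorphUnitSphereProd
  have hemb := (homeomorphUnitSphereProd (Space N)).measurableEmbedding
  set G : Metric.sphere (0 : Space N) 1 × Ioi (0 : ℝ) → ℝ := fun q => g ((q.2 : ℝ) • (q.1 : Space N))
    with hG
  have hcomp : ∀ x : ({0}ᶜ : Set (Space N)), G (homeomorphUnitSphereProd (Space N) x) = g x := by
    intro x
    have hx : (x : Space N) ≠ 0 := x.2
    simp [hG, homeomorphUnitSphereProd, smul_smul, norm_ne_zero_iff.mpr hx]
  have hgi : Integrable (fun x : ({0}ᶜ : Set (Space N)) => g x)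
      ((volume : Measure (Space N)).comap (↑)) := by
    have h := (integrableOn_iff_comap_subtypeVal (μ := (volume : Measure (Space N))) (f := g)
      (s := {0}ᶜ) (measurableSet_singleton _).compl).mp hg.integrableOn
    exact h
  have hGi : Integrable G ((volume : Measure (Space N)).toSphere.prod
      (Measure.volumeIoiPow (Module.finrank ℝ (Space N) - 1))) := by
    rw [← hmp.integrable_comp_emb hemb]
    exact hgi.congr (Eventually.of_forall fun x => (hcomp x).symm)
  calc ∫ x, g x = ∫ x : ({0}ᶜ : Set (Space N)), g x ∂((volume : Measure (Space N)).comap (↑)) := by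
        rw [integral_subtype_comap (measurableSet_singleton _).compl g, restrict_compl_singleton]
    _ = ∫ x : ({0}ᶜ : Set (Space N)), G (homeomorphUnitSphereProd (Space N) x)
          ∂((volume : Measure (Space N)).comap (↑)) := by simp only [hcomp]
    _ = ∫ q, G q ∂((volume : Measure (Space N)).toSphere.prod
          (Measure.volumeIoiPow (Module.finrank ℝ (Space N) - 1))) := hmp.integral_comp hemb G
    _ = ∫ θ, (∫ r : Ioi (0 : ℝ), G (θ, r) ∂(Measure.volumeIoiPow
          (Module.finrank ℝ (Space N) - 1))) ∂(volume : Measure (Space N)).toSphere := integral_prod _ hGi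
    _ = _ := by
        refine integral_congr_ae (Eventually.of_forall fun θ => ?_)
        simp only [hG, finrank_euclideanSpace_fin]
        exact volumeIoiPow_integral (N - 1) fun r => g (r • (θ : Space N))

/-! ### Smooth functions supported in annuli -/

variable {N : ℕ}

/-- Smooth functions supported in an annulus centered at the origin. -/
structure IsAnnular (w : Space N → ℝ) : Prop where
  contDiff : ContDiff ℝ ∞ w
  supp : ∃ a b : ℝ, 0 < a ∧ ∀ x, w x ≠ 0 → a ≤ ‖x‖ ∧ ‖x‖ ≤ b

theorem isClosed_annulus (a b : ℝ) : IsClosed {x : Space N | a ≤ ‖x‖ ∧ ‖x‖ ≤ b} :=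
  (isClosed_le continuous_const continuous_norm).inter (isClosed_le continuous_norm continuous_const)

theorem isCompact_annulus (a b : ℝ) : IsCompact {x : Space N | a ≤ ‖x‖ ∧ ‖x‖ ≤ b} := by
  refine (isCompact_closedBall (0 : Space N) b).of_isClosed_subset (isClosed_annulus a b) ?_
  intro x hx
  simpa using hx.2

theorem hasCompactSupport_of_annulus {E : Type*} [Zero E] {g : Space N → E} {a b : ℝ}
    (hs : ∀ x, g x ≠ 0 → a ≤ ‖x‖ ∧ ‖x‖ ≤ b) : HasCompactSupport g :=
  HasCompactSupport.intro (isCompact_annulus a b) fun x hx => by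
    by_contra h
    exact hx (hs x h)

theorem eventually_zero_of_annulus {g : Space N → ℝ} {a b : ℝ} (ha : 0 < a)
    (hs : ∀ x, g x ≠ 0 → a ≤ ‖x‖ ∧ ‖x‖ ≤ b) : g =ᶠ[𝓝 0] fun _ => 0 := by
  filter_upwards [Metric.ball_mem_nhds (0 : Space N) ha] with x hx
  by_contra h
  have := (hs x h).1
  rw [mem_ball_zero_iff] at hx
  linarith

theorem continuous_of_annulus {g : Space N → ℝ} {a b : ℝ} (ha : 0 < a)
    (hs : ∀ x, g x ≠ 0 → a ≤ ‖x‖ ∧ ‖x‖ ≤ b) (hc : ∀ x, x ≠ 0 → ContinuousAt g x) : Continuous g := by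
  rw [continuous_iff_continuousAt]
  intro x
  by_cases hx : x = 0
  · subst hx
    exact continuousAt_const.congr (eventually_zero_of_annulus ha hs).symm
  · exact hc x hx

theorem integrable_of_annulus {g : Space N → ℝ} {a b : ℝ} (ha : 0 < a)
    (hs : ∀ x, g x ≠ 0 → a ≤ ‖x‖ ∧ ‖x‖ ≤ b) (hc : ∀ x, x ≠ 0 → ContinuousAt g x) : Integrable g :=
  (continuous_of_annulus ha hs hc).integrable_of_hasCompactSupport (hasCompactSupport_of_annulus hs)

theorem contDiffAt_norm_rpow {x : Space N} (hx : x ≠ 0) (s : ℝ) :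
    ContDiffAt ℝ ∞ (fun y : Space N => ‖y‖ ^ s) x :=
  (contDiffAt_norm ℝ hx).rpow_const_of_ne (norm_ne_zero_iff.mpr hx)

theorem continuousAt_norm_rpow {x : Space N} (hx : x ≠ 0) (s : ℝ) :
    ContinuousAt (fun y : Space N => ‖y‖ ^ s) x :=
  (contDiffAt_norm_rpow hx s).continuousAt

theorem hasFDerivAt_norm_rpow {x : Space N} (hx : x ≠ 0) (s : ℝ) :
    HasFDerivAt (fun y : Space N => ‖y‖ ^ s) ((s * ‖x‖ ^ (s - 2)) • innerSL ℝ x) x := by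
  have hx' : 0 < ‖x‖ := norm_pos_iff.mpr hx
  have h1 : HasFDerivAt (fun x : Space N => ‖x‖ ^ 2) (2 • innerSL ℝ x) x :=
    (hasStrictFDerivAt_norm_sq x).hasFDerivAt
  have h2 := h1.rpow_const (p := s / 2) (Or.inl (by positivity))
  have e : (fun y : Space N => ‖y‖ ^ s) = fun y => (‖y‖ ^ 2) ^ (s / 2) := by
    funext y
    rw [← Real.rpow_natCast, ← Real.rpow_mul (norm_nonneg _)]
    congr 1; push_cast; ring
  rw [e]
  refine h2.congr_fderiv ?_
  rw [two_smul, ← two_smul ℝ, smul_smul, ← Real.rpow_natCast, ← Real.rpow_mul hx'.le]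
  congr 1
  rw [show ((2 : ℕ) : ℝ) * (s / 2 - 1) = s - 2 by push_cast; ring]
  ring

namespace IsAnnular

variable {w : Space N → ℝ}

theorem of_contDiffAt {a b : ℝ} (ha : 0 < a) (hs : ∀ x, w x ≠ 0 → a ≤ ‖x‖ ∧ ‖x‖ ≤ b)
    (hc : ∀ x, x ≠ 0 → ContDiffAt ℝ ∞ w x) : IsAnnular w where
  contDiff := by
    rw [contDiff_iff_contDiffAt]
    intro x
    by_cases hx : x = 0
    · subst hx
      exact contDiffAt_const.congr_of_eventuallyEq (eventually_zero_of_annulus ha hs)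
    · exact hc x hx
  supp := ⟨a, b, ha, hs⟩

theorem hasCompactSupport (hw : IsAnnular w) : HasCompactSupport w := by
  obtain ⟨a, b, -, hs⟩ := hw.supp
  exact hasCompactSupport_of_annulus hs

theorem differentiable (hw : IsAnnular w) : Differentiable ℝ w := hw.contDiff.differentiable (by simp)

theorem contDiff_one (hw : IsAnnular w) : ContDiff ℝ 1 w := hw.contDiff.of_le (by simp)

theorem continuous (hw : IsAnnular w) : Continuous w := hw.contDiff.continuous

theorem supp_fderiv {a b : ℝ} (hs : ∀ x, w x ≠ 0 → a ≤ ‖x‖ ∧ ‖x‖ ≤ b) (x : Space N)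
    (hx : fderiv ℝ w x ≠ 0) : a ≤ ‖x‖ ∧ ‖x‖ ≤ b := by
  have h1 : x ∈ tsupport w := support_fderiv_subset ℝ hx
  exact closure_minimal (fun y hy => hs y hy) (isClosed_annulus a b) h1

theorem apply_zero (hw : IsAnnular w) : w 0 = 0 := by
  obtain ⟨a, b, ha, hs⟩ := hw.supp
  exact (eventually_zero_of_annulus ha hs).self_of_nhds

theorem norm_rpow_mul (hw : IsAnnular w) (s : ℝ) : IsAnnular (fun x => ‖x‖ ^ s * w x) := by
  obtain ⟨a, b, ha, hs⟩ := hw.supp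
  exact of_contDiffAt ha (fun x hx => hs x (right_ne_zero_of_mul hx))
    fun x hx => (contDiffAt_norm_rpow hx s).mul hw.contDiff.contDiffAt

theorem norm_rpow_sub_one_smul {N : ℕ} {τ : ℝ} (x : Space N) (hx : x ≠ 0) :
    ‖‖x‖ ^ (τ - 1) • x‖ = ‖x‖ ^ τ := by
  have hx' : 0 < ‖x‖ := norm_pos_iff.mpr hx
  rw [norm_smul, Real.norm_of_nonneg (by positivity), ← Real.rpow_add_one hx'.ne']
  congr 1; ring

theorem comp_radial (hw : IsAnnular w) {τ : ℝ} (hτ : 0 < τ) :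
    IsAnnular (fun y => w (‖y‖ ^ (τ - 1) • y)) := by
  obtain ⟨a, b, ha, hs⟩ := hw.supp
  have hcd : ∀ x : Space N, x ≠ 0 → ContDiffAt ℝ ∞ (fun y => w (‖y‖ ^ (τ - 1) • y)) x := by
    intro x hx
    exact hw.contDiff.contDiffAt.comp x ((contDiffAt_norm_rpow hx (τ - 1)).smul contDiffAt_id)
  refine of_contDiffAt (a := a ^ (1 / τ)) (b := b ^ (1 / τ)) (by positivity) (fun x hx => ?_) hcd
  have hx0 : x ≠ 0 := by
    rintro rfl
    simp [hw.apply_zero] at hx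
  have hx' : 0 < ‖x‖ := norm_pos_iff.mpr hx0
  have h := hs _ hx
  rw [norm_rpow_sub_one_smul x hx0] at h
  have e : ‖x‖ = (‖x‖ ^ τ) ^ (1 / τ) := by
    rw [← Real.rpow_mul hx'.le, mul_one_div_cancel hτ.ne', Real.rpow_one]
  constructor
  · rw [e]; exact Real.rpow_le_rpow ha.le h.1 (by positivity)
  · conv_lhs => rw [e]
    exact Real.rpow_le_rpow (by positivity) h.2 (by positivity)

theorem integrable_weight {g : Space N → ℝ} {a b s : ℝ} (ha : 0 < a)
    (hs : ∀ x, g x ≠ 0 → a ≤ ‖x‖ ∧ ‖x‖ ≤ b) (hg : Continuous g) :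
    Integrable (fun x => g x * ‖x‖ ^ s) :=
  integrable_of_annulus ha (fun x hx => hs x (left_ne_zero_of_mul hx))
    fun _ hx => hg.continuousAt.mul (continuousAt_norm_rpow hx s)

end IsAnnular

theorem integrable_comp_radial {h : Space N → ℝ} {a b τ : ℝ} (ha : 0 < a)
    (hs : ∀ x, h x ≠ 0 → a ≤ ‖x‖ ∧ ‖x‖ ≤ b) (hc : Continuous h) (hτ : 0 < τ) :
    Integrable (fun y : Space N => h (‖y‖ ^ (τ - 1) • y) * ‖y‖ ^ (-(N : ℝ))) := by
  have h0 : h 0 = 0 := (eventually_zero_of_annulus ha hs).self_of_nhds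
  refine integrable_of_annulus (a := a ^ (1 / τ)) (b := b ^ (1 / τ)) (by positivity) (fun x hx => ?_)
    fun x hx => ?_
  · have hx := left_ne_zero_of_mul hx
    have hx0 : x ≠ 0 := by
      rintro rfl
      simp [h0] at hx
    have hx' : 0 < ‖x‖ := norm_pos_iff.mpr hx0
    have h := hs _ hx
    rw [IsAnnular.norm_rpow_sub_one_smul x hx0] at h
    have e : ‖x‖ = (‖x‖ ^ τ) ^ (1 / τ) := by
      rw [← Real.rpow_mul hx'.le, mul_one_div_cancel hτ.ne', Real.rpow_one]
    constructor
    · rw [e]; exact Real.rpow_le_rpow ha.le h.1 (by positivity)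
    · conv_lhs => rw [e]
      exact Real.rpow_le_rpow (by positivity) h.2 (by positivity)
  · exact (hc.continuousAt.comp ((continuousAt_norm_rpow hx (τ - 1)).smul continuousAt_id)).mul
      (continuousAt_norm_rpow hx _)

/-- Radial change of variables `x = |y|^{τ-1} y` for the scale-invariant measure `|x|^{-N} dx`. -/
theorem integral_comp_radial (hN : 3 ≤ N) {h : Space N → ℝ} {a b τ : ℝ} (ha : 0 < a)
    (hs : ∀ x, h x ≠ 0 → a ≤ ‖x‖ ∧ ‖x‖ ≤ b) (hc : Continuous h) (hτ : 0 < τ) :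
    ∫ y, h (‖y‖ ^ (τ - 1) • y) * ‖y‖ ^ (-(N : ℝ)) = τ⁻¹ * ∫ x, h x * ‖x‖ ^ (-(N : ℝ)) := by
  have hi1 : Integrable (fun y : Space N => h (‖y‖ ^ (τ - 1) • y) * ‖y‖ ^ (-(N : ℝ))) :=
    integrable_comp_radial ha hs hc hτ
  have hi2 : Integrable (fun x : Space N => h x * ‖x‖ ^ (-(N : ℝ))) :=
    IsAnnular.integrable_weight ha hs hc
  rw [integral_polar hN hi1, integral_polar hN hi2, ← integral_const_mul]
  refine integral_congr_ae (Eventually.of_forall fun θ => ?_)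
  have hθ : ‖(θ : Space N)‖ = 1 := norm_eq_of_mem_sphere θ
  have hpow : ∀ r ∈ Ioi (0 : ℝ), r ^ (N - 1) * r ^ (-(N : ℝ)) = r⁻¹ := by
    intro r hr
    have hr' : (0 : ℝ) < r := hr
    rw [← Real.rpow_natCast, ← Real.rpow_add hr', Nat.cast_sub (by omega), ← Real.rpow_neg_one]
    congr 1; push_cast; ring
  -- On each ray the measure |x|^{-N}dx becomes dr/r, and the change of variables is s = r^τ.
  have hsub := integral_comp_rpow_Ioi_of_pos (g := fun s : ℝ => h (s • (θ : Space N)) * s⁻¹) hτ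
  simp only
  have e2 : ∫ r in Ioi (0 : ℝ), r ^ (N - 1) * (h (r • (θ : Space N)) * ‖r • (θ : Space N)‖ ^ (-(N : ℝ)))
      = ∫ s in Ioi (0 : ℝ), h (s • (θ : Space N)) * s⁻¹ := by
    refine setIntegral_congr_fun measurableSet_Ioi fun r hr => ?_
    have hr' : (0 : ℝ) < r := hr
    simp only [norm_smul, hθ, mul_one, Real.norm_of_nonneg hr'.le]
    rw [mul_left_comm, hpow r hr]
  rw [e2, ← hsub, ← integral_const_mul]
  refine setIntegral_congr_fun measurableSet_Ioi fun r hr => ?_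
  have hr' : (0 : ℝ) < r := hr
  simp only [norm_smul, hθ, mul_one, Real.norm_of_nonneg hr'.le, smul_smul, smul_eq_mul]
  rw [mul_left_comm, hpow r hr]
  have e3 : r ^ (τ - 1) * r = r ^ τ := by
    rw [← Real.rpow_add_one hr'.ne']; congr 1; ring
  have e4 : r ^ (τ - 1) = r ^ τ * r⁻¹ := by rw [← e3]; field_simp
  rw [e3, e4]
  have : r ^ τ ≠ 0 := (Real.rpow_pos_of_pos hr' _).ne'
  field_simp

/-- Integration of a radial derivative along rays. -/
theorem integral_mul_fderiv_radial (hN : 3 ≤ N) {w : Space N → ℝ} (hw : IsAnnular w) :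
    ∫ x, (w x * fderiv ℝ w x x) * ‖x‖ ^ (-(N : ℝ)) = 0 := by
  obtain ⟨a, b, ha, hs⟩ := hw.supp
  have hfc : Continuous (fun x => fderiv ℝ w x x) :=
    (hw.contDiff.continuous_fderiv (by simp)).clm_apply continuous_id
  have hi : Integrable (fun x : Space N => (w x * fderiv ℝ w x x) * ‖x‖ ^ (-(N : ℝ))) :=
    IsAnnular.integrable_weight ha (fun x hx => hs x (left_ne_zero_of_mul hx))
      (hw.continuous.mul hfc)
  rw [integral_polar hN hi]
  refine integral_eq_zero_of_ae (Eventually.of_forall fun θ => ?_)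
  have hθ : ‖(θ : Space N)‖ = 1 := norm_eq_of_mem_sphere θ
  -- On a ray x·∇w = r∂_r w, and the weights leave no power of r, so the integrand is the exact
  -- derivative of w²/2, which vanishes at both ends.
  set u : ℝ → ℝ := fun r => w (r • (θ : Space N)) ^ 2 / 2 with hu
  have hder : ∀ r : ℝ, HasDerivAt u (w (r • (θ : Space N)) * fderiv ℝ w (r • (θ : Space N)) θ) r := by
    intro r
    have h1 : HasDerivAt (fun r : ℝ => r • (θ : Space N)) (θ : Space N) r := by
      simpa using (hasDerivAt_id r).smul_const (θ : Space N)
    have h2 : HasDerivAt (fun r : ℝ => w (r • (θ : Space N)))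
        (fderiv ℝ w (r • (θ : Space N)) θ) r :=
      (hw.differentiable _).hasFDerivAt.comp_hasDerivAt r h1
    refine ((h2.pow 2).div_const 2).congr_deriv ?_
    simp; ring
  have hzero : ∀ r, b < r → u r = 0 := by
    intro r hr
    have : w (r • (θ : Space N)) = 0 := by
      by_contra hne
      have h1 := (hs _ hne)
      rw [norm_smul, hθ, mul_one, Real.norm_eq_abs] at h1
      linarith [le_abs_self r, h1.2]
    simp [hu, this]
  have hcont : Continuous (fun r : ℝ => w (r • (θ : Space N)) * fderiv ℝ w (r • (θ : Space N)) θ) := by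
    have hsm : Continuous (fun r : ℝ => r • (θ : Space N)) := by fun_prop
    exact (hw.continuous.comp hsm).mul
      (((hw.contDiff.continuous_fderiv (by simp)).comp hsm).clm_apply continuous_const)
  have hint : IntegrableOn (fun r : ℝ => w (r • (θ : Space N)) * fderiv ℝ w (r • (θ : Space N)) θ)
      (Ioi 0) := by
    refine (hcont.integrable_of_hasCompactSupport ?_).integrableOn
    refine HasCompactSupport.intro (isCompact_Icc (a := -b) (b := b)) fun r hr => ?_
    have : w (r • (θ : Space N)) = 0 := by
      by_contra hne
      have h1 := (hs _ hne)
      rw [norm_smul, hθ, mul_one, Real.norm_eq_abs] at h1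
      exact hr (abs_le.mp h1.2)
    rw [this, zero_mul]
  have hlim : Tendsto u atTop (𝓝 0) := by
    refine tendsto_const_nhds.congr' ?_
    filter_upwards [eventually_gt_atTop b] with r hr
    exact (hzero r hr).symm
  have hftc := integral_Ioi_of_hasDerivAt_of_tendsto (a := 0) (m := 0) (f := u)
    (hder 0).continuousAt.continuousWithinAt (fun r _ => hder r) hint hlim
  have hu0 : u 0 = 0 := by simp [hu, hw.apply_zero]
  rw [hu0, sub_zero] at hftc
  simp only [Pi.zero_apply]
  refine Eq.trans ?_ hftc
  refine setIntegral_congr_fun measurableSet_Ioi fun r hr => ?_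
  have hr' : (0 : ℝ) < r := hr
  simp only [norm_smul, hθ, mul_one, Real.norm_of_nonneg hr'.le, map_smul, smul_eq_mul]
  have e1 : r ^ (N - 1) * r * r ^ (-(N : ℝ)) = 1 := by
    rw [← pow_succ, Nat.sub_add_cancel (by omega), ← Real.rpow_natCast, ← Real.rpow_add hr']
    simp
  linear_combination (w (r • (θ : Space N)) * fderiv ℝ w (r • (θ : Space N)) θ) * e1

variable {N : ℕ}

/-! ### The Hardy–Sobolev inequality for functions supported in annuli -/

theorem norm_smul_add_smul_innerSL_sq (L : Space N →L[ℝ] ℝ) (x : Space N) (a c : ℝ) :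
    ‖a • L + c • innerSL ℝ x‖ ^ 2 = a ^ 2 * ‖L‖ ^ 2 + 2 * a * c * L x + c ^ 2 * ‖x‖ ^ 2 := by
  obtain ⟨g, rfl⟩ := (InnerProductSpace.toDual ℝ (Space N)).surjective L
  have e : a • (InnerProductSpace.toDual ℝ (Space N) g) + c • innerSL ℝ x =
      InnerProductSpace.toDual ℝ (Space N) (a • g + c • x) := by
    ext v
    simp
  rw [e, LinearIsometryEquiv.norm_map, LinearIsometryEquiv.norm_map, norm_add_sq_real, norm_smul,
    norm_smul, real_inner_smul_left, real_inner_smul_right, mul_pow, mul_pow, Real.norm_eq_abs,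
    Real.norm_eq_abs, sq_abs, sq_abs, InnerProductSpace.toDual_apply_apply]
  ring

theorem ae_ne_zero (hN : 3 ≤ N) : ∀ᵐ x : Space N, x ≠ 0 := by
  have := nontrivial_space hN
  rw [ae_iff]
  simp

theorem fderiv_norm_rpow_mul {w : Space N → ℝ} {x : Space N} (hx : x ≠ 0)
    (hw : DifferentiableAt ℝ w x) (s : ℝ) :
    HasFDerivAt (fun y => ‖y‖ ^ s * w y)
      (‖x‖ ^ s • fderiv ℝ w x + (w x * (s * ‖x‖ ^ (s - 2))) • innerSL ℝ x) x := by
  refine ((hasFDerivAt_norm_rpow hx s).mul hw.hasFDerivAt).congr_fderiv ?_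
  rw [smul_smul]

/-- The energy in Emden–Fowler variables. -/
theorem integral_gradient_sq_annular (hN : 3 ≤ N) {w : Space N → ℝ} (hw : IsAnnular w) :
    ∫ x, ‖gradient (fun y => ‖y‖ ^ (-(((N : ℝ) - 2) / 2)) * w y) x‖ ^ 2 =
      (∫ x, (‖x‖ ^ 2 * ‖fderiv ℝ w x‖ ^ 2) * ‖x‖ ^ (-(N : ℝ))) +
        (((N : ℝ) - 2) / 2) ^ 2 * ∫ x, w x ^ 2 * ‖x‖ ^ (-(N : ℝ)) := by
  obtain ⟨a, b, ha, hs⟩ := hw.supp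
  set μ : ℝ := ((N : ℝ) - 2) / 2 with hμ
  have hfc : Continuous (fun x => fderiv ℝ w x) := hw.contDiff.continuous_fderiv (by simp)
  have hi1 : Integrable (fun x : Space N => (‖x‖ ^ 2 * ‖fderiv ℝ w x‖ ^ 2) * ‖x‖ ^ (-(N : ℝ))) :=
    IsAnnular.integrable_weight ha (fun x hx => IsAnnular.supp_fderiv hs x fun h => hx (by
      rw [h]; simp)) ((continuous_norm.pow 2).mul (hfc.norm.pow 2))
  have hi2 : Integrable (fun x : Space N => w x ^ 2 * ‖x‖ ^ (-(N : ℝ))) :=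
    IsAnnular.integrable_weight ha (fun x hx => hs x fun h => hx (by rw [h]; simp))
      (hw.continuous.pow 2)
  have hi3 : Integrable (fun x : Space N => (w x * fderiv ℝ w x x) * ‖x‖ ^ (-(N : ℝ))) :=
    IsAnnular.integrable_weight ha (fun x hx => hs x (left_ne_zero_of_mul hx))
      (hw.continuous.mul (hfc.clm_apply continuous_id))
  -- Expansion of the square; the cross term is the radial derivative with zero integral.
  have hpt : ∀ᵐ x : Space N, ‖gradient (fun y => ‖y‖ ^ (-μ) * w y) x‖ ^ 2 =
      (‖x‖ ^ 2 * ‖fderiv ℝ w x‖ ^ 2) * ‖x‖ ^ (-(N : ℝ)) -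
        2 * μ * ((w x * fderiv ℝ w x x) * ‖x‖ ^ (-(N : ℝ))) +
        μ ^ 2 * (w x ^ 2 * ‖x‖ ^ (-(N : ℝ))) := by
    filter_upwards [ae_ne_zero hN] with x hx
    have hx' : 0 < ‖x‖ := norm_pos_iff.mpr hx
    rw [norm_gradient_eq, (fderiv_norm_rpow_mul hx (hw.differentiable x) (-μ)).fderiv,
      norm_smul_add_smul_innerSL_sq]
    have e1 : (‖x‖ ^ (-μ)) ^ 2 = ‖x‖ ^ 2 * ‖x‖ ^ (-(N : ℝ)) := by
      rw [← Real.rpow_natCast (‖x‖ ^ (-μ)), ← Real.rpow_mul hx'.le, ← Real.rpow_natCast ‖x‖ 2,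
        ← Real.rpow_add hx']
      congr 1; rw [hμ]; push_cast; ring
    have e2 : ‖x‖ ^ (-μ - 2) = ‖x‖ ^ (-μ) / ‖x‖ ^ 2 := by
      rw [Real.rpow_sub hx', Real.rpow_two]
    rw [e2]
    have e3 : (‖x‖ ^ (-μ)) * (‖x‖ ^ (-μ)) = ‖x‖ ^ 2 * ‖x‖ ^ (-(N : ℝ)) := by rw [← sq, e1]
    field_simp
    linear_combination (‖fderiv ℝ w x‖ ^ 2 * ‖x‖ ^ 2 - 2 * μ * w x * fderiv ℝ w x x
      + μ ^ 2 * w x ^ 2) * e3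
  have hi13 : Integrable (fun x : Space N => (‖x‖ ^ 2 * ‖fderiv ℝ w x‖ ^ 2) * ‖x‖ ^ (-(N : ℝ)) -
      2 * μ * ((w x * fderiv ℝ w x x) * ‖x‖ ^ (-(N : ℝ)))) := hi1.sub (hi3.const_mul _)
  rw [integral_congr_ae hpt, integral_add hi13 (hi2.const_mul _),
    integral_sub hi1 (hi3.const_mul _), integral_const_mul, integral_const_mul,
    integral_mul_fderiv_radial hN hw]
  ring

theorem norm_rpow_neg_mul_cancel {φ : Space N → ℝ} (hφ : IsAnnular φ) (s : ℝ) :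
    (fun x => ‖x‖ ^ (-s) * (‖x‖ ^ s * φ x)) = φ := by
  funext x
  by_cases hx : x = 0
  · subst hx; simp [hφ.apply_zero]
  · have hx' : 0 < ‖x‖ := norm_pos_iff.mpr hx
    rw [← mul_assoc, ← Real.rpow_add hx']
    simp

theorem integral_sq_div_norm_sq_annular (hN : 3 ≤ N) (φ : Space N → ℝ) :
    ∫ x, φ x ^ 2 / ‖x‖ ^ 2 =
      ∫ x, (‖x‖ ^ (((N : ℝ) - 2) / 2) * φ x) ^ 2 * ‖x‖ ^ (-(N : ℝ)) := by
  refine integral_congr_ae ?_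
  filter_upwards [ae_ne_zero hN] with x hx
  have hx' : 0 < ‖x‖ := norm_pos_iff.mpr hx
  have e1 : (‖x‖ ^ (((N : ℝ) - 2) / 2)) ^ 2 * ‖x‖ ^ (-(N : ℝ)) = (‖x‖ ^ 2)⁻¹ := by
    rw [← Real.rpow_natCast (‖x‖ ^ (((N : ℝ) - 2) / 2)), ← Real.rpow_mul hx'.le, ← Real.rpow_add hx',
      ← Real.rpow_two, ← Real.rpow_neg hx'.le]
    congr 1; push_cast; ring
  rw [mul_pow, div_eq_mul_inv, ← e1]
  ring

theorem integral_abs_rpow_annular (hN : 3 ≤ N) (φ : Space N → ℝ) :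
    ∫ x, |φ x| ^ critExp N =
      ∫ x, |‖x‖ ^ (((N : ℝ) - 2) / 2) * φ x| ^ critExp N * ‖x‖ ^ (-(N : ℝ)) := by
  have h3 : (3 : ℝ) ≤ N := by exact_mod_cast hN
  have hN2 : (0 : ℝ) < N - 2 := by linarith
  refine integral_congr_ae ?_
  filter_upwards [ae_ne_zero hN] with x hx
  have hx' : 0 < ‖x‖ := norm_pos_iff.mpr hx
  have e1 : (‖x‖ ^ (((N : ℝ) - 2) / 2)) ^ critExp N * ‖x‖ ^ (-(N : ℝ)) = 1 := by
    rw [← Real.rpow_mul hx'.le, ← Real.rpow_add hx', critExp]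
    rw [show ((N : ℝ) - 2) / 2 * (2 * N / (N - 2)) + -N = 0 by field_simp; ring, Real.rpow_zero]
  rw [abs_mul, abs_of_pos (Real.rpow_pos_of_pos hx' _), Real.mul_rpow (by positivity) (abs_nonneg _)]
  linear_combination (-|φ x| ^ critExp N) * e1

/-- In Emden–Fowler form the difference of the two sides is a weighted integral of |∇w|². -/
theorem hardy_annular (hN : 3 ≤ N) {φ : Space N → ℝ} (hφ : IsAnnular φ) :
    (((N : ℝ) - 2) / 2) ^ 2 * ∫ x, φ x ^ 2 / ‖x‖ ^ 2 ≤ ∫ x, ‖gradient φ x‖ ^ 2 := by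
  have h := integral_gradient_sq_annular hN (hφ.norm_rpow_mul (((N : ℝ) - 2) / 2))
  rw [norm_rpow_neg_mul_cancel hφ] at h
  rw [h, integral_sq_div_norm_sq_annular hN]
  have : 0 ≤ ∫ x, (‖x‖ ^ 2 * ‖fderiv ℝ (fun x => ‖x‖ ^ (((N : ℝ) - 2) / 2) * φ x) x‖ ^ 2) *
      ‖x‖ ^ (-(N : ℝ)) := integral_nonneg fun x => by positivity
  linarith

/-- The sharp constant of the Hardy–Sobolev inequality with parameter
`γ = (1 - σ²) (N-2)²/4`. -/
def sharpConst (N : ℕ) (σ : ℝ) : ℝ :=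
  N * ((N : ℝ) - 2) * sobolevMass N ^ (2 / (N : ℝ)) * σ ^ (2 - 2 / (N : ℝ))

/-- The substitution scales tangential directions by |y|^{τ-1} and the radial one by τ|y|^{τ-1}. For
τ ≥ 1 the radial factor dominates; this is where σ ≤ 1, that is γ ≥ 0, matters. -/
theorem norm_fderiv_comp_radial_le {w : Space N → ℝ} (hw : Differentiable ℝ w) {τ : ℝ} (hτ : 1 ≤ τ)
    {y : Space N} (hy : y ≠ 0) :
    ‖y‖ * ‖fderiv ℝ (fun y => w (‖y‖ ^ (τ - 1) • y)) y‖ ≤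
      τ * (‖‖y‖ ^ (τ - 1) • y‖ * ‖fderiv ℝ w (‖y‖ ^ (τ - 1) • y)‖) := by
  have hy' : 0 < ‖y‖ := norm_pos_iff.mpr hy
  have h1 := (hasFDerivAt_norm_rpow hy (τ - 1)).smul (hasFDerivAt_id y)
  have h2 := ((hw _).hasFDerivAt.comp y h1).fderiv
  change fderiv ℝ (fun y => w (‖y‖ ^ (τ - 1) • y)) y = _ at h2
  rw [h2, IsAnnular.norm_rpow_sub_one_smul y hy]
  set L := fderiv ℝ w (‖y‖ ^ (τ - 1) • y) with hL
  have hA : ‖(‖y‖ ^ (τ - 1) • ContinuousLinearMap.id ℝ (Space N) +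
      (((τ - 1) * ‖y‖ ^ (τ - 1 - 2)) • innerSL ℝ y).smulRight (id y))‖ ≤ τ * ‖y‖ ^ (τ - 1) := by
    refine ContinuousLinearMap.opNorm_le_bound _ (by positivity) fun v => ?_
    simp only [_root_.add_apply, _root_.smul_apply,
      ContinuousLinearMap.id_apply, ContinuousLinearMap.smulRight_apply, innerSL_apply_apply, id]
    have e1 : ‖y‖ ^ (τ - 1 - 2) * (‖y‖ * ‖y‖) = ‖y‖ ^ (τ - 1) := by
      rw [← sq, ← Real.rpow_two, ← Real.rpow_add hy']; congr 1; ring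
    calc _ ≤ ‖‖y‖ ^ (τ - 1) • v‖ + ‖(((τ - 1) * ‖y‖ ^ (τ - 1 - 2)) • inner ℝ y v) • y‖ :=
          norm_add_le _ _
      _ ≤ ‖y‖ ^ (τ - 1) * ‖v‖ + ((τ - 1) * ‖y‖ ^ (τ - 1 - 2)) * (‖y‖ * ‖v‖) * ‖y‖ := by
          have h0 : 0 ≤ τ - 1 := by linarith
          rw [norm_smul, norm_smul, norm_smul, Real.norm_of_nonneg (by positivity),
            Real.norm_of_nonneg (by positivity)]
          gcongr
          exact norm_inner_le_norm _ _
      _ = τ * ‖y‖ ^ (τ - 1) * ‖v‖ := by linear_combination ((τ - 1) * ‖v‖) * e1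
  have e2 : ‖y‖ * ‖y‖ ^ (τ - 1) = ‖y‖ ^ τ := by
    rw [mul_comm, ← Real.rpow_add_one hy'.ne']; congr 1; ring
  calc _ ≤ ‖y‖ * (‖L‖ * (τ * ‖y‖ ^ (τ - 1))) := by
        gcongr
        exact (ContinuousLinearMap.opNorm_comp_le _ _).trans (mul_le_mul_of_nonneg_left hA (norm_nonneg L))
    _ = _ := by linear_combination (‖L‖ * τ) * e2

/-- With K and Z the weighted integrals of |x|²|∇w|² and w², the right side is K + μ²σ²Z. After the
substitution with τ = 1/σ, the gradient term is at most K/σ, the zero-order term is σZ, and the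
integral of the p-th power is multiplied by σ. Sobolev's inequality for the new function, multiplied
by σ, is the claim; this produces the power σ^{2-2/N}. -/
theorem hardySobolev_annular (hN : 3 ≤ N) {γ σ : ℝ} (hσ0 : 0 < σ) (hσ1 : σ ≤ 1)
    (hγ : γ = (((N : ℝ) - 2) / 2) ^ 2 * (1 - σ ^ 2)) {φ : Space N → ℝ} (hφ : IsAnnular φ) :
    sharpConst N σ * (∫ x, |φ x| ^ critExp N) ^ (1 - 2 / (N : ℝ)) ≤
      (∫ x, ‖gradient φ x‖ ^ 2) - γ * ∫ x, φ x ^ 2 / ‖x‖ ^ 2 := by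
  have h3 : (3 : ℝ) ≤ N := by exact_mod_cast hN
  have hN0 : (0 : ℝ) < N := by linarith
  have hp0 : 0 ≤ critExp N := by linarith [one_le_critExp hN]
  set μ : ℝ := ((N : ℝ) - 2) / 2 with hμ
  set w : Space N → ℝ := fun x => ‖x‖ ^ μ * φ x with hw
  have hwA : IsAnnular w := hφ.norm_rpow_mul μ
  obtain ⟨a, b, ha, hs⟩ := hwA.supp
  set τ : ℝ := 1 / σ with hτ
  have hτ0 : 0 < τ := by positivity
  have hτ1 : 1 ≤ τ := by rw [hτ, le_div_iff₀ hσ0]; linarith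
  set v : Space N → ℝ := fun y => w (‖y‖ ^ (τ - 1) • y) with hv
  have hvA : IsAnnular v := hwA.comp_radial hτ0
  set ψ : Space N → ℝ := fun x => ‖x‖ ^ (-μ) * v x with hψ
  have hψA : IsAnnular ψ := hvA.norm_rpow_mul (-μ)
  have hsob := sobolev_sharp hN hψA.contDiff_one hψA.hasCompactSupport
  -- rewrite both energies on the cylinder
  have hEφ := integral_gradient_sq_annular hN hwA
  rw [norm_rpow_neg_mul_cancel hφ] at hEφ
  have hEψ := integral_gradient_sq_annular hN hvA
  have hPψ := integral_abs_rpow_annular hN ψ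
  have hψv : (fun x => ‖x‖ ^ (((N : ℝ) - 2) / 2) * ψ x) = v := by
    have := norm_rpow_neg_mul_cancel hvA (-μ)
    rwa [neg_neg] at this
  rw [show (∫ x, |‖x‖ ^ (((N : ℝ) - 2) / 2) * ψ x| ^ critExp N * ‖x‖ ^ (-(N : ℝ))) =
    ∫ x, |v x| ^ critExp N * ‖x‖ ^ (-(N : ℝ)) by
      refine integral_congr_ae (Eventually.of_forall fun x => ?_)
      simp only
      rw [← congrFun hψv x]] at hPψ
  have hfc : Continuous (fun x => fderiv ℝ w x) := hwA.contDiff.continuous_fderiv (by simp)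
  have hK := integral_comp_radial hN (h := fun x => ‖x‖ ^ 2 * ‖fderiv ℝ w x‖ ^ 2) ha
    (fun x hx => IsAnnular.supp_fderiv hs x fun h => hx (by simp only [h]; simp))
    ((continuous_norm.pow 2).mul (hfc.norm.pow 2)) hτ0
  have hZ := integral_comp_radial hN (h := fun x => w x ^ 2) ha
    (fun x hx => hs x fun h => hx (by simp only [h]; simp)) (hwA.continuous.pow 2) hτ0
  have hp1 := one_le_critExp hN
  have hP := integral_comp_radial hN (h := fun x => |w x| ^ critExp N) ha
    (fun x hx => hs x fun h => hx (by
      simp only [h, abs_zero]; exact Real.zero_rpow (by linarith)))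
    (hwA.continuous.abs.rpow_const fun x => Or.inr hp0) hτ0
  set K := ∫ x, (‖x‖ ^ 2 * ‖fderiv ℝ w x‖ ^ 2) * ‖x‖ ^ (-(N : ℝ)) with hKdef
  set Z := ∫ x, w x ^ 2 * ‖x‖ ^ (-(N : ℝ)) with hZdef
  have hPφ : ∫ x, |φ x| ^ critExp N = ∫ x, |w x| ^ critExp N * ‖x‖ ^ (-(N : ℝ)) :=
    integral_abs_rpow_annular hN φ
  have hZφ : ∫ x, φ x ^ 2 / ‖x‖ ^ 2 = Z := integral_sq_div_norm_sq_annular hN φ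
  have hKv : ∫ x, (‖x‖ ^ 2 * ‖fderiv ℝ v x‖ ^ 2) * ‖x‖ ^ (-(N : ℝ)) ≤ τ * K := by
    obtain ⟨a', b', ha', hs'⟩ := hvA.supp
    have hfc' : Continuous (fun x => fderiv ℝ v x) := hvA.contDiff.continuous_fderiv (by simp)
    have hi1 : Integrable (fun x : Space N => (‖x‖ ^ 2 * ‖fderiv ℝ v x‖ ^ 2) * ‖x‖ ^ (-(N : ℝ))) :=
      IsAnnular.integrable_weight ha' (fun x hx => IsAnnular.supp_fderiv hs' x fun h => hx (by
        rw [h]; simp)) ((continuous_norm.pow 2).mul (hfc'.norm.pow 2))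
    have hK0 := integrable_comp_radial (h := fun x => ‖x‖ ^ 2 * ‖fderiv ℝ w x‖ ^ 2) ha
      (fun x hx => IsAnnular.supp_fderiv hs x fun h => hx (by simp only [h]; simp))
      ((continuous_norm.pow 2).mul (hfc.norm.pow 2)) hτ0
    calc _ ≤ ∫ y : Space N, τ ^ 2 * ((‖‖y‖ ^ (τ - 1) • y‖ ^ 2 *
            ‖fderiv ℝ w (‖y‖ ^ (τ - 1) • y)‖ ^ 2) * ‖y‖ ^ (-(N : ℝ))) := by
          refine integral_mono_ae hi1 (hK0.const_mul _) ?_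
          filter_upwards [ae_ne_zero hN] with y hy
          have h := norm_fderiv_comp_radial_le hwA.differentiable hτ1 hy
          have h2 := pow_le_pow_left₀ (by positivity) h 2
          have h3 : 0 ≤ ‖y‖ ^ (-(N : ℝ)) := by positivity
          calc _ = (‖y‖ * ‖fderiv ℝ v y‖) ^ 2 * ‖y‖ ^ (-(N : ℝ)) := by ring
            _ ≤ (τ * (‖‖y‖ ^ (τ - 1) • y‖ * ‖fderiv ℝ w (‖y‖ ^ (τ - 1) • y)‖)) ^ 2 *
                ‖y‖ ^ (-(N : ℝ)) := mul_le_mul_of_nonneg_right h2 h3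
            _ = _ := by ring
      _ = τ * K := by
          rw [integral_const_mul, hK]
          field_simp
  have hPv : ∫ x, |ψ x| ^ critExp N = σ * ∫ x, |φ x| ^ critExp N := by
    rw [hPψ, hPφ]
    refine hP.trans ?_
    rw [hτ, one_div, inv_inv]
  have hZv : ∫ x, v x ^ 2 * ‖x‖ ^ (-(N : ℝ)) = σ * Z := by
    refine hZ.trans ?_
    rw [hτ, one_div, inv_inv]
  have hPφ0 : 0 ≤ ∫ x, |φ x| ^ critExp N := integral_nonneg fun x => by positivity
  rw [hPv, Real.mul_rpow hσ0.le hPφ0] at hsob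
  have hEψ' : ∫ x, ‖gradient ψ x‖ ^ 2 ≤ τ * K + μ ^ 2 * (σ * Z) := by
    rw [← hZv]
    exact hEψ.le.trans (add_le_add_left hKv _)
  have h4 := mul_le_mul_of_nonneg_left (hsob.trans hEψ') hσ0.le
  have h5 : σ ^ (2 - 2 / (N : ℝ)) = σ * σ ^ (1 - 2 / (N : ℝ)) := by
    rw [mul_comm, ← Real.rpow_add_one hσ0.ne']; congr 1; ring
  have h6 : σ * τ = 1 := by rw [hτ]; field_simp
  rw [hEφ, hZφ, hγ, sharpConst, h5]
  calc _ ≤ σ * (τ * K + μ ^ 2 * (σ * Z)) := by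
        refine le_trans (le_of_eq ?_) h4
        ring
    _ = (σ * τ) * K + μ ^ 2 * σ ^ 2 * Z := by ring
    _ = _ := by rw [h6]; ring

/-! ### Annular approximation in `H¹` -/

theorem tendsto_eLpNorm_smul_zero {α E : Type*} [MeasurableSpace α] {ν : Measure α}
    [NormedAddCommGroup E] [NormedSpace ℝ E] {p : ℝ≥0∞} (hp0 : p ≠ 0) (hp : p ≠ ⊤)
    {c : ℕ → α → ℝ} {f : α → E} (hf : MemLp f p ν) (hc : ∀ n, AEStronglyMeasurable (c n) ν)
    (hc1 : ∀ n x, |c n x| ≤ 1) (hlim : ∀ᵐ x ∂ν, Tendsto (fun n => c n x) atTop (𝓝 0)) :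
    Tendsto (fun n => eLpNorm (fun x => c n x • f x) p ν) atTop (𝓝 0) := by
  have hp' : 0 < p.toReal := ENNReal.toReal_pos hp0 hp
  have hmain : Tendsto (fun n => ∫⁻ x, ‖c n x • f x‖ₑ ^ p.toReal ∂ν) atTop (𝓝 0) := by
    have := tendsto_lintegral_of_dominated_convergence' (μ := ν)
      (F := fun n x => ‖c n x • f x‖ₑ ^ p.toReal) (f := fun _ => 0)
      (fun x => ‖f x‖ₑ ^ p.toReal)
      (fun n => (((hc n).smul hf.1).enorm.pow_const _)) (fun n => Eventually.of_forall fun x => ?_)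
      (lintegral_rpow_enorm_lt_top_of_eLpNorm_lt_top hp0 hp hf.2).ne ?_
    · simpa using this
    · refine ENNReal.rpow_le_rpow ?_ hp'.le
      rw [enorm_smul]
      refine mul_le_of_le_one_left (zero_le) ?_
      rw [← ofReal_norm, Real.norm_eq_abs, ← ENNReal.ofReal_one]
      exact ENNReal.ofReal_le_ofReal (hc1 n x)
    · filter_upwards [hlim] with x hx
      have h1 : Tendsto (fun n => ‖c n x • f x‖ₑ) atTop (𝓝 0) := by
        have := (hx.smul_const (f x)).enorm
        simpa using this
      have h2 := ((ENNReal.continuous_rpow_const (y := p.toReal)).tendsto 0).comp h1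
      simpa [ENNReal.zero_rpow_of_pos hp', Function.comp_def] using h2
  have h2 := ((ENNReal.continuous_rpow_const (y := 1 / p.toReal)).tendsto 0).comp hmain
  rw [ENNReal.zero_rpow_of_pos (by positivity)] at h2
  refine h2.congr fun n => ?_
  rw [eLpNorm_eq_lintegral_rpow_enorm_toReal hp0 hp]
  rfl

/-- A fixed bump function on the line. -/
def logBump : ContDiffBump (0 : ℝ) := ⟨1, 2, one_pos, one_lt_two⟩

/-- A logarithmic cutoff away from `0` and `∞`. -/
def logCutoff (N k : ℕ) (x : Space N) : ℝ := logBump (Real.log ‖x‖ / (k + 1))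

variable {N : ℕ}

theorem logCutoff_nonneg (k : ℕ) (x : Space N) : 0 ≤ logCutoff N k x := logBump.nonneg

theorem logCutoff_le_one (k : ℕ) (x : Space N) : logCutoff N k x ≤ 1 := logBump.le_one

theorem logCutoff_supp {k : ℕ} {x : Space N} (hx : x ≠ 0) (h : logCutoff N k x ≠ 0) :
    Real.exp (-(2 * (k + 1))) ≤ ‖x‖ ∧ ‖x‖ ≤ Real.exp (2 * (k + 1)) := by
  have hx' : 0 < ‖x‖ := norm_pos_iff.mpr hx
  have hk : (0 : ℝ) < k + 1 := by positivity
  have h1 : |Real.log ‖x‖ / (k + 1)| ≤ 2 := by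
    by_contra hlt
    refine h (logBump.zero_of_le_dist ?_)
    rw [Real.dist_eq, sub_zero]
    exact (not_le.mp hlt).le
  rw [abs_div, abs_of_pos hk, div_le_iff₀ hk, abs_le] at h1
  exact ⟨by rw [← Real.le_log_iff_exp_le hx']; linarith [h1.1],
    by rw [← Real.log_le_iff_le_exp hx']; linarith [h1.2]⟩

theorem tendsto_logCutoff (x : Space N) : Tendsto (fun k => logCutoff N k x) atTop (𝓝 1) := by
  have h1 : Tendsto (fun k : ℕ => Real.log ‖x‖ / ((k : ℝ) + 1)) atTop (𝓝 0) :=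
    tendsto_const_nhds.div_atTop (tendsto_atTop_add_const_right _ _ tendsto_natCast_atTop_atTop)
  have h2 := (logBump.continuous.tendsto 0).comp h1
  rwa [logBump.one_of_mem_closedBall (by simp [logBump])] at h2

theorem contDiffAt_logCutoff (k : ℕ) {x : Space N} (hx : x ≠ 0) :
    ContDiffAt ℝ ∞ (logCutoff N k) x :=
  logBump.contDiff.contDiffAt.comp x
    (((contDiffAt_norm ℝ hx).log (norm_ne_zero_iff.mpr hx)).div_const _)

theorem measurable_logCutoff (k : ℕ) : Measurable (logCutoff N k) :=
  logBump.continuous.measurable.comp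
    ((Real.measurable_log.comp measurable_norm).div_const _)

theorem hasFDerivAt_log_norm {x : Space N} (hx : x ≠ 0) :
    HasFDerivAt (fun y : Space N => Real.log ‖y‖) ((‖x‖ ^ 2)⁻¹ • innerSL ℝ x) x := by
  have hx' : 0 < ‖x‖ := norm_pos_iff.mpr hx
  have h1 := hasFDerivAt_norm_rpow hx 1
  simp only [Real.rpow_one] at h1
  refine (h1.log hx'.ne').congr_fderiv ?_
  rw [smul_smul]
  congr 1
  rw [show (1 : ℝ) - 2 = -1 by norm_num, Real.rpow_neg_one]
  field_simp

/-- Cutting off on a logarithmic scale gains the factor 1/(k+1) over |x|^{-1}. The error u∇χ is then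
small in L² as soon as u/|x| is in L². -/
theorem exists_norm_fderiv_logCutoff_le : ∃ C : ℝ, 0 ≤ C ∧ ∀ (N k : ℕ) (x : Space N), x ≠ 0 →
    ‖fderiv ℝ (logCutoff N k) x‖ ≤ C / (k + 1) * ‖x‖⁻¹ := by
  obtain ⟨C, hC⟩ := (logBump.hasCompactSupport.deriv).exists_bound_of_continuous
    (logBump.contDiff.continuous_deriv (n := 1) le_rfl)
  refine ⟨C, (norm_nonneg _).trans (hC 0), fun N k x hx => ?_⟩
  have hx' : 0 < ‖x‖ := norm_pos_iff.mpr hx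
  have hk : (0 : ℝ) < k + 1 := by positivity
  have hb : HasDerivAt logBump (deriv logBump (Real.log ‖x‖ / (k + 1))) (Real.log ‖x‖ / (k + 1)) :=
    ((logBump.contDiff (n := 1)).differentiable (by simp) _).hasDerivAt
  have h1 := hb.comp_hasFDerivAt x ((hasFDerivAt_log_norm hx).mul_const ((k : ℝ) + 1)⁻¹)
  have h2 : fderiv ℝ (logCutoff N k) x = _ := h1.fderiv
  rw [h2, norm_smul, norm_smul, norm_smul, innerSL_apply_norm, norm_inv, norm_inv,
    norm_pow, norm_norm, Real.norm_of_nonneg hk.le]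
  calc _ ≤ C * (((k : ℝ) + 1)⁻¹ * ((‖x‖ ^ 2)⁻¹ * ‖x‖)) :=
        mul_le_mul_of_nonneg_right (hC _) (by positivity)
    _ = _ := by field_simp

theorem critExp_ofReal (hN : 3 ≤ N) : 1 ≤ ENNReal.ofReal (critExp N) := by
  rw [← ENNReal.ofReal_one]; exact ENNReal.ofReal_le_ofReal (one_le_critExp hN)

theorem measurable_gradient (f : Space N → ℝ) : Measurable (gradient f) :=
  (InnerProductSpace.toDual ℝ (Space N)).symm.continuous.measurable.comp (measurable_fderiv ℝ f)

/-- Logarithmic cutoffs approximate a function that is smooth away from the origin. -/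
theorem exists_annular_approx (hN : 3 ≤ N) {u : Space N → ℝ}
    (hu : ∀ x, x ≠ 0 → ContDiffAt ℝ ∞ u x) (hup : MemLp u (ENNReal.ofReal (critExp N)) volume)
    (hu2 : MemLp (gradient u) 2 volume) (huH : MemLp (fun x => ‖x‖⁻¹ * u x) 2 volume) :
    ∃ φ : ℕ → Space N → ℝ, (∀ n, IsAnnular (φ n)) ∧
      Tendsto (fun n => eLpNorm (φ n - u) (ENNReal.ofReal (critExp N)) volume) atTop (𝓝 0) ∧
      Tendsto (fun n => eLpNorm (gradient (φ n) - gradient u) 2 volume) atTop (𝓝 0) := by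
  classical
  have hp1 := critExp_ofReal hN
  obtain ⟨C, hC0, hC⟩ := exists_norm_fderiv_logCutoff_le
  -- Because `Real.log 0 = 0`, the cutoff equals 1 at the origin; the value 0 there has to be
  -- imposed.
  set φ : ℕ → Space N → ℝ := fun k x => if x = 0 then 0 else logCutoff N k x * u x with hφ
  have heq : ∀ k x, x ≠ 0 → φ k =ᶠ[𝓝 x] fun y => logCutoff N k y * u y := by
    intro k x hx
    filter_upwards [isOpen_ne.mem_nhds hx] with y hy
    simp only [hφ, if_neg (show ¬ y = 0 from hy)]
  have hone : ∀ k x, |logCutoff N k x - 1| ≤ 1 := by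
    intro k x
    rw [abs_le]
    constructor <;> linarith [logCutoff_nonneg k x, logCutoff_le_one k x]
  have hlim : ∀ x : Space N, Tendsto (fun k => logCutoff N k x - 1) atTop (𝓝 0) := by
    intro x
    simpa using (tendsto_logCutoff x).sub_const 1
  refine ⟨φ, fun k => ?_, ?_, ?_⟩
  · refine IsAnnular.of_contDiffAt (a := Real.exp (-(2 * (k + 1)))) (b := Real.exp (2 * (k + 1)))
      (Real.exp_pos _) (fun x hx => ?_) fun x hx => ?_
    · have hx0 : x ≠ 0 := by rintro rfl; simp [hφ] at hx
      simp only [hφ, if_neg hx0] at hx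
      exact logCutoff_supp hx0 (left_ne_zero_of_mul hx)
    · exact ((contDiffAt_logCutoff k hx).mul (hu x hx)).congr_of_eventuallyEq (heq k x hx)
  · refine (tendsto_eLpNorm_smul_zero (p := ENNReal.ofReal (critExp N))
      (zero_lt_one.trans_le hp1).ne' ENNReal.ofReal_ne_top hup
      (fun k => ((measurable_logCutoff k).sub_const 1).aestronglyMeasurable) hone
      (Eventually.of_forall hlim)).congr fun k => ?_
    refine eLpNorm_congr_ae ?_
    filter_upwards [ae_ne_zero hN] with x hx
    simp only [hφ, Pi.sub_apply, if_neg hx, smul_eq_mul]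
    ring
  · have t1 := tendsto_eLpNorm_smul_zero (p := 2) (by norm_num) (by norm_num) hu2
      (fun k => ((measurable_logCutoff k).sub_const 1).aestronglyMeasurable) hone
      (Eventually.of_forall hlim)
    have t2 : Tendsto (fun k : ℕ => ENNReal.ofReal (C / (k + 1)) *
        eLpNorm (fun x : Space N => ‖x‖⁻¹ * u x) 2 volume) atTop (𝓝 0) := by
      have h1 : Tendsto (fun k : ℕ => C / ((k : ℝ) + 1)) atTop (𝓝 0) :=
        tendsto_const_nhds.div_atTop (tendsto_atTop_add_const_right _ _ tendsto_natCast_atTop_atTop)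
      have h2 := (ENNReal.tendsto_ofReal h1)
      rw [ENNReal.ofReal_zero] at h2
      have := ENNReal.Tendsto.mul_const (b := eLpNorm (fun x : Space N => ‖x‖⁻¹ * u x) 2 volume)
        h2 (Or.inr huH.2.ne)
      simpa using this
    have t3 := t1.add t2
    rw [add_zero] at t3
    refine tendsto_of_tendsto_of_tendsto_of_le_of_le tendsto_const_nhds t3
      (fun _ => zero_le) (fun k => ?_)
    -- What remains after removing the cutoff acting on ∇u: the term in which the cutoff is
    -- differentiated.
    set B : Space N → Space N := fun x => (gradient (φ k) x - gradient u x) -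
      (logCutoff N k x - 1) • gradient u x with hB
    have hBm : AEStronglyMeasurable B volume :=
      (((measurable_gradient _).sub (measurable_gradient _)).sub
        (((measurable_logCutoff k).sub_const 1).smul (measurable_gradient _))).aestronglyMeasurable
    have hsplit : gradient (φ k) - gradient u =
        (fun x => (logCutoff N k x - 1) • gradient u x) + B := by
      funext x; simp [hB]
    rw [hsplit]
    refine (eLpNorm_add_le (((measurable_logCutoff k).sub_const 1).smul
      (measurable_gradient _)).aestronglyMeasurable hBm (by norm_num)).trans ?_
    refine add_le_add_right ?_ _
    refine eLpNorm_le_mul_eLpNorm_of_ae_le_mul (c := C / (k + 1)) ?_ 2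
    filter_upwards [ae_ne_zero hN] with x hx
    have hd : fderiv ℝ (φ k) x = logCutoff N k x • fderiv ℝ u x + u x • fderiv ℝ (logCutoff N k) x := by
      rw [(heq k x hx).fderiv_eq]
      exact fderiv_mul ((contDiffAt_logCutoff k hx).differentiableAt (by simp))
        ((hu x hx).differentiableAt (by simp))
    have hBx : B x = u x • gradient (logCutoff N k) x := by
      simp only [hB, gradient, hd, map_add, map_smulₛₗ, conj_trivial, sub_smul, one_smul]
      abel
    rw [hBx, norm_smul, norm_gradient_eq, norm_mul, norm_inv, norm_norm]
    calc _ ≤ ‖u x‖ * (C / (k + 1) * ‖x‖⁻¹) := by gcongr; exact hC N k x hx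
      _ = _ := by ring

variable {N : ℕ}

/-! ### The Hardy–Sobolev inequality in `H¹` -/

/-- In dimension at least 3 the weight r^{N-1}r^{-2} has no singularity. Hence test functions need
not vanish at the origin for u/|x| to be square integrable. -/
theorem integrableOn_ball_inv_norm_sq (hN : 3 ≤ N) (R : ℝ) :
    IntegrableOn (fun x : Space N => (‖x‖ ^ 2)⁻¹) (Metric.ball 0 R) := by
  have := nontrivial_space hN
  rw [integrableOn_fun_norm_addHaar volume (f := fun r : ℝ => (r ^ 2)⁻¹)]
  have h1 : IntegrableOn (fun r : ℝ => r ^ (N - 3)) (Ioo 0 R) :=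
    ((continuous_pow (N - 3)).integrableOn_Icc (a := 0) (b := R)).mono_set Ioo_subset_Icc_self
  refine h1.congr_fun (fun r hr => ?_) measurableSet_Ioo
  have hr0 : r ≠ 0 := hr.1.ne'
  simp only [finrank_euclideanSpace, Fintype.card_fin, smul_eq_mul]
  rw [show N - 1 = (N - 3) + 2 by omega, pow_add]
  field_simp

theorem memLp_inv_norm_mul (hN : 3 ≤ N) {φ : Space N → ℝ} (hφ : Continuous φ)
    (hφc : HasCompactSupport φ) : MemLp (fun x => ‖x‖⁻¹ * φ x) 2 volume := by
  have hm : Measurable (fun x : Space N => ‖x‖⁻¹ * φ x) := measurable_norm.inv.mul hφ.measurable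
  rw [memLp_two_iff_integrable_sq hm.aestronglyMeasurable]
  obtain ⟨C, hC⟩ := hφc.exists_bound_of_continuous hφ
  obtain ⟨R, hR⟩ := hφc.isCompact.isBounded.subset_ball 0
  have h1 := ((integrableOn_ball_inv_norm_sq hN R).const_mul (C ^ 2))
  have h1 := (integrable_indicator_iff measurableSet_ball).mpr h1
  refine h1.mono' (hm.pow_const 2).aestronglyMeasurable (Eventually.of_forall fun x => ?_)
  rw [Real.norm_of_nonneg (by positivity)]
  by_cases hx : φ x = 0
  · rw [hx, mul_zero, zero_pow two_ne_zero]
    exact indicator_nonneg (fun _ _ => by positivity) _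
  · rw [indicator_of_mem (hR (subset_tsupport _ hx))]
    have : φ x ^ 2 ≤ C ^ 2 := by
      rw [← sq_abs]; exact pow_le_pow_left₀ (abs_nonneg _) (hC x) 2
    rw [mul_pow, inv_pow, mul_comm]
    gcongr

theorem IsAnnular.sub {v w : Space N → ℝ} (hv : IsAnnular v) (hw : IsAnnular w) :
    IsAnnular (v - w) := by
  obtain ⟨a, b, ha, hs⟩ := hv.supp
  obtain ⟨a', b', ha', hs'⟩ := hw.supp
  refine ⟨hv.contDiff.sub hw.contDiff, min a a', max b b', lt_min ha ha', fun x hx => ?_⟩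
  by_cases h : v x = 0
  · have h' : w x ≠ 0 := fun h' => hx (by simp [h, h'])
    exact ⟨min_le_of_right_le (hs' x h').1, le_max_of_le_right (hs' x h').2⟩
  · exact ⟨min_le_of_left_le (hs x h).1, le_max_of_le_left (hs x h).2⟩

theorem gradient_sub_of_differentiable {f g : Space N → ℝ} (hf : Differentiable ℝ f)
    (hg : Differentiable ℝ g) : gradient (f - g) = gradient f - gradient g := by
  funext x
  simp only [gradient, Pi.sub_apply]
  rw [fderiv_sub (hf x) (hg x), map_sub]

/-- Each test function is replaced by an annular one within 1/n in both norms; at n = 0 the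
tolerance is infinite and harmless. -/
theorem HasH1Gradient.exists_annular (hN : 3 ≤ N) {u : Space N → ℝ} {G : Space N → Space N}
    (h : HasH1Gradient N u G) :
    ∃ φ : ℕ → Space N → ℝ, (∀ n, IsAnnular (φ n)) ∧
      Tendsto (fun n => eLpNorm (φ n - u) (ENNReal.ofReal (critExp N)) volume) atTop (𝓝 0) ∧
      Tendsto (fun n => eLpNorm (gradient (φ n) - G) 2 volume) atTop (𝓝 0) := by
  obtain ⟨hu, hG, φ, hφ, hφu, hφG⟩ := h
  have hp1 := critExp_ofReal hN
  have key : ∀ n, ∃ ψ, IsAnnular ψ ∧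
      eLpNorm (ψ - φ n) (ENNReal.ofReal (critExp N)) volume ≤ (n : ℝ≥0∞)⁻¹ ∧
      eLpNorm (gradient ψ - gradient (φ n)) 2 volume ≤ (n : ℝ≥0∞)⁻¹ := by
    intro n
    obtain ⟨hs, hc⟩ := hφ n
    have hs1 : ContDiff ℝ 1 (φ n) := hs.of_le (by simp)
    obtain ⟨ψ, hψ, h1, h2⟩ := exists_annular_approx hN (fun x _ => hs.contDiffAt)
      (hs.continuous.memLp_of_hasCompactSupport hc)
      ((continuous_gradient hs1).memLp_of_hasCompactSupport
        (hc.fderiv (𝕜 := ℝ) |>.comp_left (map_zero _)))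
      (memLp_inv_norm_mul hN hs.continuous hc)
    have hpos : (0 : ℝ≥0∞) < (n : ℝ≥0∞)⁻¹ := by simp
    obtain ⟨k, hk1, hk2⟩ := ((h1.eventually_lt_const hpos).and (h2.eventually_lt_const hpos)).exists
    exact ⟨ψ k, hψ k, hk1.le, hk2.le⟩
  choose ψ hψ hψ1 hψ2 using key
  have hinv : Tendsto (fun n : ℕ => (n : ℝ≥0∞)⁻¹) atTop (𝓝 0) :=
    ENNReal.tendsto_inv_nat_nhds_zero
  refine ⟨ψ, hψ, ?_, ?_⟩
  · have hs := hinv.add hφu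
    rw [add_zero] at hs
    refine tendsto_of_tendsto_of_tendsto_of_le_of_le tendsto_const_nhds hs
      (fun _ => zero_le) (fun n => ?_)
    have e : ψ n - u = (ψ n - φ n) + (φ n - u) := by abel
    simp only
    rw [e]
    refine (eLpNorm_add_le ((hψ n).continuous.sub (hφ n).1.continuous).aestronglyMeasurable
      ((hφ n).1.continuous.aestronglyMeasurable.sub hu.1) hp1).trans ?_
    gcongr
    exact hψ1 n
  · have hs := hinv.add hφG
    rw [add_zero] at hs
    refine tendsto_of_tendsto_of_tendsto_of_le_of_le tendsto_const_nhds hs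
      (fun _ => zero_le) (fun n => ?_)
    have e : gradient (ψ n) - G = (gradient (ψ n) - gradient (φ n)) + (gradient (φ n) - G) := by abel
    simp only
    rw [e]
    refine (eLpNorm_add_le ((measurable_gradient _).sub (measurable_gradient _)).aestronglyMeasurable
      ((measurable_gradient _).aestronglyMeasurable.sub hG.1) (by norm_num)).trans ?_
    gcongr
    exact hψ2 n

theorem integral_sq_norm_eq {E : Type*} [NormedAddCommGroup E] {f : Space N → E}
    (hf : MemLp f 2 volume) : ∫ x, ‖f x‖ ^ 2 = (eLpNorm f 2 volume).toReal ^ 2 := by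
  have h0 : 0 ≤ ∫ x, ‖f x‖ ^ 2 := integral_nonneg fun x => by positivity
  have := hf.eLpNorm_eq_integral_rpow_norm (by norm_num) (by norm_num)
  rw [this, ENNReal.toReal_ofReal (by positivity)]
  simp only [ENNReal.toReal_ofNat, Real.rpow_two]
  rw [← Real.rpow_natCast, ← Real.rpow_mul h0]
  norm_num

theorem critNorm_eq (hN : 3 ≤ N) {u : Space N → ℝ}
    (hu : MemLp u (ENNReal.ofReal (critExp N)) volume) :
    critNorm N u = (eLpNorm u (ENNReal.ofReal (critExp N)) volume).toReal := by
  have hp1 := one_le_critExp hN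
  have h0 : 0 ≤ ∫ x, |u x| ^ critExp N := integral_nonneg fun x => by positivity
  rw [hu.eLpNorm_eq_integral_rpow_norm (zero_lt_one.trans_le (critExp_ofReal hN)).ne'
    ENNReal.ofReal_ne_top, ENNReal.toReal_ofReal (by positivity),
    ENNReal.toReal_ofReal (by linarith), critNorm, one_div]
  rfl

theorem critNorm_sq {u : Space N → ℝ} (hN : 3 ≤ N) :
    critNorm N u ^ 2 = (∫ x, |u x| ^ critExp N) ^ (1 - 2 / (N : ℝ)) := by
  have h0 : 0 ≤ ∫ x, |u x| ^ critExp N := integral_nonneg fun x => by positivity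
  have h3 : (3 : ℝ) ≤ N := by exact_mod_cast hN
  have h2 : (N : ℝ) - 2 ≠ 0 := by linarith
  rw [critNorm, ← Real.rpow_natCast, ← Real.rpow_mul h0, critExp]
  congr 1
  push_cast
  field_simp

theorem tendsto_toReal_eLpNorm {E : Type*} [NormedAddCommGroup E] {p : ℝ≥0∞} (hp : 1 ≤ p)
    {f : ℕ → Space N → E} {g : Space N → E} (hf : ∀ n, MemLp (f n) p volume)
    (hg : MemLp g p volume) (h : Tendsto (fun n => eLpNorm (f n - g) p volume) atTop (𝓝 0)) :
    Tendsto (fun n => (eLpNorm (f n) p volume).toReal) atTop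
      (𝓝 (eLpNorm g p volume).toReal) := by
  have : Fact (1 ≤ p) := ⟨hp⟩
  have h1 := ((Lp.tendsto_Lp_iff_tendsto_eLpNorm'' f hf g hg).mpr h).norm
  simpa only [Lp.norm_toLp] using h1

theorem IsAnnular.memLp_gradient {w : Space N → ℝ} (hw : IsAnnular w) :
    MemLp (gradient w) 2 volume :=
  (continuous_gradient hw.contDiff_one).memLp_of_hasCompactSupport
    (hw.hasCompactSupport.fderiv (𝕜 := ℝ) |>.comp_left (map_zero _))

/-- Hardy's inequality for functions supported in annuli, in terms of `L²` norms. -/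
theorem IsAnnular.eLpNorm_inv_norm_mul_le (hN : 3 ≤ N) {w : Space N → ℝ} (hw : IsAnnular w) :
    eLpNorm (fun x => ‖x‖⁻¹ * w x) 2 volume ≤
      ENNReal.ofReal (((N : ℝ) - 2) / 2)⁻¹ * eLpNorm (gradient w) 2 volume := by
  have h3 : (3 : ℝ) ≤ N := by exact_mod_cast hN
  have hμ : 0 < ((N : ℝ) - 2) / 2 := by linarith
  have h1 := memLp_inv_norm_mul hN hw.continuous hw.hasCompactSupport
  have h2 := hardy_annular hN hw
  have e1 : ∫ x, w x ^ 2 / ‖x‖ ^ 2 = ∫ x, ‖‖x‖⁻¹ * w x‖ ^ 2 := by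
    refine integral_congr_ae (Eventually.of_forall fun x => ?_)
    simp only [Real.norm_eq_abs, sq_abs]
    rw [mul_pow, inv_pow]
    ring
  rw [e1, integral_sq_norm_eq h1, integral_sq_norm_eq hw.memLp_gradient, ← mul_pow] at h2
  have h4 := (sq_le_sq₀ (by positivity) (by positivity)).mp h2
  have h5 : (eLpNorm (fun x => ‖x‖⁻¹ * w x) 2 volume).toReal ≤
      (((N : ℝ) - 2) / 2)⁻¹ * (eLpNorm (gradient w) 2 volume).toReal := by
    rw [inv_mul_eq_div, le_div_iff₀ hμ]; linarith
  rw [← ENNReal.ofReal_toReal h1.2.ne, ← ENNReal.ofReal_toReal hw.memLp_gradient.2.ne,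
    ← ENNReal.ofReal_mul (by positivity)]
  exact ENNReal.ofReal_le_ofReal h5

/-- Hardy's inequality applied to differences φ_n - φ_m controls φ_n/|x| by the gradients. The limit
is identified as u/|x| through an almost everywhere convergent subsequence and Fatou's lemma. -/
theorem HasH1Gradient.exists_annular_hardy (hN : 3 ≤ N) {u : Space N → ℝ} {G : Space N → Space N}
    (h : HasH1Gradient N u G) :
    MemLp (fun x => ‖x‖⁻¹ * u x) 2 volume ∧
    ∃ φ : ℕ → Space N → ℝ, (∀ n, IsAnnular (φ n)) ∧
      Tendsto (fun n => eLpNorm (φ n - u) (ENNReal.ofReal (critExp N)) volume) atTop (𝓝 0) ∧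
      Tendsto (fun n => eLpNorm (gradient (φ n) - G) 2 volume) atTop (𝓝 0) ∧
      Tendsto (fun n => eLpNorm ((fun x => ‖x‖⁻¹ * φ n x) - fun x => ‖x‖⁻¹ * u x) 2 volume)
        atTop (𝓝 0) := by
  obtain ⟨φ, hφ, hφu, hφG⟩ := h.exists_annular hN
  obtain ⟨hu, hG, -⟩ := h
  have hp1 := critExp_ofReal hN
  obtain ⟨m, hm, hae⟩ := (tendstoInMeasure_of_tendsto_eLpNorm (zero_lt_one.trans_le hp1).ne'
    (fun n => (hφ n).continuous.aestronglyMeasurable) hu.1 hφu).exists_seq_tendsto_ae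
  set C : ℝ≥0∞ := ENNReal.ofReal (((N : ℝ) - 2) / 2)⁻¹ with hC
  set V : ℕ → Space N → ℝ := fun n x => ‖x‖⁻¹ * φ n x with hV
  set U : Space N → ℝ := fun x => ‖x‖⁻¹ * u x with hU
  have hVm : ∀ n, MemLp (V n) 2 volume := fun n =>
    memLp_inv_norm_mul hN (hφ n).continuous (hφ n).hasCompactSupport
  have hUm : AEStronglyMeasurable U volume :=
    measurable_norm.inv.aestronglyMeasurable.mul hu.1
  have hbd : ∀ n, eLpNorm (V n - U) 2 volume ≤ C * eLpNorm (gradient (φ n) - G) 2 volume := by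
    intro n
    have hlim : ∀ᵐ x, Tendsto (fun k => (V n - V (m k)) x) atTop (𝓝 ((V n - U) x)) := by
      filter_upwards [hae] with x hx
      exact tendsto_const_nhds.sub (tendsto_const_nhds.mul hx)
    refine (Lp.eLpNorm_lim_le_liminf_eLpNorm (fun k => ((hVm n).sub (hVm (m k))).1) _ hlim).trans ?_
    have hle : ∀ k, eLpNorm (V n - V (m k)) 2 volume ≤
        C * (eLpNorm (gradient (φ n) - G) 2 volume + eLpNorm (gradient (φ (m k)) - G) 2 volume) := by
      intro k
      have h1 := ((hφ n).sub (hφ (m k))).eLpNorm_inv_norm_mul_le hN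
      have e1 : V n - V (m k) = fun x => ‖x‖⁻¹ * (φ n - φ (m k)) x := by
        funext x; simp [hV]; ring
      rw [e1]
      refine h1.trans ?_
      gcongr
      have e2 : gradient (φ n - φ (m k)) = (gradient (φ n) - G) - (gradient (φ (m k)) - G) := by
        rw [gradient_sub_of_differentiable (hφ n).differentiable (hφ (m k)).differentiable]; abel
      rw [e2]
      exact eLpNorm_sub_le ((measurable_gradient _).aestronglyMeasurable.sub hG.1)
        ((measurable_gradient _).aestronglyMeasurable.sub hG.1) (by norm_num)
    have hlim2 : Tendsto (fun k => C * (eLpNorm (gradient (φ n) - G) 2 volume +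
        eLpNorm (gradient (φ (m k)) - G) 2 volume)) atTop
        (𝓝 (C * eLpNorm (gradient (φ n) - G) 2 volume)) := by
      have h1 := (hφG.comp hm.tendsto_atTop).const_add (eLpNorm (gradient (φ n) - G) 2 volume)
      rw [add_zero] at h1
      exact ENNReal.Tendsto.const_mul h1 (Or.inr ENNReal.ofReal_ne_top)
    exact (liminf_le_liminf (Eventually.of_forall hle)).trans hlim2.liminf_eq.le
  have hconv : Tendsto (fun n => eLpNorm (V n - U) 2 volume) atTop (𝓝 0) := by
    have h1 := ENNReal.Tendsto.const_mul (a := C) hφG (Or.inr ENNReal.ofReal_ne_top)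
    rw [mul_zero] at h1
    exact tendsto_of_tendsto_of_tendsto_of_le_of_le tendsto_const_nhds h1 (fun _ => zero_le) hbd
  refine ⟨?_, φ, hφ, hφu, hφG, hconv⟩
  have hsub : MemLp (V 0 - U) 2 volume := by
    refine ⟨(hVm 0).1.sub hUm, (hbd 0).trans_lt ?_⟩
    exact ENNReal.mul_lt_top ENNReal.ofReal_lt_top ((hφ 0).memLp_gradient.sub hG).2
  have := (hVm 0).sub hsub
  rwa [sub_sub_cancel] at this

/-- Removes the choice hidden in `grad` and splits the integral, legitimate because both pieces are
integrable by Hardy. -/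
theorem HasH1Gradient.energy_eq (hN : 3 ≤ N) {u : Space N → ℝ} {G : Space N → Space N}
    (h : HasH1Gradient N u G) (γ : ℝ) :
    energy N γ u = (∫ x, ‖G x‖ ^ 2) - γ * ∫ x, ‖‖x‖⁻¹ * u x‖ ^ 2 := by
  have hu : MemH1 N u := ⟨G, h⟩
  have hae := hu.hasH1Gradient_grad.ae_unique hN h
  have hH := (h.exists_annular_hardy hN).1
  have i1 : Integrable (fun x => ‖G x‖ ^ 2) volume :=
    h.2.1.integrable_norm_pow two_ne_zero
  have i2 : Integrable (fun x => ‖‖x‖⁻¹ * u x‖ ^ 2) volume :=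
    hH.integrable_norm_pow two_ne_zero
  rw [← integral_const_mul, ← integral_sub i1 (i2.const_mul γ), energy]
  refine integral_congr_ae ?_
  filter_upwards [hae] with x hx
  rw [hx, Real.norm_eq_abs, sq_abs, mul_pow, inv_pow]
  ring

theorem HasH1Gradient.hardySobolev (hN : 3 ≤ N) {γ σ : ℝ} (hσ0 : 0 < σ) (hσ1 : σ ≤ 1)
    (hγ : γ = (((N : ℝ) - 2) / 2) ^ 2 * (1 - σ ^ 2)) {u : Space N → ℝ} {G : Space N → Space N}
    (h : HasH1Gradient N u G) :
    sharpConst N σ * critNorm N u ^ 2 ≤ energy N γ u := by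
  obtain ⟨hH, φ, hφ, hφu, hφG, hφH⟩ := h.exists_annular_hardy hN
  have hp1 := critExp_ofReal hN
  have hφp : ∀ n, MemLp (φ n) (ENNReal.ofReal (critExp N)) volume := fun n =>
    (hφ n).continuous.memLp_of_hasCompactSupport (hφ n).hasCompactSupport
  have hφ2 : ∀ n, MemLp (fun x => ‖x‖⁻¹ * φ n x) 2 volume := fun n =>
    memLp_inv_norm_mul hN (hφ n).continuous (hφ n).hasCompactSupport
  rw [h.energy_eq hN, integral_sq_norm_eq h.2.1, integral_sq_norm_eq hH, critNorm_eq hN h.1]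
  have t1 := tendsto_toReal_eLpNorm hp1 hφp h.1 hφu
  have t2 := tendsto_toReal_eLpNorm (by norm_num) (fun n => (hφ n).memLp_gradient) h.2.1 hφG
  have t3 := tendsto_toReal_eLpNorm (by norm_num) hφ2 hH hφH
  refine le_of_tendsto_of_tendsto' ((t1.pow 2).const_mul (sharpConst N σ))
    ((t2.pow 2).sub ((t3.pow 2).const_mul γ)) fun n => ?_
  have h1 := hardySobolev_annular hN hσ0 hσ1 hγ (hφ n)
  rw [← critNorm_sq hN, critNorm_eq hN (hφp n), integral_sq_norm_eq (hφ n).memLp_gradient] at h1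
  rw [← integral_sq_norm_eq (hφ2 n)]
  refine h1.trans (le_of_eq ?_)
  congr 2
  refine integral_congr_ae (Eventually.of_forall fun x => ?_)
  simp only [Real.norm_eq_abs, sq_abs]
  rw [mul_pow, inv_pow]
  ring

theorem HasH1Gradient.sub (hN : 3 ≤ N) {u v : Space N → ℝ} {G H : Space N → Space N}
    (hu : HasH1Gradient N u G) (hv : HasH1Gradient N v H) :
    HasH1Gradient N (u - v) (G - H) := by
  obtain ⟨hu1, hG, φ, hφ, hφu, hφG⟩ := hu
  obtain ⟨hv1, hH, ψ, hψ, hψv, hψH⟩ := hv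
  have hd : ∀ {f : Space N → ℝ}, ContDiff ℝ ∞ f → Differentiable ℝ f :=
    fun hf => hf.differentiable (by simp)
  refine ⟨hu1.sub hv1, hG.sub hH, fun n => φ n - ψ n,
    fun n => ⟨(hφ n).1.sub (hψ n).1, (hφ n).2.sub (hψ n).2⟩, ?_, ?_⟩
  · have hs := hφu.add hψv
    rw [add_zero] at hs
    refine tendsto_of_tendsto_of_tendsto_of_le_of_le tendsto_const_nhds hs
      (fun _ => zero_le) (fun n => ?_)
    simp only
    rw [show φ n - ψ n - (u - v) = (φ n - u) - (ψ n - v) by abel]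
    exact eLpNorm_sub_le ((hφ n).1.continuous.aestronglyMeasurable.sub hu1.1)
      ((hψ n).1.continuous.aestronglyMeasurable.sub hv1.1) (critExp_ofReal hN)
  · have hs := hφG.add hψH
    rw [add_zero] at hs
    refine tendsto_of_tendsto_of_tendsto_of_le_of_le tendsto_const_nhds hs
      (fun _ => zero_le) (fun n => ?_)
    simp only
    rw [gradient_sub_of_differentiable (hd (hφ n).1) (hd (hψ n).1),
      show gradient (φ n) - gradient (ψ n) - (G - H) = (gradient (φ n) - G) - (gradient (ψ n) - H)
        by abel]
    exact eLpNorm_sub_le ((measurable_gradient _).aestronglyMeasurable.sub hG.1)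
      ((measurable_gradient _).aestronglyMeasurable.sub hH.1) (by norm_num)

/-- Functions smooth away from the origin with the natural integrability belong to `H¹`. -/
theorem hasH1Gradient_of_contDiffAt (hN : 3 ≤ N) {u : Space N → ℝ}
    (hu : ∀ x, x ≠ 0 → ContDiffAt ℝ ∞ u x) (hup : MemLp u (ENNReal.ofReal (critExp N)) volume)
    (hu2 : MemLp (gradient u) 2 volume) (huH : MemLp (fun x => ‖x‖⁻¹ * u x) 2 volume) :
    HasH1Gradient N u (gradient u) := by
  obtain ⟨φ, hφ, h1, h2⟩ := exists_annular_approx hN hu hup hu2 huH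
  exact ⟨hup, hu2, φ, fun n => ⟨(hφ n).contDiff, (hφ n).hasCompactSupport⟩, h1, h2⟩

variable {N : ℕ}

/-! ### Radial functions in Emden–Fowler coordinates -/

/-- The surface area of the unit sphere. -/
def sphereConst (N : ℕ) : ℝ := N * volume.real (Metric.ball (0 : Space N) 1)

theorem sphereConst_pos (hN : 3 ≤ N) : 0 < sphereConst N := by
  have : 0 < volume.real (Metric.ball (0 : Space N) 1) :=
    ENNReal.toReal_pos (Metric.measure_ball_pos _ _ one_pos).ne' measure_ball_lt_top.ne
  have h3 : (0 : ℝ) < N := by exact_mod_cast (by omega : 0 < N)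
  exact mul_pos h3 this

theorem hasDerivAt_exp_div (σ t : ℝ) :
    HasDerivAt (fun t => Real.exp (t / σ)) (Real.exp (t / σ) / σ) t := by
  refine ((hasDerivAt_id t).div_const σ).exp.congr_deriv ?_
  simp [div_eq_mul_inv]

theorem image_exp_div {σ : ℝ} (hσ : 0 < σ) :
    (fun t => Real.exp (t / σ)) '' univ = Ioi 0 := by
  ext r
  constructor
  · rintro ⟨t, -, rfl⟩; exact Real.exp_pos _
  · intro hr
    refine ⟨σ * Real.log r, mem_univ _, ?_⟩
    simp only
    rw [mul_div_cancel_left₀ _ hσ.ne', Real.exp_log hr]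

theorem injOn_exp_div {σ : ℝ} (hσ : 0 < σ) : InjOn (fun t => Real.exp (t / σ)) univ := by
  intro s _ t _ h
  have := Real.exp_injective h
  field_simp at this
  exact this

theorem pow_mul_rpow_neg (hN : 3 ≤ N) {r : ℝ} (hr : 0 < r) :
    r ^ (N - 1) * r ^ (-(N : ℝ)) = r⁻¹ := by
  rw [← Real.rpow_natCast, ← Real.rpow_add hr, Nat.cast_sub (by omega), ← Real.rpow_neg_one]
  congr 1; push_cast; ring

theorem abs_exp_div_smul {σ : ℝ} (hσ : 0 < σ) (g : ℝ → ℝ) (t : ℝ) :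
    |Real.exp (t / σ) / σ| • ((Real.exp (t / σ))⁻¹ * g (σ * Real.log (Real.exp (t / σ)))) =
      σ⁻¹ * g t := by
  rw [Real.log_exp, mul_div_cancel₀ _ hσ.ne', abs_of_pos (by positivity), smul_eq_mul]
  have := (Real.exp_pos (t / σ)).ne'
  field_simp

/-- With r = e^{t/σ} the radial measure r^{N-1}r^{-N}dr = dr/r becomes dt/σ. -/
theorem integral_rpow_neg_mul_log (hN : 3 ≤ N) {σ : ℝ} (hσ : 0 < σ) (g : ℝ → ℝ) :
    ∫ x : Space N, ‖x‖ ^ (-(N : ℝ)) * g (σ * Real.log ‖x‖) = sphereConst N / σ * ∫ t, g t := by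
  have := nontrivial_space hN
  rw [integral_fun_norm_addHaar volume (fun r : ℝ => r ^ (-(N : ℝ)) * g (σ * Real.log r))]
  have e1 : ∫ r in Ioi (0 : ℝ), r ^ (Module.finrank ℝ (Space N) - 1) •
      (r ^ (-(N : ℝ)) * g (σ * Real.log r)) = ∫ r in Ioi (0 : ℝ), r⁻¹ * g (σ * Real.log r) := by
    refine setIntegral_congr_fun measurableSet_Ioi fun r hr => ?_
    simp only [finrank_euclideanSpace, Fintype.card_fin, smul_eq_mul]
    rw [← mul_assoc, pow_mul_rpow_neg hN hr]
  rw [e1, ← image_exp_div hσ, integral_image_eq_integral_abs_deriv_smul MeasurableSet.univ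
    (fun t _ => (hasDerivAt_exp_div σ t).hasDerivWithinAt) (injOn_exp_div hσ)]
  simp only [abs_exp_div_smul hσ, setIntegral_univ, integral_const_mul, finrank_euclideanSpace,
    Fintype.card_fin, smul_eq_mul, nsmul_eq_mul, sphereConst]
  field_simp

theorem integrable_rpow_neg_mul_log (hN : 3 ≤ N) {σ : ℝ} (hσ : 0 < σ) {g : ℝ → ℝ}
    (hg : Integrable g) : Integrable fun x : Space N => ‖x‖ ^ (-(N : ℝ)) * g (σ * Real.log ‖x‖) := by
  have := nontrivial_space hN
  rw [integrable_fun_norm_addHaar volume (f := fun r : ℝ => r ^ (-(N : ℝ)) * g (σ * Real.log r))]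
  have h1 : IntegrableOn (fun r : ℝ => r⁻¹ * g (σ * Real.log r)) (Ioi 0) := by
    rw [← image_exp_div hσ, integrableOn_image_iff_integrableOn_abs_deriv_smul MeasurableSet.univ
      (fun t _ => (hasDerivAt_exp_div σ t).hasDerivWithinAt) (injOn_exp_div hσ)]
    simp only [abs_exp_div_smul hσ]
    exact (hg.const_mul _).integrableOn
  refine h1.congr_fun (fun r hr => ?_) measurableSet_Ioi
  simp only [finrank_euclideanSpace, Fintype.card_fin, smul_eq_mul]
  rw [← mul_assoc, pow_mul_rpow_neg hN hr]

theorem integrable_exp_neg_mul_abs {a : ℝ} (ha : 0 < a) :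
    Integrable fun t : ℝ => Real.exp (-(a * |t|)) := by
  rw [← integrableOn_univ, ← Iic_union_Ioi (a := (0 : ℝ)), integrableOn_union]
  constructor
  · refine (integrableOn_exp_mul_Iic ha 0).congr_fun (fun t ht => ?_) measurableSet_Iic
    simp only
    rw [abs_of_nonpos ht]; congr 1; ring
  · refine (exp_neg_integrableOn_Ioi 0 ha).congr_fun (fun t ht => ?_) measurableSet_Ioi
    have ht' : (0 : ℝ) < t := ht
    simp only
    rw [abs_of_pos ht']; congr 1; ring

/-- Smooth functions on the line which decay, with their derivative, like `e^{-μ|t|}`. -/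
structure IsEmden (μ : ℝ) (w : ℝ → ℝ) : Prop where
  contDiff : ContDiff ℝ ∞ w
  decay : ∃ C : ℝ, ∀ t, |w t| ≤ C * Real.exp (-(μ * |t|)) ∧ |deriv w t| ≤ C * Real.exp (-(μ * |t|))

namespace IsEmden

variable {μ : ℝ} {v w : ℝ → ℝ}

theorem hasDerivAt (hw : IsEmden μ w) (t : ℝ) : HasDerivAt w (deriv w t) t :=
  (hw.contDiff.differentiable (by simp) t).hasDerivAt

theorem continuous (hw : IsEmden μ w) : Continuous w := hw.contDiff.continuous

theorem continuous_deriv (hw : IsEmden μ w) : Continuous (deriv w) :=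
  hw.contDiff.continuous_deriv (by simp)

theorem add (hv : IsEmden μ v) (hw : IsEmden μ w) : IsEmden μ (v + w) := by
  obtain ⟨C, hC⟩ := hv.decay
  obtain ⟨D, hD⟩ := hw.decay
  refine ⟨hv.contDiff.add hw.contDiff, C + D, fun t => ?_⟩
  rw [((hv.hasDerivAt t).add (hw.hasDerivAt t)).deriv, add_mul]
  exact ⟨(abs_add_le _ _).trans (add_le_add (hC t).1 (hD t).1),
    (abs_add_le _ _).trans (add_le_add (hC t).2 (hD t).2)⟩

theorem const_mul (hw : IsEmden μ w) (c : ℝ) : IsEmden μ (fun t => c * w t) := by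
  obtain ⟨D, hD⟩ := hw.decay
  refine ⟨contDiff_const.mul hw.contDiff, |c| * D, fun t => ?_⟩
  rw [((hw.hasDerivAt t).const_mul c).deriv, abs_mul, abs_mul, mul_assoc]
  exact ⟨mul_le_mul_of_nonneg_left (hD t).1 (abs_nonneg _),
    mul_le_mul_of_nonneg_left (hD t).2 (abs_nonneg _)⟩

theorem comp_sub (hμ : 0 < μ) (hw : IsEmden μ w) (s : ℝ) : IsEmden μ (fun t => w (t - s)) := by
  obtain ⟨D, hD⟩ := hw.decay
  have hD0 : 0 ≤ D := by
    by_contra h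
    have := (abs_nonneg _).trans (hD 0).1
    simp at this
    linarith
  refine ⟨hw.contDiff.comp (contDiff_id.sub contDiff_const), D * Real.exp (μ * |s|), fun t => ?_⟩
  have h1 : D * Real.exp (-(μ * |t - s|)) ≤ D * Real.exp (μ * |s|) * Real.exp (-(μ * |t|)) := by
    rw [mul_assoc, ← Real.exp_add]
    have h2 : |t| ≤ |t - s| + |s| := by simpa using abs_add_le (t - s) s
    gcongr
    nlinarith
  rw [deriv_comp_sub_const]
  exact ⟨(hD (t - s)).1.trans h1, (hD (t - s)).2.trans h1⟩

theorem integrable_of_le {f : ℝ → ℝ} (hf : Continuous f) {C a : ℝ} (ha : 0 < a)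
    (h : ∀ t, |f t| ≤ C * Real.exp (-(a * |t|))) : Integrable f :=
  ((integrable_exp_neg_mul_abs ha).const_mul C).mono' hf.aestronglyMeasurable
    (Eventually.of_forall h)

theorem mul_exp_le {x y C D : ℝ} {t : ℝ} (hx : |x| ≤ C * Real.exp (-(μ * |t|)))
    (hy : |y| ≤ D * Real.exp (-(μ * |t|))) : |x * y| ≤ (C * D) * Real.exp (-((2 * μ) * |t|)) := by
  rw [abs_mul]
  refine (mul_le_mul hx hy (abs_nonneg _) ((abs_nonneg _).trans hx)).trans (le_of_eq ?_)
  rw [show -((2 * μ) * |t|) = -(μ * |t|) + -(μ * |t|) by ring, Real.exp_add]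
  ring

theorem integrable_mul (hμ : 0 < μ) (hv : IsEmden μ v) (hw : IsEmden μ w) :
    Integrable fun t => v t * w t := by
  obtain ⟨C, hC⟩ := hv.decay
  obtain ⟨D, hD⟩ := hw.decay
  exact integrable_of_le (hv.continuous.mul hw.continuous) (by positivity : 0 < 2 * μ)
    fun t => mul_exp_le (hC t).1 (hD t).1

theorem integrable_mul_deriv (hμ : 0 < μ) (hv : IsEmden μ v) (hw : IsEmden μ w) :
    Integrable fun t => v t * deriv w t := by
  obtain ⟨C, hC⟩ := hv.decay
  obtain ⟨D, hD⟩ := hw.decay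
  exact integrable_of_le (hv.continuous.mul hw.continuous_deriv) (by positivity : 0 < 2 * μ)
    fun t => mul_exp_le (hC t).1 (hD t).2

theorem integrable_deriv_mul_deriv (hμ : 0 < μ) (hv : IsEmden μ v) (hw : IsEmden μ w) :
    Integrable fun t => deriv v t * deriv w t := by
  obtain ⟨C, hC⟩ := hv.decay
  obtain ⟨D, hD⟩ := hw.decay
  exact integrable_of_le (hv.continuous_deriv.mul hw.continuous_deriv) (by positivity : 0 < 2 * μ)
    fun t => mul_exp_le (hC t).2 (hD t).2

theorem integrable_abs_rpow (hμ : 0 < μ) (hw : IsEmden μ w) {p : ℝ} (hp : 0 < p) :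
    Integrable fun t => |w t| ^ p := by
  obtain ⟨C, hC⟩ := hw.decay
  refine integrable_of_le (hw.continuous.abs.rpow_const fun _ => Or.inr hp.le)
    (C := C ^ p) (by positivity : 0 < μ * p) fun t => ?_
  rw [abs_of_nonneg (by positivity)]
  have hC0 : 0 ≤ C := by
    have := (abs_nonneg _).trans (hC 0).1
    simpa using this
  calc _ ≤ (C * Real.exp (-(μ * |t|))) ^ p := Real.rpow_le_rpow (abs_nonneg _) (hC t).1 hp.le
    _ = _ := by
      rw [Real.mul_rpow hC0 (Real.exp_pos _).le, ← Real.exp_mul]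
      congr 2; ring

theorem integral_mul_deriv_self (hμ : 0 < μ) (hw : IsEmden μ w) :
    ∫ t, w t * deriv w t = 0 := by
  have hd : ∀ t, HasDerivAt (fun t => w t * w t / 2) (w t * deriv w t) t := fun t =>
    (((hw.hasDerivAt t).mul (hw.hasDerivAt t)).div_const 2).congr_deriv (by ring)
  exact integral_eq_zero_of_hasDerivAt_of_integrable hd (hw.integrable_mul_deriv hμ hw)
    ((hw.integrable_mul hμ hw).div_const 2)

end IsEmden

/-- The radial function on `ℝ^N` with Emden–Fowler profile `w`. -/
def emden (N : ℕ) (σ : ℝ) (w : ℝ → ℝ) (x : Space N) : ℝ :=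
  ‖x‖ ^ (-(((N : ℝ) - 2) / 2)) * w (σ * Real.log ‖x‖)

/-- The quadratic form `∫ (w'² + μ² w²)` on the line. -/
def cylEnergy (μ : ℝ) (w : ℝ → ℝ) : ℝ := ∫ t, (deriv w t ^ 2 + μ ^ 2 * w t ^ 2)

theorem measurable_emden {σ : ℝ} {w : ℝ → ℝ} (hw : Continuous w) : Measurable (emden N σ w) :=
  (measurable_norm.pow_const _).mul
    (hw.measurable.comp ((Real.measurable_log.comp measurable_norm).const_mul σ))

theorem contDiffAt_emden {σ : ℝ} {w : ℝ → ℝ} (hw : ContDiff ℝ ∞ w) {x : Space N} (hx : x ≠ 0) :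
    ContDiffAt ℝ ∞ (emden N σ w) x :=
  (contDiffAt_norm_rpow hx _).mul (hw.contDiffAt.comp x
    (contDiffAt_const.mul ((contDiffAt_norm ℝ hx).log (norm_ne_zero_iff.mpr hx))))

theorem norm_gradient_emden_sq {σ : ℝ} {w : ℝ → ℝ} (hw : Differentiable ℝ w) {x : Space N}
    (hx : x ≠ 0) :
    ‖gradient (emden N σ w) x‖ ^ 2 = ‖x‖ ^ (-(N : ℝ)) *
      (σ * deriv w (σ * Real.log ‖x‖) - ((N : ℝ) - 2) / 2 * w (σ * Real.log ‖x‖)) ^ 2 := by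
  have hx' : 0 < ‖x‖ := norm_pos_iff.mpr hx
  set μ : ℝ := ((N : ℝ) - 2) / 2 with hμ
  have h1 : HasFDerivAt (fun y : Space N => w (σ * Real.log ‖y‖)) _ x :=
    (hw (σ * Real.log ‖x‖)).hasDerivAt.comp_hasFDerivAt x ((hasFDerivAt_log_norm hx).const_mul σ)
  have h2 := (hasFDerivAt_norm_rpow hx (-μ)).mul h1
  have h3 : fderiv ℝ (emden N σ w) x =
      (‖x‖ ^ (-μ) * (‖x‖ ^ 2)⁻¹ *
        (σ * deriv w (σ * Real.log ‖x‖) - μ * w (σ * Real.log ‖x‖))) • innerSL ℝ x := by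
    refine HasFDerivAt.fderiv (h2.congr_fderiv ?_)
    rw [smul_smul, smul_smul, smul_smul, smul_smul, ← add_smul]
    congr 1
    rw [Real.rpow_sub hx', Real.rpow_two]
    field_simp
    ring
  rw [norm_gradient_eq, h3, norm_smul, innerSL_apply_norm, mul_pow, Real.norm_eq_abs, sq_abs,
    mul_pow, mul_pow]
  have e1 : (‖x‖ ^ (-μ)) ^ 2 * ((‖x‖ ^ 2)⁻¹) ^ 2 * ‖x‖ ^ 2 = ‖x‖ ^ (-(N : ℝ)) := by
    rw [← Real.rpow_natCast (‖x‖ ^ (-μ)), ← Real.rpow_mul hx'.le]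
    rw [mul_assoc, show ((‖x‖ ^ 2)⁻¹) ^ 2 * ‖x‖ ^ 2 = ‖x‖ ^ (-2 : ℝ) by
      rw [Real.rpow_neg hx'.le, Real.rpow_two]; field_simp, ← Real.rpow_add hx']
    congr 1; rw [hμ]; push_cast; ring
  rw [← e1]
  ring

theorem abs_emden_rpow (hN : 3 ≤ N) (σ : ℝ) (w : ℝ → ℝ) {x : Space N} (hx : x ≠ 0) :
    |emden N σ w x| ^ critExp N = ‖x‖ ^ (-(N : ℝ)) * |w (σ * Real.log ‖x‖)| ^ critExp N := by
  have hx' : 0 < ‖x‖ := norm_pos_iff.mpr hx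
  have h3 : (3 : ℝ) ≤ N := by exact_mod_cast hN
  have hN2 : (N : ℝ) - 2 ≠ 0 := by linarith
  rw [emden, abs_mul, abs_of_nonneg (by positivity),
    Real.mul_rpow (by positivity) (abs_nonneg _), ← Real.rpow_mul hx'.le, critExp]
  congr 2
  field_simp

theorem inv_norm_mul_emden_sq (σ : ℝ) (w : ℝ → ℝ) {x : Space N} (hx : x ≠ 0) :
    (‖x‖⁻¹ * emden N σ w x) ^ 2 = ‖x‖ ^ (-(N : ℝ)) * w (σ * Real.log ‖x‖) ^ 2 := by
  have hx' : 0 < ‖x‖ := norm_pos_iff.mpr hx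
  have e1 : (‖x‖⁻¹) ^ 2 * (‖x‖ ^ (-(((N : ℝ) - 2) / 2))) ^ 2 = ‖x‖ ^ (-(N : ℝ)) := by
    rw [← Real.rpow_natCast (‖x‖ ^ (-(((N : ℝ) - 2) / 2))), ← Real.rpow_mul hx'.le,
      ← Real.rpow_neg_one, ← Real.rpow_natCast (‖x‖ ^ (-1 : ℝ)), ← Real.rpow_mul hx'.le,
      ← Real.rpow_add hx']
    congr 1; push_cast; ring
  rw [← e1, emden]
  ring

theorem integral_abs_emden_rpow (hN : 3 ≤ N) {σ : ℝ} (hσ : 0 < σ) (w : ℝ → ℝ) :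
    ∫ x, |emden N σ w x| ^ critExp N = sphereConst N / σ * ∫ t, |w t| ^ critExp N := by
  rw [← integral_rpow_neg_mul_log hN hσ]
  refine integral_congr_ae ?_
  filter_upwards [ae_ne_zero hN] with x hx
  exact abs_emden_rpow hN σ w hx

theorem IsEmden.hasH1Gradient (hN : 3 ≤ N) {σ : ℝ} (hσ : 0 < σ) {w : ℝ → ℝ}
    (hw : IsEmden (((N : ℝ) - 2) / 2) w) :
    HasH1Gradient N (emden N σ w) (gradient (emden N σ w)) := by
  have h3 : (3 : ℝ) ≤ N := by exact_mod_cast hN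
  have hμ : 0 < ((N : ℝ) - 2) / 2 := by linarith
  have hp1 := one_le_critExp hN
  have hm : Measurable (emden N σ w) := measurable_emden hw.continuous
  refine hasH1Gradient_of_contDiffAt hN (fun x hx => contDiffAt_emden hw.contDiff hx) ?_ ?_ ?_
  · rw [← integrable_norm_rpow_iff hm.aestronglyMeasurable (by simpa using by linarith)
      ENNReal.ofReal_ne_top, ENNReal.toReal_ofReal (by linarith)]
    refine (integrable_rpow_neg_mul_log hN hσ
      (hw.integrable_abs_rpow hμ (by linarith : 0 < critExp N))).congr ?_
    filter_upwards [ae_ne_zero hN] with x hx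
    exact (abs_emden_rpow hN σ w hx).symm
  · rw [memLp_two_iff_integrable_sq_norm (measurable_gradient _).aestronglyMeasurable]
    have hi : Integrable fun t => (σ * deriv w t - ((N : ℝ) - 2) / 2 * w t) ^ 2 := by
      have := (((hw.integrable_deriv_mul_deriv hμ hw).const_mul (σ ^ 2)).sub
        ((hw.integrable_mul_deriv hμ hw).const_mul (2 * σ * (((N : ℝ) - 2) / 2)))).add
        ((hw.integrable_mul hμ hw).const_mul ((((N : ℝ) - 2) / 2) ^ 2))
      refine this.congr (Eventually.of_forall fun t => ?_)
      simp only [Pi.add_apply, Pi.sub_apply]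
      ring
    refine (integrable_rpow_neg_mul_log hN hσ hi).congr ?_
    filter_upwards [ae_ne_zero hN] with x hx
    exact (norm_gradient_emden_sq (hw.contDiff.differentiable (by simp)) hx).symm
  · have hm' : AEStronglyMeasurable (fun x : Space N => ‖x‖⁻¹ * emden N σ w x) volume :=
      (measurable_norm.inv.mul hm).aestronglyMeasurable
    rw [memLp_two_iff_integrable_sq hm']
    have hi : Integrable fun t => w t ^ 2 := by
      simpa only [sq] using hw.integrable_mul hμ hw
    refine (integrable_rpow_neg_mul_log hN hσ hi).congr ?_
    filter_upwards [ae_ne_zero hN] with x hx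
    exact (inv_norm_mul_emden_sq σ w hx).symm

/-- The cross term w w' integrates to zero and μ² - γ = μ²σ², so both remaining terms acquire σ²
against the prefactor 1/σ. -/
theorem IsEmden.energy_eq (hN : 3 ≤ N) {σ γ : ℝ} (hσ : 0 < σ)
    (hγ : γ = (((N : ℝ) - 2) / 2) ^ 2 * (1 - σ ^ 2)) {w : ℝ → ℝ}
    (hw : IsEmden (((N : ℝ) - 2) / 2) w) :
    energy N γ (emden N σ w) = sphereConst N * σ * cylEnergy (((N : ℝ) - 2) / 2) w := by
  have h3 : (3 : ℝ) ≤ N := by exact_mod_cast hN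
  have hμ : 0 < ((N : ℝ) - 2) / 2 := by linarith
  rw [(hw.hasH1Gradient hN hσ).energy_eq hN]
  set μ : ℝ := ((N : ℝ) - 2) / 2 with hμdef
  have e1 : ∫ x, ‖gradient (emden N σ w) x‖ ^ 2 =
      sphereConst N / σ * ∫ t, (σ * deriv w t - μ * w t) ^ 2 := by
    rw [← integral_rpow_neg_mul_log hN hσ]
    refine integral_congr_ae ?_
    filter_upwards [ae_ne_zero hN] with x hx
    exact norm_gradient_emden_sq (hw.contDiff.differentiable (by simp)) hx
  have e2 : ∫ x, ‖‖x‖⁻¹ * emden N σ w x‖ ^ 2 = sphereConst N / σ * ∫ t, w t * w t := by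
    rw [← integral_rpow_neg_mul_log hN hσ]
    refine integral_congr_ae ?_
    filter_upwards [ae_ne_zero hN] with x hx
    rw [Real.norm_eq_abs, sq_abs, inv_norm_mul_emden_sq σ w hx, sq]
  have i1 := hw.integrable_deriv_mul_deriv hμ hw
  have i2 := hw.integrable_mul_deriv hμ hw
  have i3 := hw.integrable_mul hμ hw
  have e3 : ∫ t, (σ * deriv w t - μ * w t) ^ 2 =
      σ ^ 2 * (∫ t, deriv w t * deriv w t) + μ ^ 2 * ∫ t, w t * w t := by
    have : ∀ t, (σ * deriv w t - μ * w t) ^ 2 = σ ^ 2 * (deriv w t * deriv w t) +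
        (μ ^ 2 * (w t * w t) - 2 * σ * μ * (w t * deriv w t)) := fun t => by ring
    have i4 : Integrable fun t => μ ^ 2 * (w t * w t) - 2 * σ * μ * (w t * deriv w t) :=
      (i3.const_mul _).sub (i2.const_mul _)
    simp only [this]
    rw [integral_add (i1.const_mul _) i4,
      integral_sub (i3.const_mul _) (i2.const_mul _), integral_const_mul, integral_const_mul,
      integral_const_mul, hw.integral_mul_deriv_self hμ]
    ring
  have e4 : cylEnergy μ w = (∫ t, deriv w t * deriv w t) + μ ^ 2 * ∫ t, w t * w t := by
    rw [cylEnergy, ← integral_const_mul, ← integral_add i1 (i3.const_mul _)]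
    refine integral_congr_ae (Eventually.of_forall fun t => ?_)
    simp only
    ring
  rw [e1, e2, e3, e4, hγ]
  field_simp
  ring

/-! ### The one-dimensional bubble -/

/-- The bubble on the line. -/
def lineBubble (μ t : ℝ) : ℝ := (2 * Real.cosh t) ^ (-μ)

section lineBubble

variable {μ : ℝ}

theorem two_cosh_pos (t : ℝ) : 0 < 2 * Real.cosh t := by
  have := Real.cosh_pos t; positivity

theorem exp_abs_le_two_cosh (t : ℝ) : Real.exp |t| ≤ 2 * Real.cosh t := by
  rw [← Real.cosh_abs, Real.cosh_eq]
  linarith [Real.exp_pos (-|t|)]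

theorem two_cosh_le (t s : ℝ) : 2 * Real.cosh (t - s) ≤ Real.exp |s| * (2 * Real.cosh t) := by
  rw [Real.cosh_eq, Real.cosh_eq]
  have h1 : Real.exp (t - s) ≤ Real.exp |s| * Real.exp t := by
    rw [← Real.exp_add]; exact Real.exp_le_exp.mpr (by linarith [neg_abs_le s])
  have h2 : Real.exp (-(t - s)) ≤ Real.exp |s| * Real.exp (-t) := by
    rw [← Real.exp_add]; exact Real.exp_le_exp.mpr (by linarith [le_abs_self s])
  linarith

theorem lineBubble_pos (μ t : ℝ) : 0 < lineBubble μ t := Real.rpow_pos_of_pos (two_cosh_pos t) _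

theorem lineBubble_le_exp (hμ : 0 ≤ μ) (t : ℝ) : lineBubble μ t ≤ Real.exp (-(μ * |t|)) := by
  have h := Real.rpow_le_rpow_of_nonpos (Real.exp_pos |t|) (exp_abs_le_two_cosh t)
    (neg_nonpos.mpr hμ)
  refine h.trans (le_of_eq ?_)
  rw [← Real.exp_mul]; congr 1; ring

/-- A Harnack inequality, from cosh(t-s) ≤ e^{|s|} cosh t. Integrated, it compares interactions at
different distances. -/
theorem exp_mul_lineBubble_le (hμ : 0 ≤ μ) (t s : ℝ) :
    Real.exp (-(μ * |s|)) * lineBubble μ t ≤ lineBubble μ (t - s) := by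
  have h := Real.rpow_le_rpow_of_nonpos (two_cosh_pos _) (two_cosh_le t s) (neg_nonpos.mpr hμ)
  refine le_trans (le_of_eq ?_) h
  rw [Real.mul_rpow (Real.exp_pos _).le (two_cosh_pos t).le, ← Real.exp_mul, lineBubble]
  congr 2; ring

theorem lineBubble_le_of_abs_le (hμ : 0 ≤ μ) {s t : ℝ} (h : |s| ≤ |t|) :
    lineBubble μ t ≤ lineBubble μ s :=
  Real.rpow_le_rpow_of_nonpos (two_cosh_pos _)
    (mul_le_mul_of_nonneg_left (Real.cosh_le_cosh.mpr h) zero_le_two) (neg_nonpos.mpr hμ)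

theorem hasDerivAt_lineBubble (μ t : ℝ) :
    HasDerivAt (lineBubble μ) (-(2 * μ) * (Real.sinh t * lineBubble (μ + 1) t)) t := by
  have h := ((Real.hasDerivAt_cosh t).const_mul 2).rpow_const (p := -μ)
    (Or.inl (two_cosh_pos t).ne')
  refine h.congr_deriv ?_
  rw [lineBubble, show -(μ + 1) = -μ - 1 by ring]
  ring

theorem deriv_lineBubble (μ : ℝ) :
    deriv (lineBubble μ) = fun t => -(2 * μ) * (Real.sinh t * lineBubble (μ + 1) t) :=
  funext fun t => (hasDerivAt_lineBubble μ t).deriv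

theorem lineBubble_add (μ ν t : ℝ) : lineBubble (μ + ν) t = lineBubble μ t * lineBubble ν t := by
  rw [lineBubble, neg_add, Real.rpow_add (two_cosh_pos t)]; rfl

theorem lineBubble_rpow (μ r t : ℝ) : lineBubble μ t ^ r = lineBubble (μ * r) t := by
  rw [lineBubble, ← Real.rpow_mul (two_cosh_pos t).le, lineBubble]; congr 1; ring

theorem cosh_mul_lineBubble (μ t : ℝ) :
    2 * Real.cosh t * lineBubble (μ + 1) t = lineBubble μ t := by
  rw [lineBubble_add, lineBubble, lineBubble, Real.rpow_neg_one]
  have := (two_cosh_pos t).ne'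
  field_simp

/-- The Emden equation `-b'' + μ² b = 4μ(μ+1) b^{1+2/μ}`. -/
theorem hasDerivAt_deriv_lineBubble (μ t : ℝ) :
    HasDerivAt (deriv (lineBubble μ))
      (μ ^ 2 * lineBubble μ t - 4 * μ * (μ + 1) * lineBubble (μ + 2) t) t := by
  rw [deriv_lineBubble]
  have h := ((Real.hasDerivAt_sinh t).mul (hasDerivAt_lineBubble (μ + 1) t)).const_mul (-(2 * μ))
  refine h.congr_deriv ?_
  have e1 := cosh_mul_lineBubble μ t
  have e2 := cosh_mul_lineBubble (μ + 1) t
  have e3 := Real.cosh_sq' t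
  rw [show μ + 1 + 1 = μ + 2 by ring] at *
  rw [← e1, ← e2]
  linear_combination (-4 * μ * (μ + 1) * lineBubble (μ + 2) t) * e3

theorem contDiff_lineBubble (μ : ℝ) : ContDiff ℝ ∞ (lineBubble μ) :=
  (contDiff_const.mul Real.contDiff_cosh).rpow_const_of_ne fun t => (two_cosh_pos t).ne'

theorem continuous_lineBubble (μ : ℝ) : Continuous (lineBubble μ) :=
  (contDiff_lineBubble μ).continuous

theorem isEmden_lineBubble (hμ : 0 < μ) : IsEmden μ (lineBubble μ) := by
  refine ⟨contDiff_lineBubble μ, 1 + μ, fun t => ⟨?_, ?_⟩⟩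
  · rw [abs_of_pos (lineBubble_pos μ t)]
    have h := lineBubble_le_exp hμ.le t
    nlinarith [Real.exp_pos (-(μ * |t|))]
  · rw [deriv_lineBubble]
    have hs : |Real.sinh t| ≤ Real.cosh t := by
      rw [abs_le, Real.sinh_eq, Real.cosh_eq]
      constructor <;> linarith [Real.exp_pos t, Real.exp_pos (-t)]
    have h := lineBubble_le_exp hμ.le t
    simp only [abs_mul, abs_neg, abs_two, abs_of_pos hμ, abs_of_pos (lineBubble_pos _ t)]
    have h2 : 2 * μ * (|Real.sinh t| * lineBubble (μ + 1) t) ≤ μ * lineBubble μ t := by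
      rw [← cosh_mul_lineBubble μ t]
      have := mul_le_mul_of_nonneg_right hs (lineBubble_pos (μ + 1) t).le
      nlinarith
    nlinarith [Real.exp_pos (-(μ * |t|))]

theorem integrable_lineBubble (hμ : 0 < μ) : Integrable (lineBubble μ) :=
  IsEmden.integrable_of_le (continuous_lineBubble μ) hμ (C := 1) fun t => by
    rw [abs_of_pos (lineBubble_pos μ t), one_mul]; exact lineBubble_le_exp hμ.le t

end lineBubble

/-! ### The bilinear form on the line -/

/-- The bilinear form associated with `cylEnergy`. -/
def cylForm (μ : ℝ) (v w : ℝ → ℝ) : ℝ := ∫ t, (deriv v t * deriv w t + μ ^ 2 * (v t * w t))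

section cylForm

variable {μ : ℝ} {u v w : ℝ → ℝ}

theorem cylEnergy_eq_cylForm (μ : ℝ) (w : ℝ → ℝ) : cylEnergy μ w = cylForm μ w w := by
  simp only [cylEnergy, cylForm, sq]

theorem cylForm_comm (μ : ℝ) (v w : ℝ → ℝ) : cylForm μ v w = cylForm μ w v := by
  simp only [cylForm, mul_comm]

theorem IsEmden.integrable_cylForm (hμ : 0 < μ) (hv : IsEmden μ v) (hw : IsEmden μ w) :
    Integrable fun t => deriv v t * deriv w t + μ ^ 2 * (v t * w t) :=
  (hv.integrable_deriv_mul_deriv hμ hw).add ((hv.integrable_mul hμ hw).const_mul _)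

theorem cylForm_add_left (hμ : 0 < μ) (hu : IsEmden μ u) (hv : IsEmden μ v) (hw : IsEmden μ w) :
    cylForm μ (u + v) w = cylForm μ u w + cylForm μ v w := by
  rw [cylForm, cylForm, cylForm,
    ← integral_add (hu.integrable_cylForm hμ hw) (hv.integrable_cylForm hμ hw)]
  refine integral_congr_ae (Eventually.of_forall fun t => ?_)
  simp only [Pi.add_apply]
  rw [((hu.hasDerivAt t).add (hv.hasDerivAt t)).deriv]
  ring

theorem cylForm_const_mul_left (hv : IsEmden μ v) (c : ℝ) :
    cylForm μ (fun t => c * v t) w = c * cylForm μ v w := by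
  rw [cylForm, cylForm, ← integral_const_mul]
  refine integral_congr_ae (Eventually.of_forall fun t => ?_)
  simp only
  rw [((hv.hasDerivAt t).const_mul c).deriv]
  ring

theorem cylForm_comp_sub (μ : ℝ) (v w : ℝ → ℝ) (s : ℝ) :
    cylForm μ (fun t => v (t - s)) (fun t => w (t - s)) = cylForm μ v w := by
  simp only [cylForm, deriv_comp_sub_const]
  exact integral_sub_right_eq_self (fun t => deriv v t * deriv w t + μ ^ 2 * (v t * w t)) s

theorem cylEnergy_add (hμ : 0 < μ) (hv : IsEmden μ v) (hw : IsEmden μ w) :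
    cylEnergy μ (v + w) = cylEnergy μ v + 2 * cylForm μ v w + cylEnergy μ w := by
  simp only [cylEnergy_eq_cylForm]
  rw [cylForm_add_left hμ hv hw (hv.add hw), cylForm_comm μ v, cylForm_comm μ w,
    cylForm_add_left hμ hv hw hv, cylForm_add_left hμ hv hw hw, cylForm_comm μ w v]
  ring

theorem cylEnergy_const_mul (hv : IsEmden μ v) (c : ℝ) :
    cylEnergy μ (fun t => c * v t) = c ^ 2 * cylEnergy μ v := by
  simp only [cylEnergy_eq_cylForm]
  rw [cylForm_const_mul_left hv, cylForm_comm, cylForm_const_mul_left hv]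
  ring

/-- The Emden equation tested against `w`: the two integrands differ by the derivative of w b',
which is integrable. -/
theorem cylForm_lineBubble (hμ : 0 < μ) (hw : IsEmden μ w) :
    cylForm μ (lineBubble μ) w = 4 * μ * (μ + 1) * ∫ t, lineBubble (μ + 2) t * w t := by
  have hb := isEmden_lineBubble hμ
  obtain ⟨C, hC⟩ := hw.decay
  have hi : Integrable fun t => lineBubble (μ + 2) t * w t := by
    refine IsEmden.integrable_of_le ((continuous_lineBubble _).mul hw.continuous)
      (C := 1 * C) (by positivity : 0 < 2 * μ) fun t => IsEmden.mul_exp_le ?_ (hC t).1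
    rw [abs_of_pos (lineBubble_pos _ t), one_mul]
    refine (lineBubble_le_exp (by linarith) t).trans (Real.exp_le_exp.mpr ?_)
    nlinarith [abs_nonneg t]
  have hd : ∀ t, HasDerivAt (fun t => w t * deriv (lineBubble μ) t)
      (deriv (lineBubble μ) t * deriv w t + μ ^ 2 * (lineBubble μ t * w t) -
        4 * μ * (μ + 1) * (lineBubble (μ + 2) t * w t)) t := fun t =>
    ((hw.hasDerivAt t).mul (hasDerivAt_deriv_lineBubble μ t)).congr_deriv (by ring)
  have h := integral_eq_zero_of_hasDerivAt_of_integrable hd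
    ((hb.integrable_cylForm hμ hw).sub (hi.const_mul _)) (hw.integrable_mul_deriv hμ hb)
  rw [integral_sub (hb.integrable_cylForm hμ hw) (hi.const_mul _), integral_const_mul] at h
  rw [cylForm]
  linarith

end cylForm

/-! ### Interaction of two bubbles -/

/-- The bubble centred at `s`. -/
def lineBubbleAt (μ s : ℝ) : ℝ → ℝ := fun t => lineBubble μ (t - s)

/-- The interaction of two bubbles at distance `s`. -/
def interaction (μ s : ℝ) : ℝ := cylForm μ (lineBubble μ) (lineBubbleAt μ s)

section interaction

variable {μ : ℝ}

theorem isEmden_lineBubbleAt (hμ : 0 < μ) (s : ℝ) : IsEmden μ (lineBubbleAt μ s) :=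
  (isEmden_lineBubble hμ).comp_sub hμ s

theorem lineBubbleAt_zero (μ : ℝ) : lineBubbleAt μ 0 = lineBubble μ := by
  funext t; simp [lineBubbleAt]

theorem cylForm_lineBubbleAt (μ x y : ℝ) :
    cylForm μ (lineBubbleAt μ x) (lineBubbleAt μ y) = interaction μ (y - x) := by
  rw [interaction, ← cylForm_comp_sub μ (lineBubble μ) (lineBubbleAt μ (y - x)) x]
  congr 1
  funext t
  simp only [lineBubbleAt]
  congr 1; ring

theorem cylEnergy_lineBubbleAt (μ x : ℝ) : cylEnergy μ (lineBubbleAt μ x) = interaction μ 0 := by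
  rw [cylEnergy_eq_cylForm, cylForm_lineBubbleAt, sub_self]

theorem interaction_neg (μ s : ℝ) : interaction μ (-s) = interaction μ s := by
  have := cylForm_comm μ (lineBubbleAt μ 0) (lineBubbleAt μ s)
  rw [cylForm_lineBubbleAt, cylForm_lineBubbleAt] at this
  simpa using this.symm

theorem interaction_eq (hμ : 0 < μ) (s : ℝ) :
    interaction μ s = 4 * μ * (μ + 1) * ∫ t, lineBubble (μ + 2) t * lineBubble μ (t - s) :=
  cylForm_lineBubble hμ (isEmden_lineBubbleAt hμ s)

theorem integrable_interaction (hμ : 0 < μ) (s : ℝ) :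
    Integrable fun t => lineBubble (μ + 2) t * lineBubble μ (t - s) := by
  refine (integrable_lineBubble (by linarith : 0 < μ + 2)).mul_bdd (c := 1)
    ((continuous_lineBubble μ).comp (continuous_id.sub continuous_const)).aestronglyMeasurable
    (Eventually.of_forall fun t => ?_)
  rw [Real.norm_of_nonneg (lineBubble_pos _ _).le]
  refine (lineBubble_le_exp hμ.le _).trans (Real.exp_le_one_iff.mpr ?_)
  have := abs_nonneg (t - s)
  simp only [Left.neg_nonpos_iff]
  positivity

theorem interaction_zero (hμ : 0 < μ) :
    interaction μ 0 = 4 * μ * (μ + 1) * ∫ t, lineBubble (2 * μ + 2) t := by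
  rw [interaction_eq hμ]
  congr 1
  refine integral_congr_ae (Eventually.of_forall fun t => ?_)
  simp only [sub_zero]
  rw [← lineBubble_add]; congr 1; ring

theorem integral_lineBubble_pos (hμ : 0 < μ) : 0 < ∫ t, lineBubble μ t := by
  refine (integral_pos_iff_support_of_nonneg (fun t => (lineBubble_pos μ t).le)
    (integrable_lineBubble hμ)).mpr ?_
  rw [show Function.support (lineBubble μ) = univ from
    eq_univ_of_forall fun t => (lineBubble_pos μ t).ne']
  simp

theorem interaction_zero_pos (hμ : 0 < μ) : 0 < interaction μ 0 := by
  rw [interaction_zero hμ]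
  have := integral_lineBubble_pos (by linarith : 0 < 2 * μ + 2)
  positivity

/-- Gives both the lower bound e^{-2μL}Q ≤ ε, against which error terms are measured, and the
logarithmic Lipschitz control of the interaction. -/
theorem exp_mul_interaction_le (hμ : 0 < μ) (s d : ℝ) :
    Real.exp (-(μ * |d|)) * interaction μ s ≤ interaction μ (s + d) := by
  rw [interaction_eq hμ, interaction_eq hμ, mul_left_comm, ← integral_const_mul]
  refine mul_le_mul_of_nonneg_left ?_ (by positivity)
  refine integral_mono ((integrable_interaction hμ s).const_mul _) (integrable_interaction hμ _)
    fun t => ?_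
  have := mul_le_mul_of_nonneg_left (exp_mul_lineBubble_le hμ.le (t - s) d)
    (lineBubble_pos (μ + 2) t).le
  simp only
  rw [show t - (s + d) = t - s - d by ring]
  linarith

theorem interaction_pos (hμ : 0 < μ) (s : ℝ) : 0 < interaction μ s := by
  have h := exp_mul_interaction_le hμ 0 s
  rw [zero_add] at h
  exact (mul_pos (Real.exp_pos _) (interaction_zero_pos hμ)).trans_le h

theorem interaction_add_le (hμ : 0 < μ) (s d : ℝ) :
    interaction μ (s + d) ≤ Real.exp (μ * |d|) * interaction μ s := by
  have h := exp_mul_interaction_le hμ (s + d) (-d)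
  rw [add_neg_cancel_right, abs_neg] at h
  calc _ = Real.exp (μ * |d|) * (Real.exp (-(μ * |d|)) * interaction μ (s + d)) := by
        rw [← mul_assoc, ← Real.exp_add]; simp
    _ ≤ _ := mul_le_mul_of_nonneg_left h (Real.exp_pos _).le

/-- One factor `lineBubble 2` is kept for integrability; the other two bubbles give
e^{-μ|t|}e^{-μ|t-s|} ≤ e^{-μ|s|}. -/
theorem exists_interaction_le (hμ : 0 < μ) :
    ∃ C : ℝ, 0 < C ∧ ∀ s, interaction μ s ≤ C * Real.exp (-(μ * |s|)) := by
  have h2 := integrable_lineBubble (two_pos : (0 : ℝ) < 2)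
  refine ⟨4 * μ * (μ + 1) * ∫ t, lineBubble 2 t, ?_, fun s => ?_⟩
  · have := integral_lineBubble_pos (two_pos : (0 : ℝ) < 2)
    positivity
  · rw [interaction_eq hμ, mul_assoc (4 * μ * (μ + 1)), ← integral_mul_const]
    refine mul_le_mul_of_nonneg_left ?_ (by positivity)
    refine integral_mono (integrable_interaction hμ s) (h2.mul_const _) fun t => ?_
    simp only
    rw [add_comm μ 2, lineBubble_add, mul_assoc]
    refine mul_le_mul_of_nonneg_left ?_ (lineBubble_pos 2 t).le
    calc _ ≤ Real.exp (-(μ * |t|)) * Real.exp (-(μ * |t - s|)) :=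
          mul_le_mul (lineBubble_le_exp hμ.le _) (lineBubble_le_exp hμ.le _)
            (lineBubble_pos _ _).le (Real.exp_pos _).le
      _ ≤ _ := by
          rw [← Real.exp_add]
          refine Real.exp_le_exp.mpr ?_
          have h := abs_sub_abs_le_abs_sub s t
          rw [abs_sub_comm s t] at h
          nlinarith

/-- Two distinct bubbles are at a definite distance from each other. -/
theorem exists_interaction_le_sub (hμ : 0 < μ) :
    ∃ c : ℝ, 0 < c ∧ ∀ d, interaction μ d ≤ interaction μ 0 - c * min |d| 1 ^ 2 := by
  -- A lower bound for the derivative of the bubble on [-3,-1]. For t in [-2,-1], shifting left by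
  -- at most 1 stays in this window.
  set m : ℝ := 2 * μ * (Real.sinh 1 * lineBubble (μ + 1) 3) with hm
  have hm0 : 0 < m := by
    have := lineBubble_pos (μ + 1) 3
    have := Real.sinh_pos_iff.mpr one_pos
    positivity
  have hder : ∀ t ∈ Icc (-3 : ℝ) (-1), m ≤ deriv (lineBubble μ) t := by
    intro t ht
    rw [deriv_lineBubble]
    have h1 : Real.sinh 1 ≤ -Real.sinh t := by
      rw [← Real.sinh_neg]; exact Real.sinh_le_sinh.mpr (by linarith [ht.2])
    have h2 : lineBubble (μ + 1) 3 ≤ lineBubble (μ + 1) t := by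
      refine lineBubble_le_of_abs_le (by linarith) ?_
      rw [abs_le]
      constructor <;> norm_num <;> linarith [ht.1, ht.2]
    have h3 := mul_le_mul h1 h2 (lineBubble_pos _ _).le
      ((Real.sinh_pos_iff.mpr one_pos).le.trans h1)
    simp only [hm]
    nlinarith
  have hsmall : ∀ t ∈ Icc (-2 : ℝ) (-1), ∀ d : ℝ, 0 ≤ d → d ≤ 1 →
      m * d ≤ lineBubble μ t - lineBubble μ (t - d) := by
    intro t ht d hd0 hd1
    have h := (convex_Icc (-3 : ℝ) (-1)).mul_sub_le_image_sub_of_le_deriv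
      (continuous_lineBubble μ).continuousOn
      (fun x _ => (hasDerivAt_lineBubble μ x).differentiableAt.differentiableWithinAt)
      (fun x hx => hder x (interior_subset hx)) (t - d)
      ⟨by linarith [ht.1], by linarith [ht.2]⟩ t ⟨by linarith [ht.1], ht.2⟩ (by linarith)
    rwa [sub_sub_cancel] at h
  have hall : ∀ t ∈ Icc (-2 : ℝ) (-1), ∀ d : ℝ, 0 ≤ d →
      m * min d 1 ≤ lineBubble μ t - lineBubble μ (t - d) := by
    intro t ht d hd
    rcases le_total d 1 with h | h
    · rw [min_eq_left h]; exact hsmall t ht d hd h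
    · rw [min_eq_right h]
      have h1 := hsmall t ht 1 zero_le_one le_rfl
      have h2 : lineBubble μ (t - d) ≤ lineBubble μ (t - 1) := by
        refine lineBubble_le_of_abs_le hμ.le ?_
        rw [abs_of_nonpos (by linarith [ht.2]), abs_of_nonpos (by linarith [ht.2])]
        linarith
      linarith
  refine ⟨μ ^ 2 * m ^ 2 / 2, by positivity, ?_⟩
  have hpos : ∀ d : ℝ, 0 ≤ d →
      interaction μ d ≤ interaction μ 0 - μ ^ 2 * m ^ 2 / 2 * min d 1 ^ 2 := by
    intro d hd
    have hb := isEmden_lineBubble hμ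
    have hbd := (isEmden_lineBubbleAt hμ d).const_mul (-1)
    -- Twice the drop of the interaction is the squared energy norm of the difference of two
    -- bubbles, which is bounded below by its zero-order part on the unit interval [-2,-1].
    have hE : cylEnergy μ (lineBubble μ + fun t => -1 * lineBubbleAt μ d t) =
        2 * interaction μ 0 - 2 * interaction μ d := by
      rw [cylEnergy_add hμ hb hbd, cylEnergy_const_mul (isEmden_lineBubbleAt hμ d),
        cylForm_comm, cylForm_const_mul_left (isEmden_lineBubbleAt hμ d), cylForm_comm,
        cylEnergy_lineBubbleAt, ← lineBubbleAt_zero, cylEnergy_lineBubbleAt, cylForm_lineBubbleAt,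
        sub_zero]
      ring
    have hi := (hb.add hbd).integrable_cylForm hμ (hb.add hbd)
    have hlow : μ ^ 2 * (m * min d 1) ^ 2 ≤
        cylEnergy μ (lineBubble μ + fun t => -1 * lineBubbleAt μ d t) := by
      rw [cylEnergy_eq_cylForm, cylForm]
      calc _ = ∫ t in Icc (-2 : ℝ) (-1), μ ^ 2 * (m * min d 1) ^ 2 := by
            rw [setIntegral_const]
            simp [Measure.real]
            norm_num
        _ ≤ ∫ t in Icc (-2 : ℝ) (-1), (deriv (lineBubble μ + fun t => -1 * lineBubbleAt μ d t) t *
              deriv (lineBubble μ + fun t => -1 * lineBubbleAt μ d t) t +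
              μ ^ 2 * ((lineBubble μ + fun t => -1 * lineBubbleAt μ d t) t *
              (lineBubble μ + fun t => -1 * lineBubbleAt μ d t) t)) := by
            refine setIntegral_mono_on (integrableOn_const (by simp)) hi.integrableOn
              measurableSet_Icc fun t ht => ?_
            have h1 := hall t ht d hd
            have h0 : 0 ≤ m * min d 1 := by positivity
            have h2 := pow_le_pow_left₀ h0 h1 2
            have h3 := mul_self_nonneg (deriv (lineBubble μ + fun t => -1 * lineBubbleAt μ d t) t)
            have h4 : (lineBubble μ + fun t => -1 * lineBubbleAt μ d t) t =
              lineBubble μ t - lineBubble μ (t - d) := by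
                simp [lineBubbleAt, sub_eq_add_neg]
            rw [h4, ← sq (lineBubble μ t - _)]
            have := mul_le_mul_of_nonneg_left h2 (sq_nonneg μ)
            linarith
        _ ≤ _ := by
            refine setIntegral_le_integral hi (Eventually.of_forall fun t => ?_)
            have h3 := mul_self_nonneg (deriv (lineBubble μ + fun t => -1 * lineBubbleAt μ d t) t)
            have h4 := mul_self_nonneg ((lineBubble μ + fun t => -1 * lineBubbleAt μ d t) t)
            simp only [Pi.zero_apply]
            positivity
    rw [hE] at hlow
    nlinarith
  intro d
  rcases le_total 0 d with h | h
  · rw [abs_of_nonneg h]; exact hpos d h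
  · rw [abs_of_nonpos h, ← interaction_neg]; exact hpos (-d) (by linarith)

end interaction

/-! ### Two bubbles far apart -/

/-- For b ≤ a, Bernoulli supplies a^p + p a^{p-1}b. The other two terms b^p and p b^{p-1}a are at
most (ab)^{p/2} and p(ab)^{p/2}, and the subtracted remainder absorbs them. This covers every p ≥ 2
at once. -/
theorem rpow_add_le_add_rpow {p a b : ℝ} (hp : 2 ≤ p) (ha : 0 < a) (hb : 0 < b) :
    a ^ p + b ^ p + p * (a ^ (p - 1) * b + b ^ (p - 1) * a) - (1 + p) * (a * b) ^ (p / 2) ≤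
      (a + b) ^ p := by
  wlog hab : b ≤ a generalizing a b
  · have := this hb ha (le_of_not_ge hab)
    rw [add_comm b a, mul_comm b a] at this
    linarith
  have hab0 : 0 < a * b := mul_pos ha hb
  have h1 : a ^ p + p * (a ^ (p - 1) * b) ≤ (a + b) ^ p := by
    have h := one_add_mul_self_le_rpow_one_add (s := b / a) (p := p)
      (by linarith [div_pos hb ha]) (by linarith)
    have e : a + b = a * (1 + b / a) := by field_simp
    rw [e, Real.mul_rpow ha.le (by positivity)]
    refine le_trans (le_of_eq ?_) (mul_le_mul_of_nonneg_left h (by positivity))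
    rw [Real.rpow_sub_one ha.ne']
    field_simp
  have h2 : b ^ p ≤ (a * b) ^ (p / 2) := by
    have e : b ^ p = (b * b) ^ (p / 2) := by
      rw [Real.mul_rpow hb.le hb.le, ← Real.rpow_add hb]; congr 1; ring
    rw [e]
    exact Real.rpow_le_rpow (by positivity) (mul_le_mul_of_nonneg_right hab hb.le) (by linarith)
  have h3 : b ^ (p - 1) * a ≤ (a * b) ^ (p / 2) := by
    have e1 : b ^ (p - 1) * a = (b * b) ^ (p / 2 - 1) * (a * b) := by
      rw [Real.mul_rpow hb.le hb.le, ← Real.rpow_add hb, mul_comm a b, ← mul_assoc,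
        ← Real.rpow_add_one hb.ne']
      congr 2; ring
    have e2 : (a * b) ^ (p / 2) = (a * b) ^ (p / 2 - 1) * (a * b) := by
      rw [← Real.rpow_add_one hab0.ne']; congr 1; ring
    rw [e1, e2]
    refine mul_le_mul_of_nonneg_right ?_ hab0.le
    exact Real.rpow_le_rpow (by positivity) (mul_le_mul_of_nonneg_right hab hb.le) (by linarith)
  have h4 : p * (b ^ (p - 1) * a) ≤ p * (a * b) ^ (p / 2) :=
    mul_le_mul_of_nonneg_left h3 (by linarith)
  linarith

/-- A first-order lower bound with slope reduced by θ; for r < 1 concavity forbids the full slope.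
The smallness of x is what gives e^{θx} ≤ 1 + x. -/
theorem one_add_mul_le_rpow {r θ x : ℝ} (hr : 0 ≤ r) (hx : 0 ≤ x) (hθx : θ * x ≤ 1 - θ) :
    1 + θ * r * x ≤ (1 + x) ^ r := by
  rcases eq_or_lt_of_le hx with rfl | hx'
  · simp
  have h1 : Real.exp (θ * x) ≤ 1 + x := by
    rcases le_or_gt 1 (θ * x) with h | h
    · exfalso
      nlinarith
    · have h2 : 1 - θ * x ≤ Real.exp (-(θ * x)) := by
        have := Real.add_one_le_exp (-(θ * x)); linarith
      have h3 : Real.exp (θ * x) * Real.exp (-(θ * x)) = 1 := by rw [← Real.exp_add]; simp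
      have h4 := Real.exp_pos (θ * x)
      have h5 : Real.exp (θ * x) * (1 - θ * x) ≤ 1 := by
        exact (mul_le_mul_of_nonneg_left h2 h4.le).trans h3.le
      have h6 : 1 ≤ (1 + x) * (1 - θ * x) := by nlinarith
      exact le_of_mul_le_mul_right (h5.trans h6) (by linarith)
  calc 1 + θ * r * x ≤ Real.exp (θ * r * x) := by
        have := Real.add_one_le_exp (θ * r * x); linarith
    _ = Real.exp (θ * x) ^ r := by rw [← Real.exp_mul]; congr 1; ring
    _ ≤ _ := Real.rpow_le_rpow (Real.exp_pos _).le h1 hr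

/-- Two bubbles at distance `2L`. -/
def twoBubble (μ L : ℝ) : ℝ → ℝ := lineBubbleAt μ L + lineBubbleAt μ (-L)

section twoBubble

variable {μ : ℝ}

theorem isEmden_twoBubble (hμ : 0 < μ) (L : ℝ) : IsEmden μ (twoBubble μ L) :=
  (isEmden_lineBubbleAt hμ L).add (isEmden_lineBubbleAt hμ (-L))

theorem cylEnergy_twoBubble (hμ : 0 < μ) (L : ℝ) :
    cylEnergy μ (twoBubble μ L) = 2 * interaction μ 0 + 2 * interaction μ (2 * L) := by
  rw [twoBubble, cylEnergy_add hμ (isEmden_lineBubbleAt hμ L) (isEmden_lineBubbleAt hμ (-L)),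
    cylEnergy_lineBubbleAt, cylEnergy_lineBubbleAt, cylForm_lineBubbleAt,
    show -L - L = -(2 * L) by ring, interaction_neg]
  ring

theorem cylEnergy_twoBubble_sub (hμ : 0 < μ) (L c s : ℝ) :
    cylEnergy μ (twoBubble μ L + fun t => -c * lineBubbleAt μ s t) =
      2 * interaction μ 0 + 2 * interaction μ (2 * L) -
        2 * c * (interaction μ (s - L) + interaction μ (s + L)) + c ^ 2 * interaction μ 0 := by
  have hs := isEmden_lineBubbleAt hμ s
  rw [cylEnergy_add hμ (isEmden_twoBubble hμ L) (hs.const_mul (-c)), cylEnergy_twoBubble hμ,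
    cylEnergy_const_mul hs, cylEnergy_lineBubbleAt, cylForm_comm, cylForm_const_mul_left hs,
    cylForm_comm, twoBubble, cylForm_add_left hμ (isEmden_lineBubbleAt hμ L)
    (isEmden_lineBubbleAt hμ (-L)) hs, cylForm_lineBubbleAt, cylForm_lineBubbleAt, sub_neg_eq_add]
  ring

theorem integral_rpow_lineBubbleAt (hμ : 0 < μ) (s : ℝ) :
    ∫ t, lineBubbleAt μ s t ^ (2 + 2 / μ) = ∫ t, lineBubble (2 * μ + 2) t := by
  rw [← integral_sub_right_eq_self (fun t => lineBubble (2 * μ + 2) t) s]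
  refine integral_congr_ae (Eventually.of_forall fun t => ?_)
  simp only [lineBubbleAt, lineBubble_rpow]
  congr 1
  field_simp

theorem rpow_lineBubbleAt_mul (hμ : 0 < μ) (x y t : ℝ) :
    lineBubbleAt μ x t ^ (2 + 2 / μ - 1) * lineBubbleAt μ y t =
      lineBubble (μ + 2) (t - x) * lineBubble μ (t - x - (y - x)) := by
  simp only [lineBubbleAt, lineBubble_rpow]
  congr 2
  · field_simp; ring
  · ring

theorem integral_rpow_lineBubbleAt_mul (hμ : 0 < μ) (x y : ℝ) :
    ∫ t, lineBubbleAt μ x t ^ (2 + 2 / μ - 1) * lineBubbleAt μ y t =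
      interaction μ (y - x) / (4 * μ * (μ + 1)) := by
  simp only [rpow_lineBubbleAt_mul hμ]
  rw [integral_sub_right_eq_self (fun t => lineBubble (μ + 2) t * lineBubble μ (t - (y - x))) x,
    interaction_eq hμ]
  field_simp

theorem integrable_rpow_lineBubbleAt (hμ : 0 < μ) (s : ℝ) :
    Integrable fun t => lineBubbleAt μ s t ^ (2 + 2 / μ) := by
  refine ((isEmden_lineBubbleAt hμ s).integrable_abs_rpow hμ
    (by positivity : 0 < 2 + 2 / μ)).congr (Eventually.of_forall fun t => ?_)
  simp only
  rw [abs_of_pos]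
  exact lineBubble_pos _ _

theorem integrable_rpow_lineBubbleAt_mul (hμ : 0 < μ) (x y : ℝ) :
    Integrable fun t => lineBubbleAt μ x t ^ (2 + 2 / μ - 1) * lineBubbleAt μ y t := by
  simp only [rpow_lineBubbleAt_mul hμ]
  exact (integrable_interaction hμ (y - x)).comp_sub_right x

/-- Since |t-L| + |t+L| is at least 2L and at least 2|t|, the exponent μ+1 splits as (μ+1/2) + 1/2.
The rate 2μ+1 beats the rate 2μ of the interaction, so this remainder is o(ε). -/
theorem rpow_mul_lineBubbleAt_le (hμ : 0 < μ) {L : ℝ} (hL : 0 ≤ L) (t : ℝ) :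
    (lineBubbleAt μ L t * lineBubbleAt μ (-L) t) ^ ((2 + 2 / μ) / 2) ≤
      Real.exp (-((2 * μ + 1) * L)) * Real.exp (-(1 * |t|)) := by
  have h1 : lineBubbleAt μ L t * lineBubbleAt μ (-L) t ≤ Real.exp (-(μ * (|t - L| + |t + L|))) := by
    calc _ ≤ Real.exp (-(μ * |t - L|)) * Real.exp (-(μ * |t - -L|)) :=
          mul_le_mul (lineBubble_le_exp hμ.le _) (lineBubble_le_exp hμ.le _)
            (lineBubble_pos _ _).le (Real.exp_pos _).le
      _ = _ := by rw [← Real.exp_add, sub_neg_eq_add]; congr 1; ring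
  have h0 : 0 ≤ lineBubbleAt μ L t * lineBubbleAt μ (-L) t :=
    (mul_pos (lineBubble_pos _ _) (lineBubble_pos _ _)).le
  refine (Real.rpow_le_rpow h0 h1 (by positivity)).trans ?_
  rw [← Real.exp_mul, ← Real.exp_add]
  refine Real.exp_le_exp.mpr ?_
  have e : -(μ * (|t - L| + |t + L|)) * ((2 + 2 / μ) / 2) = -((μ + 1) * (|t - L| + |t + L|)) := by
    field_simp
  rw [e]
  have h2 : 2 * |t| ≤ |t - L| + |t + L| := by
    have := abs_add_le (t - L) (t + L)
    rw [show t - L + (t + L) = 2 * t by ring, abs_mul, abs_two] at this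
    exact this
  have h3 : 2 * L ≤ |t - L| + |t + L| := by
    have := abs_sub (t + L) (t - L)
    rw [show t + L - (t - L) = 2 * L by ring, abs_of_nonneg (by positivity)] at this
    linarith
  nlinarith

theorem le_integral_twoBubble_rpow (hμ : 0 < μ) {L : ℝ} (hL : 0 ≤ L) :
    2 * (∫ t, lineBubble (2 * μ + 2) t) +
        2 * (2 + 2 / μ) * (interaction μ (2 * L) / (4 * μ * (μ + 1))) -
        (1 + (2 + 2 / μ)) * (Real.exp (-((2 * μ + 1) * L)) * ∫ t, Real.exp (-(1 * |t|))) ≤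
      ∫ t, |twoBubble μ L t| ^ (2 + 2 / μ) := by
  set p : ℝ := 2 + 2 / μ with hp
  have hp2 : 2 ≤ p := by rw [hp]; have : 0 < 2 / μ := by positivity
                         linarith
  have i1 := integrable_rpow_lineBubbleAt hμ L
  have i2 := integrable_rpow_lineBubbleAt hμ (-L)
  have i3 := integrable_rpow_lineBubbleAt_mul hμ L (-L)
  have i4 := integrable_rpow_lineBubbleAt_mul hμ (-L) L
  have i5 := (integrable_exp_neg_mul_abs one_pos).const_mul (Real.exp (-((2 * μ + 1) * L)))
  rw [← hp] at i1 i2 i3 i4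
  have hi := (((i1.add i2).add ((i3.add i4).const_mul p)).sub (i5.const_mul (1 + p)))
  have hle : ∫ t, ((lineBubbleAt μ L t ^ p + lineBubbleAt μ (-L) t ^ p) +
      p * (lineBubbleAt μ L t ^ (p - 1) * lineBubbleAt μ (-L) t +
        lineBubbleAt μ (-L) t ^ (p - 1) * lineBubbleAt μ L t) -
      (1 + p) * (Real.exp (-((2 * μ + 1) * L)) * Real.exp (-(1 * |t|)))) ≤
      ∫ t, |twoBubble μ L t| ^ p := by
    refine integral_mono hi ((isEmden_twoBubble hμ L).integrable_abs_rpow hμ (by linarith))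
      fun t => ?_
    have ha : 0 < lineBubbleAt μ L t := lineBubble_pos _ _
    have hb : 0 < lineBubbleAt μ (-L) t := lineBubble_pos _ _
    have h1 := rpow_add_le_add_rpow hp2 ha hb
    have h2 := mul_le_mul_of_nonneg_left (rpow_mul_lineBubbleAt_le hμ hL t)
      (by linarith : 0 ≤ 1 + p)
    rw [← hp] at h2
    simp only [twoBubble, Pi.add_apply]
    rw [abs_of_pos (add_pos ha hb)]
    linarith
  refine le_trans (le_of_eq ?_) hle
  have i12 : Integrable fun t => lineBubbleAt μ L t ^ p + lineBubbleAt μ (-L) t ^ p := i1.add i2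
  have i34 : Integrable fun t => lineBubbleAt μ L t ^ (p - 1) * lineBubbleAt μ (-L) t +
        lineBubbleAt μ (-L) t ^ (p - 1) * lineBubbleAt μ L t := i3.add i4
  have i14 : Integrable fun t => (lineBubbleAt μ L t ^ p + lineBubbleAt μ (-L) t ^ p) +
      p * (lineBubbleAt μ L t ^ (p - 1) * lineBubbleAt μ (-L) t +
        lineBubbleAt μ (-L) t ^ (p - 1) * lineBubbleAt μ L t) := i12.add (i34.const_mul p)
  rw [integral_sub i14 (i5.const_mul (1 + p)), integral_add i12 (i34.const_mul p),
    integral_add i1 i2, integral_const_mul, integral_add i3 i4, integral_const_mul,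
    integral_const_mul, integral_rpow_lineBubbleAt hμ, integral_rpow_lineBubbleAt hμ,
    integral_rpow_lineBubbleAt_mul hμ, integral_rpow_lineBubbleAt_mul hμ,
    show -L - L = -(2 * L) by ring, show L - -L = 2 * L by ring, interaction_neg]
  ring

/-- The best single bubble sits essentially at one of the two centres. Moving it by d ≤ 1 from L
costs at least c d² in the first interaction and gains at most k d ε in the second; optimizing over
d leaves k²ε²/(4c). Farther away the loss c already exceeds the second interaction. -/
theorem exists_interaction_add_le (hμ : 0 < μ) :
    ∃ K : ℝ, 0 ≤ K ∧ ∀ᶠ L in atTop, ∀ s : ℝ,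
      interaction μ (s - L) + interaction μ (s + L) ≤
        interaction μ 0 + interaction μ (2 * L) + K * interaction μ (2 * L) ^ 2 := by
  obtain ⟨c, hc, hcd⟩ := exists_interaction_le_sub hμ
  obtain ⟨C, hC, hCs⟩ := exists_interaction_le hμ
  -- This k satisfies e^{μd} ≤ 1 + k d for 0 ≤ d ≤ 1.
  set k : ℝ := μ * Real.exp μ with hk
  refine ⟨k ^ 2 / (4 * c), by positivity, ?_⟩
  have hlim : Tendsto (fun L : ℝ => C * Real.exp (-(μ * L))) atTop (𝓝 0) := by
    have h1 : Tendsto (fun L : ℝ => μ * L) atTop atTop := tendsto_id.const_mul_atTop hμ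
    have h2 := (Real.tendsto_exp_neg_atTop_nhds_zero.comp h1).const_mul C
    simpa [Function.comp_def] using h2
  filter_upwards [hlim.eventually_lt_const hc, eventually_ge_atTop (0 : ℝ)] with L hL hL0
  set ε := interaction μ (2 * L) with hε
  have hε0 : 0 < ε := interaction_pos hμ _
  -- Reflection exchanges the two centres, so s ≥ 0 suffices and L is the nearer one.
  have key : ∀ s : ℝ, 0 ≤ s → interaction μ (s - L) + interaction μ (s + L) ≤
      interaction μ 0 + ε + k ^ 2 / (4 * c) * ε ^ 2 := by
    intro s hs
    have h1 := hcd (s - L)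
    rcases le_total |s - L| 1 with h | h
    · rw [min_eq_left h] at h1
      have h2 := interaction_add_le hμ (2 * L) (s - L)
      rw [show 2 * L + (s - L) = s + L by ring] at h2
      set d := |s - L| with hd
      have hd0 : 0 ≤ d := abs_nonneg _
      have h3 : Real.exp (μ * d) ≤ 1 + k * d := by
        have h4 : 1 - μ * d ≤ Real.exp (-(μ * d)) := by
          have := Real.add_one_le_exp (-(μ * d)); linarith
        have h5 : Real.exp (μ * d) * Real.exp (-(μ * d)) = 1 := by rw [← Real.exp_add]; simp
        have h6 : Real.exp (μ * d) ≤ Real.exp μ := Real.exp_le_exp.mpr (by nlinarith)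
        have h7 := mul_le_mul_of_nonneg_left h4 (Real.exp_pos (μ * d)).le
        have h8 := mul_le_mul_of_nonneg_left h6 (by positivity : 0 ≤ μ * d)
        rw [hk]
        linarith
      have h4 : k * d * ε - c * d ^ 2 ≤ k ^ 2 / (4 * c) * ε ^ 2 := by
        have h5 : 0 ≤ (k * ε - 2 * c * d) ^ 2 / (4 * c) := by positivity
        have h6 : (k * ε - 2 * c * d) ^ 2 / (4 * c) =
            k ^ 2 / (4 * c) * ε ^ 2 - k * d * ε + c * d ^ 2 := by
          field_simp; ring
        linarith
      have h5 := mul_le_mul_of_nonneg_right h3 hε0.le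
      linarith
    · rw [min_eq_right h] at h1
      have h2 := hCs (s + L)
      have h3 : C * Real.exp (-(μ * |s + L|)) ≤ C * Real.exp (-(μ * L)) := by
        refine mul_le_mul_of_nonneg_left (Real.exp_le_exp.mpr ?_) hC.le
        rw [abs_of_nonneg (by linarith)]
        nlinarith
      have h4 : 0 ≤ k ^ 2 / (4 * c) * ε ^ 2 := by positivity
      linarith
  intro s
  rcases le_total 0 s with hs | hs
  · exact key s hs
  · have := key (-s) (by linarith)
    rw [show -s - L = -(s + L) by ring, show -s + L = -(s - L) by ring, interaction_neg,
      interaction_neg] at this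
    linarith

set_option maxHeartbeats 1000000 in
/-- Two bubbles far apart have a small deficit relative to their distance to the single bubbles. -/
theorem exists_twoBubble (hμ : 0 < μ) :
    ∃ L D : ℝ, 0 < D ∧
      (∀ c s : ℝ, D ≤ cylEnergy μ (twoBubble μ L + fun t => -c * lineBubbleAt μ s t)) ∧
      cylEnergy μ (twoBubble μ L) - interaction μ 0 *
        ((∫ t, |twoBubble μ L t| ^ (2 + 2 / μ)) / ∫ t, lineBubble (2 * μ + 2) t) ^
          (2 / (2 + 2 / μ)) <
        (2 - 2 ^ (2 / (2 + 2 / μ))) * D := by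
  obtain ⟨K, hK, hev⟩ := exists_interaction_add_le hμ
  obtain ⟨C, hC, hCs⟩ := exists_interaction_le hμ
  set p : ℝ := 2 + 2 / μ with hp
  have hp2 : 2 < p := by
    have : 0 < 2 / μ := by positivity
    linarith
  set r : ℝ := 2 / p with hr
  have hr0 : 0 < r := by positivity
  have hr1 : r < 1 := by rw [hr, div_lt_one (by linarith)]; exact hp2
  set P : ℝ := ∫ t, lineBubble (2 * μ + 2) t with hP
  have hP0 : 0 < P := integral_lineBubble_pos (by linarith)
  set κ : ℝ := 4 * μ * (μ + 1) with hκ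
  have hκ0 : 0 < κ := by positivity
  set Q : ℝ := interaction μ 0 with hQ
  have hQP : Q = κ * P := interaction_zero hμ
  have hQ0 : 0 < Q := interaction_zero_pos hμ
  set I : ℝ := ∫ t : ℝ, Real.exp (-(1 * |t|)) with hI
  have hI0 : 0 ≤ I := integral_nonneg fun t => (Real.exp_pos _).le
  -- The interaction term loses a factor θ twice: once to the remainder in the integral, once to the
  -- reduced slope for the r-th power. The choice makes 2^r θ² = 2^{r/3} = A, still above 1.
  set θ : ℝ := 2 ^ (-(r / 3)) with hθ
  have hθ0 : 0 < θ := by positivity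
  have hθ1 : θ < 1 := Real.rpow_lt_one_of_one_lt_of_neg one_lt_two (by linarith)
  set A : ℝ := 2 ^ (r / 3) with hA
  have hA1 : 1 < A := Real.one_lt_rpow one_lt_two (by positivity)
  have hAθ : 2 ^ r * (θ * θ) = A := by
    rw [hθ, hA, ← Real.rpow_add two_pos, ← Real.rpow_add two_pos]; congr 1; ring
  -- Collects the second-order coefficients of M²/Q for M = Q + ε + Kε², using ε ≤ 1.
  set K' : ℝ := (1 + 2 * K * Q + 2 * K + K ^ 2) / Q with hK'
  have hK'0 : 0 ≤ K' := by positivity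
  set B : ℝ := 2 - 2 ^ r with hB
  have hB0 : 0 < B := by
    have : (2 : ℝ) ^ r < 2 ^ (1 : ℝ) := Real.rpow_lt_rpow_of_exponent_lt one_lt_two hr1
    rw [Real.rpow_one] at this
    linarith
  have hlimε : Tendsto (fun L : ℝ => interaction μ (2 * L)) atTop (𝓝 0) := by
    have h1 : Tendsto (fun L : ℝ => μ * |2 * L|) atTop atTop :=
      (tendsto_abs_atTop_atTop.comp (tendsto_id.const_mul_atTop two_pos)).const_mul_atTop hμ
    have h2 := (Real.tendsto_exp_neg_atTop_nhds_zero.comp h1).const_mul C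
    rw [mul_zero] at h2
    exact tendsto_of_tendsto_of_tendsto_of_le_of_le tendsto_const_nhds h2
      (fun L => (interaction_pos hμ _).le) fun L => hCs _
  have hlimI : Tendsto (fun L : ℝ => (1 + p) * I * Real.exp (-L)) atTop (𝓝 0) := by
    simpa using Real.tendsto_exp_neg_atTop_nhds_zero.const_mul ((1 + p) * I)
  have hlim1 : Tendsto (fun L : ℝ => θ * (θ * (p * interaction μ (2 * L) / Q))) atTop (𝓝 0) := by
    simpa using (((hlimε.const_mul p).div_const Q).const_mul θ).const_mul θ
  have hlim2 : Tendsto (fun L : ℝ => B * K' * interaction μ (2 * L)) atTop (𝓝 0) := by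
    simpa using hlimε.const_mul (B * K')
  have hlim3 : Tendsto (fun L : ℝ => K' * interaction μ (2 * L)) atTop (𝓝 0) := by
    simpa using hlimε.const_mul K'
  have hθp : 0 < 2 * p * (1 - θ) := mul_pos (by linarith) (by linarith)
  -- Besides the interaction bound, L is large enough that ε < 1, the remainder fits into the share
  -- 1-θ, the reduced-slope bound applies, the distance error stays below the gain 2(A-1)ε, and the
  -- distance bound is positive.
  obtain ⟨L, hsup, hL0, hε1, hLI, hL1, hL2, hL3⟩ := (hev.and ((eventually_ge_atTop (0 : ℝ)).and
    ((hlimε.eventually_lt_const one_pos).and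
    ((hlimI.eventually_lt_const (mul_pos hθp hP0)).and
    ((hlim1.eventually_lt_const (by linarith : (0 : ℝ) < 1 - θ)).and
    ((hlim2.eventually_lt_const (by linarith : (0 : ℝ) < 2 * (A - 1))).and
    (hlim3.eventually_lt_const hQ0))))))).exists
  set ε := interaction μ (2 * L) with hε
  have hε0 : 0 < ε := interaction_pos hμ _
  set M : ℝ := Q + ε + K * ε ^ 2 with hM
  have hεsq : ε ^ 2 ≤ ε := by nlinarith
  -- The terms of order ε cancel, so the squared distance differs from Q only at second order.
  have hD : Q - K' * ε ^ 2 ≤ 2 * Q + 2 * ε - M ^ 2 / Q := by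
    have h1 : M ^ 2 ≤ Q ^ 2 + 2 * Q * ε + (1 + 2 * K * Q + 2 * K + K ^ 2) * ε ^ 2 := by
      have h2 : 2 * K * (ε * ε ^ 2) ≤ 2 * K * (1 * ε ^ 2) := by gcongr
      have h3 : K ^ 2 * (ε ^ 2 * ε ^ 2) ≤ K ^ 2 * (1 * ε ^ 2) := by gcongr; linarith
      rw [hM]
      nlinarith
    have h2 : M ^ 2 / Q ≤ Q + 2 * ε + K' * ε ^ 2 := by
      rw [div_le_iff₀ hQ0, hK']
      refine h1.trans (le_of_eq ?_)
      field_simp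
    linarith
  have hK'ε : K' * ε ^ 2 ≤ K' * ε := mul_le_mul_of_nonneg_left hεsq hK'0
  refine ⟨L, 2 * Q + 2 * ε - M ^ 2 / Q, by linarith, fun c s => ?_, ?_⟩
  -- The quadratic in c is minimized by completing the square at c = S/Q.
  · rw [cylEnergy_twoBubble_sub hμ]
    have h1 := hsup s
    have h0 : 0 < interaction μ (s - L) + interaction μ (s + L) :=
      add_pos (interaction_pos hμ _) (interaction_pos hμ _)
    set S := interaction μ (s - L) + interaction μ (s + L) with hS
    have h2 : S ^ 2 / Q ≤ M ^ 2 / Q := by gcongr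
    have h3 : 0 ≤ (S - c * Q) ^ 2 / Q := by positivity
    have h4 : (S - c * Q) ^ 2 / Q = S ^ 2 / Q - 2 * c * S + c ^ 2 * Q := by
      field_simp; ring
    linarith
  · rw [cylEnergy_twoBubble hμ]
    have hint := le_integral_twoBubble_rpow hμ hL0
    rw [← hp] at hint
    set W : ℝ := ∫ t, |twoBubble μ L t| ^ p with hW
    have hεlow : Real.exp (-(2 * μ * L)) * Q ≤ ε := by
      have h1 := exp_mul_interaction_le hμ 0 (2 * L)
      rw [zero_add, abs_of_nonneg (by linarith), show μ * (2 * L) = 2 * μ * L by ring] at h1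
      exact h1
    -- The remainder e^{-(2μ+1)L} is e^{-L} times e^{-2μL}, and the latter is at most ε/Q.
    have hJ : (1 + p) * (Real.exp (-((2 * μ + 1) * L)) * I) ≤ 2 * p * (1 - θ) * (ε / κ) := by
      have e1 : Real.exp (-((2 * μ + 1) * L)) = Real.exp (-L) * Real.exp (-(2 * μ * L)) := by
        rw [← Real.exp_add]; congr 1; ring
      have h1 := mul_le_mul_of_nonneg_right hLI.le (Real.exp_pos (-(2 * μ * L))).le
      have h2 : P * Real.exp (-(2 * μ * L)) ≤ ε / κ := by
        rw [le_div_iff₀ hκ0]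
        calc _ = Real.exp (-(2 * μ * L)) * (κ * P) := by ring
          _ ≤ ε := by rw [← hQP]; exact hεlow
      have h3 := mul_le_mul_of_nonneg_left h2 hθp.le
      rw [e1]
      linarith
    set x : ℝ := θ * (p * ε / Q) with hx
    have hx0 : 0 ≤ x := by positivity
    have hWP : 2 * (1 + x) ≤ W / P := by
      rw [le_div_iff₀ hP0]
      have e : x * P = θ * p * (ε / κ) := by rw [hx, hQP]; field_simp
      have : 2 * (1 + x) * P = 2 * P + 2 * (θ * p * (ε / κ)) := by rw [← e]; ring
      rw [this]
      linarith
    have hpow : 2 ^ r * (1 + θ * r * x) ≤ (W / P) ^ r := by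
      calc _ ≤ 2 ^ r * (1 + x) ^ r := by
            refine mul_le_mul_of_nonneg_left (one_add_mul_le_rpow hr0.le hx0 hL1.le) (by positivity)
        _ = (2 * (1 + x)) ^ r := (Real.mul_rpow zero_le_two (by linarith)).symm
        _ ≤ _ := Real.rpow_le_rpow (by linarith) hWP hr0.le
    have hQpow := mul_le_mul_of_nonneg_left hpow hQ0.le
    have e2 : Q * (2 ^ r * (1 + θ * r * x)) = 2 ^ r * Q + 2 * A * ε := by
      have : r * p = 2 := by rw [hr]; field_simp
      calc _ = 2 ^ r * Q + 2 ^ r * (θ * θ) * ε * (r * p) * (Q / Q) := by rw [hx]; ring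
        _ = _ := by rw [this, hAθ, div_self hQ0.ne']; ring
    rw [e2] at hQpow
    have hBD := mul_le_mul_of_nonneg_left hD hB0.le
    have hfin : B * (K' * ε ^ 2) < 2 * (A - 1) * ε := by
      have := mul_lt_mul_of_pos_right hL2 hε0
      calc _ = B * K' * ε * ε := by ring
        _ < _ := this
    -- What remains is 2ε - 2Aε < -B K'ε²: the strict gain A > 1 is of first order, the distance
    -- error of second.
    have e3 : B * (Q - K' * ε ^ 2) = 2 * Q - 2 ^ r * Q - B * (K' * ε ^ 2) := by rw [hB]; ring
    linarith

end twoBubble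

variable {N : ℕ}

/-! ### The radial quotients -/

/-- The parameter `σ` with `γ = (1 - σ²) (N-2)²/4`. -/
def emdenScale (N : ℕ) (γ : ℝ) : ℝ :=
  Real.sqrt (((N : ℝ) - 2) ^ 2 / 4 - γ) / (((N : ℝ) - 2) / 2)

section emdenScale

variable {γ : ℝ}

theorem half_sub_pos (hN : 3 ≤ N) : 0 < ((N : ℝ) - 2) / 2 := by
  have h3 : (3 : ℝ) ≤ N := by exact_mod_cast hN
  linarith

theorem emdenScale_pos (hN : 3 ≤ N) (hγ' : γ < ((N : ℝ) - 2) ^ 2 / 4) : 0 < emdenScale N γ :=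
  div_pos (Real.sqrt_pos.mpr (by linarith)) (half_sub_pos hN)

theorem eq_emdenScale (hN : 3 ≤ N) (hγ' : γ < ((N : ℝ) - 2) ^ 2 / 4) :
    γ = (((N : ℝ) - 2) / 2) ^ 2 * (1 - emdenScale N γ ^ 2) := by
  have h := half_sub_pos hN
  have h0 : (N : ℝ) - 2 ≠ 0 := by linarith
  rw [emdenScale, div_pow (Real.sqrt _), Real.sq_sqrt (by linarith)]
  field_simp
  ring

theorem emdenScale_lt_one (hN : 3 ≤ N) (hγ : 0 < γ) (hγ' : γ < ((N : ℝ) - 2) ^ 2 / 4) :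
    emdenScale N γ < 1 := by
  have h := half_sub_pos hN
  have h1 := eq_emdenScale hN hγ'
  have h2 : 0 < 1 - emdenScale N γ ^ 2 := by
    by_contra hneg
    have : (((N : ℝ) - 2) / 2) ^ 2 * (1 - emdenScale N γ ^ 2) ≤ 0 :=
      mul_nonpos_of_nonneg_of_nonpos (by positivity) (not_lt.mp hneg)
    linarith
  nlinarith [emdenScale_pos hN hγ']

theorem emden_zero (hN : 3 ≤ N) (σ : ℝ) (w : ℝ → ℝ) : emden N σ w 0 = 0 := by
  have h := half_sub_pos hN
  rw [emden, norm_zero, Real.zero_rpow (by linarith), zero_mul]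

/-- The exponents are 1 ± σ, and |x|^{1+σ} + |x|^{1-σ} = |x|·2cosh(σ log|x|). -/
theorem profile_eq_emden (hN : 3 ≤ N) (hγ : 0 < γ) (hγ' : γ < ((N : ℝ) - 2) ^ 2 / 4) :
    profile N γ = emden N (emdenScale N γ) (lineBubble (((N : ℝ) - 2) / 2)) := by
  have h := half_sub_pos hN
  have h0 : (N : ℝ) - 2 ≠ 0 := by linarith
  have hσ1 := emdenScale_lt_one hN hγ hγ'
  have hσ0 := emdenScale_pos hN hγ'
  set σ := emdenScale N γ with hσ
  have e0 : Real.sqrt (((N : ℝ) - 2) ^ 2 / 4 - γ) = σ * (((N : ℝ) - 2) / 2) := by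
    rw [hσ, emdenScale]; field_simp
  have ep : 2 * betaPlus N γ / ((N : ℝ) - 2) = 1 + σ := by
    rw [betaPlus, e0]; field_simp
  have em : 2 * betaMinus N γ / ((N : ℝ) - 2) = 1 - σ := by
    rw [betaMinus, e0]; field_simp
  funext x
  rw [profile, ep, em]
  -- At the origin both sides take the value 0: σ < 1 makes both powers of 0 vanish, and division by
  -- 0 returns 0.
  by_cases hx : x = 0
  · subst hx
    rw [emden_zero hN, norm_zero, Real.zero_rpow (by linarith), Real.zero_rpow (by linarith),
      add_zero, Real.zero_rpow h.ne', div_zero]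
  · have hx' : 0 < ‖x‖ := norm_pos_iff.mpr hx
    have e1 : ‖x‖ ^ (1 + σ) + ‖x‖ ^ (1 - σ) = ‖x‖ * (2 * Real.cosh (σ * Real.log ‖x‖)) := by
      rw [Real.cosh_eq, Real.rpow_add hx', Real.rpow_sub hx', Real.rpow_one,
        Real.rpow_def_of_pos hx', Real.exp_neg, mul_comm (Real.log ‖x‖)]
      field_simp
    rw [e1, emden, lineBubble, one_div, ← Real.rpow_neg (by
      have := two_cosh_pos (σ * Real.log ‖x‖); positivity),
      Real.mul_rpow hx'.le (two_cosh_pos _).le]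

/-- Dilation by l is translation by -σ log l. The normalizing constant can stay unevaluated, since
the distance ranges over all multiples. -/
theorem dilatedBubble_eq_emden (hN : 3 ≤ N) (hγ : 0 < γ) (hγ' : γ < ((N : ℝ) - 2) ^ 2 / 4)
    {l : ℝ} (hl : 0 < l) (x : Space N) :
    dilatedBubble N γ l x = 1 / critNorm N (profile N γ) *
      emden N (emdenScale N γ)
        (lineBubbleAt (((N : ℝ) - 2) / 2) (-(emdenScale N γ * Real.log l))) x := by
  rw [dilatedBubble, bubble, mul_left_comm]
  congr 1
  rw [profile_eq_emden hN hγ hγ']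
  by_cases hx : x = 0
  · subst hx
    rw [smul_zero, emden_zero hN, emden_zero hN, mul_zero]
  · have hx' : 0 < ‖x‖ := norm_pos_iff.mpr hx
    rw [emden, emden, norm_smul, Real.norm_of_nonneg hl.le, Real.mul_rpow hl.le hx'.le,
      Real.log_mul hl.ne' hx'.ne', lineBubbleAt, sub_neg_eq_add, mul_add, add_comm (_ * Real.log l),
      ← mul_assoc, ← mul_assoc, ← Real.rpow_add hl]
    simp

theorem emden_sub_mul (σ c : ℝ) (v w : ℝ → ℝ) :
    (fun x : Space N => emden N σ w x - c * emden N σ v x) =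
      emden N σ (w + fun t => -c * v t) := by
  funext x
  simp only [emden, Pi.add_apply]
  ring

end emdenScale

theorem critExp_eq (hN : 3 ≤ N) : critExp N = 2 + 2 / (((N : ℝ) - 2) / 2) := by
  have h := half_sub_pos hN
  have h0 : (N : ℝ) - 2 ≠ 0 := by linarith
  rw [critExp]
  field_simp
  ring

theorem two_div_critExp (hN : 3 ≤ N) : 2 / critExp N = 1 - 2 / (N : ℝ) := by
  have h := half_sub_pos hN
  have h0 : (N : ℝ) - 2 ≠ 0 := by linarith
  have h1 : (N : ℝ) ≠ 0 := by linarith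
  rw [critExp]
  field_simp

/-- The identity behind it is 1 + r² = r·2cosh(log r). -/
theorem sobolevMass_eq_lineBubble (hN : 3 ≤ N) :
    sobolevMass N = sphereConst N * ∫ t, lineBubble (N : ℝ) t := by
  have h := integral_rpow_neg_mul_log hN one_pos (lineBubble (N : ℝ))
  rw [div_one] at h
  rw [← h, sobolevMass]
  refine integral_congr_ae ?_
  filter_upwards [ae_ne_zero hN] with x hx
  have hx' : 0 < ‖x‖ := norm_pos_iff.mpr hx
  rw [one_mul, lineBubble, ← Real.mul_rpow hx'.le (two_cosh_pos _).le, Real.cosh_eq,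
    Real.exp_neg, Real.exp_log hx']
  congr 1
  field_simp
  ring

theorem sharpConst_pos (hN : 3 ≤ N) {σ : ℝ} (hσ : 0 < σ) : 0 < sharpConst N σ := by
  have h := half_sub_pos hN
  have h2 := sobolevMass_pos hN
  have h1 : (0 : ℝ) < N := by linarith
  have h0 : 0 < (N : ℝ) - 2 := by linarith
  rw [sharpConst]
  positivity

/-- Expresses the critical term with the same prefactor as the energy, so the deficit becomes a
quantity on the line. For w the bubble the right side equals its energy: the transport constant is
attained. -/
theorem sharpConst_mul_critNorm_emden_sq (hN : 3 ≤ N) {σ : ℝ} (hσ : 0 < σ) (w : ℝ → ℝ) :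
    sharpConst N σ * critNorm N (emden N σ w) ^ 2 = sphereConst N * σ *
      (interaction (((N : ℝ) - 2) / 2) 0 *
        ((∫ t, |w t| ^ critExp N) / ∫ t, lineBubble (N : ℝ) t) ^ (2 / critExp N)) := by
  have h := half_sub_pos hN
  have hN0 : (0 : ℝ) < N := by linarith
  have hS := sphereConst_pos hN
  rw [critNorm_sq hN, integral_abs_emden_rpow hN hσ, two_div_critExp hN, interaction_zero h,
    show 2 * (((N : ℝ) - 2) / 2) + 2 = N by ring, sharpConst, sobolevMass_eq_lineBubble hN]
  have hP := integral_lineBubble_pos hN0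
  set P := ∫ t, lineBubble (N : ℝ) t with hPdef
  have hW : 0 ≤ ∫ t, |w t| ^ critExp N := integral_nonneg fun t => by positivity
  set W := ∫ t, |w t| ^ critExp N with hWdef
  rw [Real.mul_rpow hS.le hP.le, Real.mul_rpow (by positivity) hW, Real.div_rpow hS.le hσ.le,
    Real.div_rpow hW hP.le]
  have e1 : sphereConst N = sphereConst N ^ (2 / (N : ℝ)) * sphereConst N ^ (1 - 2 / (N : ℝ)) := by
    rw [← Real.rpow_add hS]; simp
  have e2 : P = P ^ (2 / (N : ℝ)) * P ^ (1 - 2 / (N : ℝ)) := by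
    rw [← Real.rpow_add hP]; simp
  have e3 : σ ^ (2 - 2 / (N : ℝ)) = σ * σ ^ (1 - 2 / (N : ℝ)) := by
    rw [mul_comm, ← Real.rpow_add_one hσ.ne']; congr 1; ring
  have p1 : 0 < σ ^ (1 - 2 / (N : ℝ)) := by positivity
  have p2 : 0 < P ^ (1 - 2 / (N : ℝ)) := by positivity
  rw [e3]
  calc _ = N * ((N : ℝ) - 2) * (sphereConst N ^ (2 / (N : ℝ)) * sphereConst N ^ (1 - 2 / (N : ℝ))) *
        P ^ (2 / (N : ℝ)) * σ * W ^ (1 - 2 / (N : ℝ)) := by field_simp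
    _ = N * ((N : ℝ) - 2) * sphereConst N * P ^ (2 / (N : ℝ)) * σ * W ^ (1 - 2 / (N : ℝ)) := by
        rw [← e1]
    _ = N * ((N : ℝ) - 2) * sphereConst N * (P / P ^ (1 - 2 / (N : ℝ))) * σ *
        W ^ (1 - 2 / (N : ℝ)) := by
        congr 3
        rw [eq_div_iff p2.ne']; exact e2.symm
    _ = _ := by field_simp; ring

/-! ### Bounds for the quotients and the two-bubble competitor -/

section quotients

variable {γ : ℝ}

theorem IsEmden.memH1 (hN : 3 ≤ N) {σ : ℝ} (hσ : 0 < σ) {w : ℝ → ℝ}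
    (hw : IsEmden (((N : ℝ) - 2) / 2) w) : MemH1 N (emden N σ w) :=
  ⟨_, hw.hasH1Gradient hN hσ⟩

theorem MemH1.hardySobolev (hN : 3 ≤ N) (hγ : 0 < γ) (hγ' : γ < ((N : ℝ) - 2) ^ 2 / 4)
    {u : Space N → ℝ} (hu : MemH1 N u) :
    sharpConst N (emdenScale N γ) * critNorm N u ^ 2 ≤ energy N γ u := by
  obtain ⟨G, hG⟩ := hu
  exact hG.hardySobolev hN (emdenScale_pos hN hγ') (emdenScale_lt_one hN hγ hγ').le
    (eq_emdenScale hN hγ')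

theorem MemH1.energy_nonneg (hN : 3 ≤ N) (hγ : 0 < γ) (hγ' : γ < ((N : ℝ) - 2) ^ 2 / 4)
    {u : Space N → ℝ} (hu : MemH1 N u) : 0 ≤ energy N γ u :=
  (mul_nonneg (sharpConst_pos hN (emdenScale_pos hN hγ')).le (sq_nonneg _)).trans
    (hu.hardySobolev hN hγ hγ')

/-- The quotient of the bubble, whose critical norm is positive, bounds the admissible constants;
without a bound the real `sSup` would carry no information. -/
theorem bddAbove_bestConst (hN : 3 ≤ N) (hγ' : γ < ((N : ℝ) - 2) ^ 2 / 4) :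
    BddAbove {S : ℝ | ∀ u, MemH1 N u → S * critNorm N u ^ 2 ≤ energy N γ u} := by
  have h := half_sub_pos hN
  have hσ := emdenScale_pos hN hγ'
  have hb := isEmden_lineBubble h
  set U := emden N (emdenScale N γ) (lineBubble (((N : ℝ) - 2) / 2)) with hU
  have h1 := sharpConst_mul_critNorm_emden_sq hN hσ (lineBubble (((N : ℝ) - 2) / 2))
  have hW : 0 < ∫ t, |lineBubble (((N : ℝ) - 2) / 2) t| ^ critExp N := by
    have : ∀ t, |lineBubble (((N : ℝ) - 2) / 2) t| ^ critExp N =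
        lineBubble (((N : ℝ) - 2) / 2 * critExp N) t := fun t => by
      rw [abs_of_pos (lineBubble_pos _ _), lineBubble_rpow]
    simp only [this]
    exact integral_lineBubble_pos (mul_pos h (by linarith [one_le_critExp hN]))
  have hpos : 0 < critNorm N U ^ 2 := by
    have hS := sphereConst_pos hN
    have hI := interaction_zero_pos h
    have hP := integral_lineBubble_pos (by linarith : (0 : ℝ) < N)
    have h2 : 0 < sharpConst N (emdenScale N γ) * critNorm N U ^ 2 := by
      rw [h1]; positivity
    exact pos_of_mul_pos_right h2 (sharpConst_pos hN hσ).le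
  refine ⟨energy N γ U / critNorm N U ^ 2, fun S hS => ?_⟩
  rw [le_div_iff₀ hpos]
  exact hS U (hb.memH1 hN hσ)

/-- Only this inequality is needed, since a larger constant lowers the deficit. -/
theorem sharpConst_le_bestConst (hN : 3 ≤ N) (hγ : 0 < γ) (hγ' : γ < ((N : ℝ) - 2) ^ 2 / 4) :
    sharpConst N (emdenScale N γ) ≤ bestConst N γ :=
  le_csSup (bddAbove_bestConst hN hγ') fun _ hu => hu.hardySobolev hN hγ hγ'

theorem deficit_nonneg (hN : 3 ≤ N) (hγ : 0 < γ) (hγ' : γ < ((N : ℝ) - 2) ^ 2 / 4)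
    {u : Space N → ℝ} (hu : MemH1 N u) : 0 ≤ deficit N γ u := by
  rw [deficit, sub_nonneg]
  -- When the critical norm vanishes, nonnegativity of the energy suffices; otherwise the energy
  -- quotient is an upper bound for all admissible constants, hence for their supremum.
  rcases eq_or_lt_of_le (sq_nonneg (critNorm N u)) with h | h
  · rw [← h, mul_zero]; exact hu.energy_nonneg hN hγ hγ'
  · rw [← le_div_iff₀ h]
    refine csSup_le ⟨_, fun u hu => hu.hardySobolev hN hγ hγ'⟩ fun S hS => ?_
    rw [le_div_iff₀ h]
    exact hS u hu

theorem memH1_sub_dilatedBubble (hN : 3 ≤ N) (hγ : 0 < γ) (hγ' : γ < ((N : ℝ) - 2) ^ 2 / 4)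
    {u : Space N → ℝ} (hu : MemH1 N u) (c : ℝ) {l : ℝ} (hl : 0 < l) :
    MemH1 N (fun x => u x - c * dilatedBubble N γ l x) := by
  obtain ⟨G, hG⟩ := hu
  have h := half_sub_pos hN
  have hb := ((isEmden_lineBubbleAt h (-(emdenScale N γ * Real.log l))).const_mul
    (c * (1 / critNorm N (profile N γ)))).hasH1Gradient hN (emdenScale_pos hN hγ')
  have e : (fun x => u x - c * dilatedBubble N γ l x) = u - emden N (emdenScale N γ)
      (fun t => c * (1 / critNorm N (profile N γ)) *
        lineBubbleAt (((N : ℝ) - 2) / 2) (-(emdenScale N γ * Real.log l)) t) := by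
    funext x
    rw [dilatedBubble_eq_emden hN hγ hγ' hl]
    simp only [Pi.sub_apply, emden]
    ring
  rw [e]
  exact ⟨_, hG.sub hN hb⟩

theorem bddBelow_distSq (hN : 3 ≤ N) (hγ : 0 < γ) (hγ' : γ < ((N : ℝ) - 2) ^ 2 / 4)
    {u : Space N → ℝ} (hu : MemH1 N u) :
    BddBelow (range fun p : ℝ × Ioi (0 : ℝ) =>
      energy N γ (fun x => u x - p.1 * dilatedBubble N γ (p.2 : ℝ) x)) := by
  refine ⟨0, ?_⟩
  rintro _ ⟨p, rfl⟩
  exact (memH1_sub_dilatedBubble hN hγ hγ' hu p.1 p.2.2).energy_nonneg hN hγ hγ'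

theorem distSq_nonneg (hN : 3 ≤ N) (hγ : 0 < γ) (hγ' : γ < ((N : ℝ) - 2) ^ 2 / 4)
    {u : Space N → ℝ} (hu : MemH1 N u) : 0 ≤ distSq N γ u :=
  Real.iInf_nonneg fun p =>
    (memH1_sub_dilatedBubble hN hγ hγ' hu p.1 p.2.2).energy_nonneg hN hγ hγ'

theorem energy_eq_zero_of_ae_eq_zero (hN : 3 ≤ N) {u : Space N → ℝ} (hu : u =ᵐ[volume] 0) :
    energy N γ u = 0 := by
  have h : HasH1Gradient N u 0 := by
    refine ⟨(memLp_congr_ae hu).mpr MemLp.zero, MemLp.zero, fun _ => 0, fun _ =>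
      ⟨contDiff_const, HasCompactSupport.zero⟩, ?_, ?_⟩
    · have : eLpNorm u (ENNReal.ofReal (critExp N)) volume = 0 := by
        rw [eLpNorm_congr_ae hu, eLpNorm_zero]
      simp [this]
    · have : gradient (0 : Space N → ℝ) = 0 := by
        funext x
        simp [gradient]
      simp [this]
  rw [h.energy_eq hN]
  have e : ∫ x, ‖‖x‖⁻¹ * u x‖ ^ 2 = 0 := by
    refine integral_eq_zero_of_ae ?_
    filter_upwards [hu] with x hx
    simp [hx]
  rw [e]
  simp

/-- Used contrapositively: the positive distance of the two-bubble function shows that it is not an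
extremizer. -/
theorem distSq_eq_zero_of_isExtremizer (hN : 3 ≤ N) (hγ : 0 < γ)
    (hγ' : γ < ((N : ℝ) - 2) ^ 2 / 4) {u : Space N → ℝ} (hu : MemH1 N u)
    (h : IsExtremizer N γ u) : distSq N γ u = 0 := by
  obtain ⟨c, l, hl, hul⟩ := h
  refine le_antisymm ?_ (distSq_nonneg hN hγ hγ' hu)
  refine (ciInf_le (bddBelow_distSq hN hγ hγ' hu) (c, ⟨l, hl⟩)).trans (le_of_eq ?_)
  refine energy_eq_zero_of_ae_eq_zero hN ?_
  filter_upwards [hul] with x hx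
  simp [hx]

theorem exists_radialQuotient_lt (hN : 3 ≤ N) (hγ : 0 < γ) (hγ' : γ < ((N : ℝ) - 2) ^ 2 / 4) :
    ∃ q ∈ radialQuotients N γ, q < 2 - (2 : ℝ) ^ (2 / critExp N) := by
  have h := half_sub_pos hN
  have hσ := emdenScale_pos hN hγ'
  have hS := sphereConst_pos hN
  obtain ⟨L, D, hD, hdist, hdef⟩ := exists_twoBubble h
  rw [← critExp_eq hN] at hdef
  set σ := emdenScale N γ with hσdef
  set μ : ℝ := ((N : ℝ) - 2) / 2 with hμ
  have hw := isEmden_twoBubble h L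
  set u := emden N σ (twoBubble μ L) with hu
  have huH : MemH1 N u := hw.memH1 hN hσ
  -- Subtracting a dilated bubble from the competitor is subtracting a multiple of a translated line
  -- bubble, so the bound D holds uniformly in c and l.
  have hdistSq : sphereConst N * σ * D ≤ distSq N γ u := by
    refine le_ciInf fun p => ?_
    obtain ⟨c, l, hl⟩ := p
    have hl : 0 < l := hl
    simp only [dilatedBubble_eq_emden hN hγ hγ' hl]
    rw [← hσdef, ← hμ]
    simp only [← mul_assoc]
    rw [emden_sub_mul, (hw.add ((isEmden_lineBubbleAt h _).const_mul _)).energy_eq hN hσ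
      (eq_emdenScale hN hγ')]
    exact mul_le_mul_of_nonneg_left (hdist _ _) (by positivity)
  have hdist0 : 0 < distSq N γ u := lt_of_lt_of_le (by positivity) hdistSq
  have hB : 0 < 2 - (2 : ℝ) ^ (2 / critExp N) := by
    have h1 : 2 / critExp N < 1 := by
      rw [two_div_critExp hN]
      have : 0 < 2 / (N : ℝ) := div_pos two_pos (by linarith)
      linarith
    have := Real.rpow_lt_rpow_of_exponent_lt (one_lt_two : (1 : ℝ) < 2) h1
    rw [Real.rpow_one] at this
    linarith
  have hdeficit : deficit N γ u < (2 - (2 : ℝ) ^ (2 / critExp N)) * distSq N γ u := by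
    have h1 : deficit N γ u ≤ energy N γ u - sharpConst N σ * critNorm N u ^ 2 := by
      rw [deficit]
      have := mul_le_mul_of_nonneg_right (sharpConst_le_bestConst hN hγ hγ')
        (sq_nonneg (critNorm N u))
      linarith
    rw [hw.energy_eq hN hσ (eq_emdenScale hN hγ'), sharpConst_mul_critNorm_emden_sq hN hσ] at h1
    rw [show 2 * μ + 2 = (N : ℝ) by rw [hμ]; ring] at hdef
    have h2 := mul_lt_mul_of_pos_left hdef (mul_pos hS hσ)
    have h3 := mul_le_mul_of_nonneg_left hdistSq hB.le
    linarith
  refine ⟨_, ⟨u, huH, ⟨fun r => r ^ (-μ) * twoBubble μ L (σ * Real.log r), EventuallyEq.rfl⟩,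
    fun hex => hdist0.ne' (distSq_eq_zero_of_isExtremizer hN hγ hγ' huH hex), rfl⟩, ?_⟩
  rwa [div_lt_iff₀ hdist0]

theorem bddBelow_radialQuotients (hN : 3 ≤ N) (hγ : 0 < γ) (hγ' : γ < ((N : ℝ) - 2) ^ 2 / 4) :
    BddBelow (radialQuotients N γ) := by
  refine ⟨0, ?_⟩
  rintro q ⟨u, hu, -, -, rfl⟩
  exact div_nonneg (deficit_nonneg hN hγ hγ' hu) (distSq_nonneg hN hγ hγ' hu)

end quotients

end HardySobolev

end

theorem mainTheorem5 (N : ℕ) (hN : 3 ≤ N) (γ : ℝ) (hγ : 0 < γ)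
    (hγ' : γ < ((N : ℝ) - 2) ^ 2 / 4) :
    IsGLB (HardySobolev.radialQuotients N γ) (HardySobolev.radialBianchiEgnell N γ) ∧
      HardySobolev.radialBianchiEgnell N γ <
        2 - (2 : ℝ) ^ (2 / HardySobolev.critExp N) := by
  obtain ⟨q, hq, hlt⟩ := HardySobolev.exists_radialQuotient_lt hN hγ hγ'
  have hbdd := HardySobolev.bddBelow_radialQuotients hN hγ hγ'
  exact ⟨isGLB_csInf ⟨q, hq⟩ hbdd, (csInf_le hbdd hq).trans_lt hlt⟩
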